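/- **Setting.** Alice and Bob are connected by $n=2t+1$ parallel two-way channels, at most $t$ of which are controlled by a computationally unbounded, possibly randomized adversary Eve, who in each round reads the data sent over her channels and replaces it arbitrarily. A two-round protocol (Bob to Alice, then Alice to Bob) is *reliable* if in every execution Bob outputs the secret, and *private* if the distribution of Eve's view (her random choices and everything sent over her channels) does not depend on the secret. A code with parameters $[n,k,d]_q$ is a linear code of length $n$, dimension $k$ and minimum Hamming distance $d$ over $\mathbb F_q$; it is MDS if $d=n+1-k$. Elements of $\mathbb F_q$ are counted as $\lceil\log_2 q\rceil$ bits, both when they are sent and in the size of the secret; $w_H$ is the Hamming weight. **Protocol data.** A prime power $q>n$; an MDS code $\mathcal C$ with parameters $[n,t+1,t+1]_q$ with parity-check matrix $\mathbf H\in\mathbb F_q^{t\times n}$; a vector $\mathbf h\in\mathbb F_q^n$ such that for $\mathbf x\in\mathcal C$ the value $\mathbf h\mathbf x^T$ is completely undetermined when at most $t$ symbols of $\mathbf x$ are known; for each $m\le t$ an MDS code $\mathcal C_m$ with parameters $[n,m+1,n-m]_q$ with a linear encoder; a list of $n$ distinct elements of $\mathbb F_q$. *Broadcast* means sending the same symbol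 over all channels (the receiver takes the majority). *$m$-generalized broadcast* of symbols means cutting them into blocks of $m+1$ (padding with zeros), encoding each block in $\mathcal C_m$ and sending the $i$-th symbol of each codeword over channel $i$; a receiver who knows a set of at least $m$ corrupted channels treats these as erasures and decodes. **The improved protocol** for a secret $(s^{(1)},\dots,s^{(\ell)})\in\mathbb F_q^\ell$. I. Bob chooses $t+\ell+1$ independent uniform codewords $\mathbf x^{(j)}\in\mathcal C$ and sends the $i$-th symbol of each over channel $i$. Alice receives words $\mathbf y^{(j)}$. II. Alice lets $I$ be the set of all $j$ such that $\mathbf H(\mathbf y^{(j)})^T$ is not in the span of the syndromes $\mathbf H(\mathbf y^{(i)})^T$, $i<j$ (so $\{\mathbf y^{(i)}\}_{i\in I}$ is a *pseudo-basis*: its syndromes form a basis of the span of all syndromes). Put $w=|I|$. Decoding a word $\mathbf y$ means finding the (unique) $\tilde{\mathbf e}$ with $w_H(\tilde{\mathbf e})\le t/2$ and $\mathbf y-\tilde{\mathbf e}\in\mathcal C$, if it exists. (i) She computes a special word $\mathbf y=\sum_{i\in I}\mu_i\mathbf y^{(i)}$: if some $\mathbf y^{(i)}$, $i\in I$, cannot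 be decoded, it is the first such $\mathbf y^{(i)}$; otherwise, if some decoded error $\tilde{\mathbf e}^{(i)}$ has weight $>t/3$, it is the first such $\mathbf y^{(i)}$; otherwise, starting from $\tilde{\mathbf f}=\tilde{\mathbf e}^{(i)}$ and $\mathbf y=\mathbf y^{(i)}$ for the first $i\in I$, she runs through the other $i\in I$ in order, replaces $\tilde{\mathbf f}$ by $\tilde{\mathbf f}+\lambda\tilde{\mathbf e}^{(i)}$ and $\mathbf y$ by $\mathbf y+\lambda\mathbf y^{(i)}$, where $\lambda\ne0$ is the first element of the list for which no coordinate in the support of $\tilde{\mathbf f}$ becomes $0$, and stops as soon as $w_H(\tilde{\mathbf f})>t/3$ (for $I=\emptyset$ the special word is $0$). She broadcasts $I$, $(\mu_i)_{i\in I}$ and $\mathbf y$, and sends the words $\mathbf y^{(i)}$, $i\in I$, by $\min(w,\lceil t/3\rceil)$-generalized broadcast. (ii) For the first $\ell$ words outside $I$, renamed $\mathbf y^{(1)},\dots,\mathbf y^{(\ell)}$, she sends all syndromes $\mathbf H(\mathbf y^{(j)})^T$ together by $\lceil t/2\rceil$-generalized broadcast, and broadcasts $z_1^{(j)}=s^{(j)}+\mathbf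 h(\mathbf y^{(j)})^T$ and $z_2^{(j)}=s^{(j)}+\mathbf h(\mathbf y^{(j)}-\tilde{\mathbf e}^{(j)})^T$ (with $z_2^{(j)}=0$ if $\mathbf y^{(j)}$ cannot be decoded). III. Bob takes the support of $\mathbf y-\sum_{i\in I}\mu_i\mathbf x^{(i)}$ as known corrupted channels, recovers the pseudo-basis, and computes $\mathcal S=\bigcup_{i\in I}\mathrm{supp}(\mathbf y^{(i)}-\mathbf x^{(i)})$. If $|\mathcal S|\ge t/2$, he recovers the syndromes (with $\mathcal S$ as known corrupted channels), from each the unique error $\mathbf e^{(j)}$ supported in $\mathcal S$ with that syndrome, and outputs $z_1^{(j)}-\mathbf h(\mathbf x^{(j)}+\mathbf e^{(j)})^T$; otherwise he outputs $z_2^{(j)}-\mathbf h(\mathbf x^{(j)})^T$. A one-bit secret is sent as $s^{(1)}\in\{0,1\}\subset\mathbb F_q$ with $\ell=1$. **Theorem.** 1. For all $t,\ell\ge0$, all $q>n=2t+1$ and all protocol data, the protocol is reliable and private, and so is its version for a one-bit secret. 2. For every $q>n$ there are protocol data in which $\mathcal C$ and all $\mathcal C_m$ are Reed–Solomon codes (with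 the listed elements as evaluation points), and for every $n=2t+1$ there is a prime power $q=2^k$ with $n<q\le 2n$. 3. (Communication complexity.) For every $\kappa$ there is a constant $c$ such that for all $t\ge1$ and $n<q\le\kappa n$, at most $c\,n^2\log n$ bits are transmitted in every execution for a one-bit secret. 4. (Transmission rate.) There is an absolute constant $c$ such that for all $t\ge0$, $\ell\ge1$, $q>n$, in every execution the number of transmitted bits divided by the bit size of the secret is at most $5n+c\,n^2/\ell$. Consequently, for every $\varepsilon>0$ there is $c$ such that this ratio is at most $c\,n$ whenever $\ell\ge\varepsilon n$; and for every $\kappa$ there is $c$ such that for all $t\ge1$ and $n<q\le\kappa n$ a rate of at most $c\,n$ is reached for some secret length of at most $c\,n\log n$ bits. 5. (Computation.) With Reed–Solomon codes, Alice's computation and both of Bob's computations are carried out by fixed programs, not depending on $n$, $\ell$ or the field, whose number of steps is bounded by a polynomial in $n$ and $\ell$; a step is an operation or zero test in $\mathbb F_q$, or an elementary operation on list structures (building or taking apart a cell, a test for the empty list, one pass of a loop through a list). The protocol data and Bob's random field elements are inputs of the programs. -/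

import Mathlib

namespace PSMT

/-! ### Two-round message transmission over `n` channels -/

/-- A two-round protocol over `n` parallel channels. First round: Bob, using his coins, sends
`send u i : A` to Alice over channel `i`. Second round: Alice, holding the secret and what she
received, sends `reply s y i : B` over channel `i`. Bob then computes his output from his coins and
what he received. `bitsA`, `bitsB` are the bit lengths of what is sent over one channel. -/
structure TwoRound (n : ℕ) (Coins Secret A B : Type) where
  send : Coins → Fin n → A
  reply : Secret → (Fin n → A) → Fin n → B
  output : Coins → (Fin n → B) → Secret
  bitsA : A → ℕ
  bitsB : B → ℕ

/-- A (deterministic, computationally unbounded) adversary who reads and overwrites the data on at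
most `t` channels. In each round she sees the data sent over her channels before she replaces it, and
she remembers the first round in the second. -/
structure Adversary (n t : ℕ) (A B : Type) where
  corrupted : Finset (Fin n)
  card_le : corrupted.card ≤ t
  tamper₁ : (corrupted → A) → corrupted → A
  tamper₂ : (corrupted → A) → (corrupted → B) → corrupted → B

namespace TwoRound

variable {n t : ℕ} {Coins Secret A B : Type}

/-- What Alice receives in the first round. -/
def received₁ (P : TwoRound n Coins Secret A B) (E : Adversary n t A B) (u : Coins) : Fin n → A :=
  fun i => if hi : i ∈ E.corrupted then E.tamper₁ (fun j => P.send u j) ⟨i, hi⟩ else P.send u i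

/-- What Alice sends in the second round. -/
def sent₂ (P : TwoRound n Coins Secret A B) (E : Adversary n t A B) (s : Secret) (u : Coins) :
    Fin n → B :=
  P.reply s (P.received₁ E u)

/-- What Bob receives in the second round. -/
def received₂ (P : TwoRound n Coins Secret A B) (E : Adversary n t A B) (s : Secret) (u : Coins) :
    Fin n → B :=
  fun i => if hi : i ∈ E.corrupted then
      E.tamper₂ (fun j => P.send u j) (fun j => P.sent₂ E s u j) ⟨i, hi⟩
    else P.sent₂ E s u i

/-- What the adversary sees: the data sent over her channels in the two rounds. -/
def view (P : TwoRound n Coins Secret A B) (E : Adversary n t A B) (s : Secret) (u : Coins) :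
    (E.corrupted → A) × (E.corrupted → B) :=
  (fun j => P.send u j, fun j => P.sent₂ E s u j)

/-- Total number of bits sent by Bob and Alice in one execution. -/
def transmittedBits (P : TwoRound n Coins Secret A B) (E : Adversary n t A B) (s : Secret)
    (u : Coins) : ℕ :=
  ∑ i, P.bitsA (P.send u i) + ∑ i, P.bitsB (P.sent₂ E s u i)

/-- Perfect reliability: Bob always outputs the secret. -/
def IsReliable (P : TwoRound n Coins Secret A B) (t : ℕ) : Prop :=
  ∀ (E : Adversary n t A B) (s : Secret) (u : Coins), P.output u (P.received₂ E s u) = s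

/-- Perfect privacy: for Bob's coins uniform and every randomized adversary (a distribution `μ` on
deterministic ones, independent of Bob's coins), the joint law of the adversary's random choice and
of her view does not depend on the secret. -/
def IsPrivate (P : TwoRound n Coins Secret A B) (t : ℕ) [Fintype Coins] [Nonempty Coins] : Prop :=
  ∀ (μ : PMF (Adversary n t A B)) (s s' : Secret),
    (μ.bind fun E => (PMF.uniformOfFintype Coins).map fun u =>
      (⟨E, P.view E s u⟩ : Σ E : Adversary n t A B, (E.corrupted → A) × (E.corrupted → B))) =
    (μ.bind fun E => (PMF.uniformOfFintype Coins).map fun u =>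
      (⟨E, P.view E s' u⟩ : Σ E : Adversary n t A B, (E.corrupted → A) × (E.corrupted → B)))

/-- In every execution at most `N` bits are transmitted. -/
def CommunicationAtMost (P : TwoRound n Coins Secret A B) (t : ℕ) (N : ℝ) : Prop :=
  ∀ (E : Adversary n t A B) (s : Secret) (u : Coins), (P.transmittedBits E s u : ℝ) ≤ N

/-- In every execution the ratio of transmitted bits to the bit size `k` of the secret is at most
`ρ`. -/
def RateAtMost (P : TwoRound n Coins Secret A B) (t : ℕ) (k : ℕ) (ρ : ℝ) : Prop :=
  ∀ (E : Adversary n t A B) (s : Secret) (u : Coins), (P.transmittedBits E s u : ℝ) / (k : ℝ) ≤ ρ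

end TwoRound

/-! ### Codes -/

/-- The injective linear encoder `g : F^k → F^n` generates an MDS code: its image has minimum
distance `n + 1 - k`. -/
def IsMDS {F : Type} [Field F] [DecidableEq F] {k n : ℕ} (g : (Fin k → F) →ₗ[F] (Fin n → F)) :
    Prop :=
  Function.Injective g ∧
    IsLeast {d : ℕ | ∃ x ∈ LinearMap.range g, x ≠ 0 ∧ hammingNorm x = d} (n + 1 - k)

/-- Reed–Solomon encoder: a polynomial of degree `< k`, given by its coefficients, is evaluated at
the points `α i`. -/
def rsEncoder {F : Type} [Field F] {n : ℕ} (α : Fin n → F) (k : ℕ) :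
    (Fin k → F) →ₗ[F] (Fin n → F) :=
  Matrix.mulVecLin (Matrix.of fun (i : Fin n) (j : Fin k) => α i ^ (j : ℕ))

/-- The public data of the protocol for `n = 2t+1` channels. -/
structure Setup (F : Type) [Field F] [DecidableEq F] (t : ℕ) where
  /-- encoder of the code `C` with parameters `[n, t+1, t+1]` -/
  gen : (Fin (t + 1) → F) →ₗ[F] (Fin (2 * t + 1) → F)
  gen_mds : IsMDS gen
  /-- parity-check matrix of `C` -/
  H : Matrix (Fin t) (Fin (2 * t + 1)) F
  H_spec : ∀ x, H.mulVec x = 0 ↔ x ∈ LinearMap.range gen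
  /-- `h x` is completely undetermined when `t` symbols of the codeword `x` are known -/
  h : Fin (2 * t + 1) → F
  h_spec : ∀ T : Finset (Fin (2 * t + 1)), T.card ≤ t → ∀ x ∈ LinearMap.range gen, ∀ a : F,
    ∃ x' ∈ LinearMap.range gen, (∀ i ∈ T, x' i = x i) ∧ dotProduct h x' = a
  /-- encoders of the codes `C_m` with parameters `[n, m+1, n-m]` for generalized broadcast -/
  bgen : (m : ℕ) → (Fin (m + 1) → F) →ₗ[F] (Fin (2 * t + 1) → F)
  bgen_mds : ∀ m ≤ t, IsMDS (bgen m)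
  /-- distinct field elements among which Alice searches for the multipliers she needs -/
  pts : Fin (2 * t + 1) → F
  pts_injective : Function.Injective pts

/-- All codes of the setup are the Reed–Solomon codes on the same evaluation points. -/
def Setup.IsReedSolomon {F : Type} [Field F] [DecidableEq F] {t : ℕ} (S : Setup F t) : Prop :=
  S.gen = rsEncoder S.pts (t + 1) ∧ ∀ m ≤ t, S.bgen m = rsEncoder S.pts (m + 1)

noncomputable section

variable {F : Type} [Field F] [DecidableEq F] {t ℓ : ℕ}

/-! ### Broadcast and generalized broadcast -/

open scoped Classical in
/-- The value received on more than `t` channels, if there is one. -/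
def majority {X : Type} {n : ℕ} (t : ℕ) (v : Fin n → X) : Option X :=
  if hx : ∃ x, t < (Finset.univ.filter fun i => v i = x).card then some hx.choose else none

/-- `⌈N / (m+1)⌉`, the number of codewords of `C_m` needed for `N` symbols. -/
def numBlocks (N m : ℕ) : ℕ := (N + m) / (m + 1)

/-- The entries of an `a × b` array, row after row, followed by zeros. -/
def flatten {a b : ℕ} (M : Fin a → Fin b → F) (p : ℕ) : F :=
  if hp : p < a * b then
    M (finProdFinEquiv.symm ⟨p, hp⟩).1 (finProdFinEquiv.symm ⟨p, hp⟩).2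
  else 0

/-- `m`-generalized broadcast of an array: its entries are cut into blocks of `m+1` symbols, each
block is encoded in `C_m`, and channel `i` carries the `i`-th symbol of each codeword. -/
def genBroadcast (S : Setup F t) (m : ℕ) {a b : ℕ} (M : Fin a → Fin b → F) (i : Fin (2 * t + 1)) :
    Fin (numBlocks (a * b) m) → F :=
  fun k => S.bgen m (fun c => flatten M (k * (m + 1) + c)) i

open scoped Classical in
/-- Decoding of `C_m` when the channels in `K` are known to be corrupted: the message whose codeword
differs from the received word in at most `t - |K|` positions outside `K`. It is unique if
`m ≤ |K| ≤ t`; outside this case the value is `0`. -/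
def genDecode (S : Setup F t) (m : ℕ) (K : Finset (Fin (2 * t + 1))) (v : Fin (2 * t + 1) → F) :
    Fin (m + 1) → F :=
  if hc : m ≤ K.card ∧ K.card ≤ t ∧
      ∃ c : Fin (m + 1) → F, (Kᶜ.filter fun i => S.bgen m c i ≠ v i).card ≤ t - K.card then
    hc.2.2.choose
  else 0

/-- Recovery of an array sent by `m`-generalized broadcast; `v i k` is the `k`-th symbol received on
channel `i`. -/
def genReceive (S : Setup F t) (m : ℕ) (K : Finset (Fin (2 * t + 1)))
    (v : Fin (2 * t + 1) → ℕ → F) (a b : ℕ) : Fin a → Fin b → F :=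
  fun i j =>
    genDecode S m K (fun c => v c ((finProdFinEquiv (i, j) : ℕ) / (m + 1)))
      (Fin.ofNat (m + 1) (finProdFinEquiv (i, j) : ℕ))

/-! ### Alice's computations -/

open scoped Classical in
/-- Index set of a pseudo-basis of the words `y`: the words whose syndrome is not in the span of the
syndromes of the preceding words. -/
def pseudoBasis (S : Setup F t) {r : ℕ} (y : Fin r → Fin (2 * t + 1) → F) : Finset (Fin r) :=
  Finset.univ.filter fun j =>
    S.H.mulVec (y j) ∉ Submodule.span F ((fun i => S.H.mulVec (y i)) '' {i | i < j})

open scoped Classical in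
/-- Unique decoding in `C`: the error `e` of weight at most `t/2` with `y - e ∈ C`, if it exists. -/
def decodeError (S : Setup F t) (y : Fin (2 * t + 1) → F) : Option (Fin (2 * t + 1) → F) :=
  if he : ∃ e : Fin (2 * t + 1) → F, 2 * hammingNorm e ≤ t ∧ y - e ∈ LinearMap.range S.gen then
    some he.choose
  else none

/-- A nonzero `a` such that `f + a e` vanishes nowhere on the support of `f`. -/
def pickMultiplier (S : Setup F t) (f e : Fin (2 * t + 1) → F) : F :=
  ((List.ofFn S.pts).find? fun a => decide (a ≠ 0 ∧ ∀ j, f j ≠ 0 → f j + a * e j ≠ 0)).getD 1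

/-- The main loop of the search for the special word: `f` is the current combination of the decoded
errors `e i`, `c` its coefficient vector; stop as soon as `f` has weight greater than `t/3`. -/
def combine (S : Setup F t) {r : ℕ} (e : Fin r → Fin (2 * t + 1) → F) :
    List (Fin r) → (Fin (2 * t + 1) → F) → (Fin r → F) → (Fin r → F)
  | [], _, c => c
  | i :: L, f, c =>
    let a := pickMultiplier S f (e i)
    let f' := f + a • e i
    let c' := c + Pi.single i a
    if t < 3 * hammingNorm f' then c' else combine S e L f' c'

/-- Coefficients, on the words of the pseudo-basis `I`, of the special word. -/
def specialCoeff (S : Setup F t) {r : ℕ} (y : Fin r → Fin (2 * t + 1) → F) (I : Finset (Fin r)) :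
    Fin r → F :=
  let L := I.sort (· ≤ ·)
  let e : Fin r → Fin (2 * t + 1) → F := fun i => (decodeError S (y i)).getD 0
  match L.find? fun i => (decodeError S (y i)).isNone with
  | some i => Pi.single i 1
  | none =>
    match L.find? fun i => decide (t < 3 * hammingNorm (e i)) with
    | some i => Pi.single i 1
    | none =>
      match L with
      | [] => 0
      | i :: L' => combine S e L' (e i) (Pi.single i 1)

/-- Index of the `j`-th word outside the pseudo-basis. -/
def remaining (I : Finset (Fin (t + ℓ + 1))) (j : Fin ℓ) : Fin (t + ℓ + 1) :=
  (Iᶜ.sort (· ≤ ·)).getD j 0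

/-- With a pseudo-basis of size `w`, its words are sent by `min(w, ⌈t/3⌉)`-generalized broadcast. -/
def basisLevel (t w : ℕ) : ℕ := min w ((t + 2) / 3)

/-- The syndromes are sent by `⌈t/2⌉`-generalized broadcast. -/
def syndromeLevel (t : ℕ) : ℕ := (t + 1) / 2

/-- The part of Alice's message sent by ordinary broadcast (identically over all channels). -/
structure Public (F : Type) (t ℓ : ℕ) where
  /-- indices of the pseudo-basis -/
  I : Finset (Fin (t + ℓ + 1))
  /-- coefficients of the special word -/
  coeff : I → F
  /-- the special word -/
  special : Fin (2 * t + 1) → F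
  /-- the masked secrets -/
  mask₁ : Fin ℓ → F
  mask₂ : Fin ℓ → F

/-- Alice's message over one channel. -/
structure Reply (F : Type) (t ℓ : ℕ) where
  pub : Public F t ℓ
  /-- generalized broadcast of the pseudo-basis -/
  basis : Fin (numBlocks (pub.I.card * (2 * t + 1)) (basisLevel t pub.I.card)) → F
  /-- generalized broadcast of the syndromes -/
  syn : Fin (numBlocks (ℓ * t) (syndromeLevel t)) → F

/-- The words as received by Alice, from the symbols received on each channel. -/
def words {r n : ℕ} (y : Fin n → Fin r → F) : Fin r → Fin n → F := fun j i => y i j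

/-- The part of Alice's message sent by ordinary broadcast. -/
def alicePublic (S : Setup F t) (s : Fin ℓ → F) (y : Fin (t + ℓ + 1) → Fin (2 * t + 1) → F) :
    Public F t ℓ where
  I := pseudoBasis S y
  coeff := fun i => specialCoeff S y (pseudoBasis S y) i
  special := ∑ i ∈ pseudoBasis S y, specialCoeff S y (pseudoBasis S y) i • y i
  mask₁ := fun j => s j + dotProduct S.h (y (remaining (pseudoBasis S y) j))
  mask₂ := fun j =>
    match decodeError S (y (remaining (pseudoBasis S y) j)) with
    | some e => s j + dotProduct S.h (y (remaining (pseudoBasis S y) j) - e)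
    | none => 0

/-- Alice's messages. -/
def aliceReply (S : Setup F t) (s : Fin ℓ → F) (y : Fin (2 * t + 1) → Fin (t + ℓ + 1) → F)
    (i : Fin (2 * t + 1)) : Reply F t ℓ where
  pub := alicePublic S s (words y)
  basis := genBroadcast S _
    (fun a => words y ((pseudoBasis S (words y)).orderEmbOfFin rfl a)) i
  syn := genBroadcast S (syndromeLevel t)
    (fun j => S.H.mulVec (words y (remaining (pseudoBasis S (words y)) j))) i

/-! ### Bob's computations -/

/-- The `k`-th symbol of the generalized broadcast of the pseudo-basis on one channel. -/
def Reply.basisSymbol (z : Reply F t ℓ) (k : ℕ) : F :=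
  if hk : k < numBlocks (z.pub.I.card * (2 * t + 1)) (basisLevel t z.pub.I.card) then
    z.basis ⟨k, hk⟩ else 0

/-- The `k`-th symbol of the generalized broadcast of the syndromes on one channel. -/
def Reply.synSymbol (z : Reply F t ℓ) (k : ℕ) : F :=
  if hk : k < numBlocks (ℓ * t) (syndromeLevel t) then z.syn ⟨k, hk⟩ else 0

open scoped Classical in
/-- The error with support in `K` and given syndrome (unique if `|K| ≤ t`; otherwise `0`). -/
def errorOfSyndrome (S : Setup F t) (K : Finset (Fin (2 * t + 1))) (σ : Fin t → F) :
    Fin (2 * t + 1) → F :=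
  if he : K.card ≤ t ∧ ∃ e : Fin (2 * t + 1) → F, (∀ i ∉ K, e i = 0) ∧ S.H.mulVec e = σ then
    he.2.choose
  else 0

/-- The channels on which the error of the special word is nonzero. -/
def specialSupport (x : Fin (t + ℓ + 1) → Fin (2 * t + 1) → F) (p : Public F t ℓ) :
    Finset (Fin (2 * t + 1)) :=
  Finset.univ.filter fun c => (p.special - ∑ i : p.I, p.coeff i • x i) c ≠ 0

/-- The global support of the errors on the pseudo-basis, as computed by Bob. -/
def globalSupport (S : Setup F t) (x : Fin (t + ℓ + 1) → Fin (2 * t + 1) → F) (p : Public F t ℓ)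
    (z : Fin (2 * t + 1) → Reply F t ℓ) : Finset (Fin (2 * t + 1)) :=
  Finset.univ.filter fun c => ∃ a : Fin p.I.card,
    genReceive S (basisLevel t p.I.card) (specialSupport x p) (fun i => (z i).basisSymbol)
      p.I.card (2 * t + 1) a c - x (p.I.orderEmbOfFin rfl a) c ≠ 0

/-- Bob's output, from his codewords `x` and what he received. -/
def bobOutput (S : Setup F t) (x : Fin (t + ℓ + 1) → Fin (2 * t + 1) → F)
    (z : Fin (2 * t + 1) → Reply F t ℓ) : Fin ℓ → F :=
  match majority t fun i => (z i).pub with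
  | none => 0
  | some p => fun j =>
    let K := globalSupport S x p z
    let xj := x (remaining p.I j)
    if t ≤ 2 * K.card then
      p.mask₁ j - dotProduct S.h (xj + errorOfSyndrome S K
        (genReceive S (syndromeLevel t) K (fun i => (z i).synSymbol) ℓ t j))
    else p.mask₂ j - dotProduct S.h xj

/-! ### The protocol -/

/-- Number of bits of a field element. -/
def symbolBits (F : Type) [Fintype F] : ℕ := Nat.clog 2 (Fintype.card F)

/-- Number of bits of Alice's message over one channel: the size of the pseudo-basis, the indices of
its elements, and field elements. -/
def Reply.bits [Fintype F] (z : Reply F t ℓ) : ℕ :=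
  Nat.clog 2 (t + ℓ + 2) + z.pub.I.card * Nat.clog 2 (t + ℓ + 1) +
    (z.pub.I.card + (2 * t + 1) + 2 * ℓ +
      numBlocks (z.pub.I.card * (2 * t + 1)) (basisLevel t z.pub.I.card) +
      numBlocks (ℓ * t) (syndromeLevel t)) * symbolBits F

/-- The improved protocol for `ℓ` secret field elements. Bob's coins are `t+ℓ+1` uniform messages,
whose encodings are independent uniform codewords of `C`. -/
def protocol [Fintype F] (S : Setup F t) (ℓ : ℕ) :
    TwoRound (2 * t + 1) (Fin (t + ℓ + 1) → Fin (t + 1) → F) (Fin ℓ → F)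
      (Fin (t + ℓ + 1) → F) (Reply F t ℓ) where
  send := fun u i j => S.gen (u j) i
  reply := fun s y i => aliceReply S s y i
  output := fun u z => bobOutput S (fun j => S.gen (u j)) z
  bitsA := fun _ => (t + ℓ + 1) * symbolBits F
  bitsB := Reply.bits

/-- The improved protocol used for a single-bit secret, sent as the field element `0` or `1`. -/
def bitProtocol [Fintype F] (S : Setup F t) :
    TwoRound (2 * t + 1) (Fin (t + 1 + 1) → Fin (t + 1) → F) Bool
      (Fin (t + 1 + 1) → F) (Reply F t 1) where
  send := (protocol S 1).send
  reply := fun s => (protocol S 1).reply fun _ => if s then 1 else 0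
  output := fun u z => decide ((protocol S 1).output u z 0 = 1)
  bitsA := (protocol S 1).bitsA
  bitsB := (protocol S 1).bitsB

end

/-! ### Computation model

A uniform model of computation with a step count. Data are binary trees (list structures) whose
leaves are `nil` or field elements. One step builds or takes apart a `cons` cell, tests for `nil`,
performs one field operation or tests a field element for `0`; the only loop runs once through a
list. A program mentions neither the field nor the number of channels. -/

inductive Data (F : Type) where
  | nil : Data F
  | elt : F → Data F
  | cons : Data F → Data F → Data F

inductive Prog where
  /-- the input itself -/
  | id : Prog
  /-- the constant `nil` -/
  | nil : Prog
  /-- the constants `0` and `1` of the field -/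
  | zero : Prog
  | one : Prog
  /-- components of a `cons` cell -/
  | fst : Prog
  | snd : Prog
  /-- a `cons` cell of two results on the same input -/
  | pair : Prog → Prog → Prog
  /-- `comp f g`: run `g`, then `f` on the result -/
  | comp : Prog → Prog → Prog
  /-- `cond c f g`: if the result of `c` is `nil` run `f`, otherwise run `g` -/
  | cond : Prog → Prog → Prog → Prog
  /-- field operations on a pair of elements, or on one element -/
  | add : Prog
  | mul : Prog
  | neg : Prog
  | inv : Prog
  /-- `nil` on the field element `0`, not `nil` on other field elements -/
  | isZero : Prog
  /-- on input `cons l a`: for each item `d` of the list `l` in turn, replace the state `a` by the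
  result of the body on `cons d a` -/
  | fold : Prog → Prog

section

variable {F : Type}

/-- `Data.fold step l (a, c)`: state `a` and step count `c` after running through the list `l`. -/
def Data.fold (step : Data F → Data F × ℕ) : Data F → Data F × ℕ → Data F × ℕ
  | .cons d l, (a, c) => Data.fold step l ((step (.cons d a)).1, c + (step (.cons d a)).2 + 1)
  | .nil, ac => ac
  | .elt _, ac => ac

/-- Result and number of steps of a program on an input. -/
def Prog.run [Field F] [DecidableEq F] : Prog → Data F → Data F × ℕ
  | .id, d => (d, 1)
  | .nil, _ => (.nil, 1)
  | .zero, _ => (.elt 0, 1)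
  | .one, _ => (.elt 1, 1)
  | .fst, .cons a _ => (a, 1)
  | .fst, _ => (.nil, 1)
  | .snd, .cons _ b => (b, 1)
  | .snd, _ => (.nil, 1)
  | .pair f g, d => (.cons (f.run d).1 (g.run d).1, (f.run d).2 + (g.run d).2 + 1)
  | .comp f g, d => ((f.run (g.run d).1).1, (g.run d).2 + (f.run (g.run d).1).2 + 1)
  | .cond c f g, d =>
    match (c.run d).1 with
    | .nil => ((f.run d).1, (c.run d).2 + (f.run d).2 + 1)
    | _ => ((g.run d).1, (c.run d).2 + (g.run d).2 + 1)
  | .add, .cons (.elt a) (.elt b) => (.elt (a + b), 1)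
  | .add, _ => (.nil, 1)
  | .mul, .cons (.elt a) (.elt b) => (.elt (a * b), 1)
  | .mul, _ => (.nil, 1)
  | .neg, .elt a => (.elt (-a), 1)
  | .neg, _ => (.nil, 1)
  | .inv, .elt a => (.elt a⁻¹, 1)
  | .inv, _ => (.nil, 1)
  | .isZero, .elt a => (if a = 0 then .nil else .cons .nil .nil, 1)
  | .isZero, _ => (.nil, 1)
  | .fold f, .cons l a => Data.fold f.run l (a, 1)
  | .fold _, _ => (.nil, 1)

/-- A list as data. -/
def Data.ofList : List (Data F) → Data F
  | [] => .nil
  | d :: l => .cons d (Data.ofList l)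

/-- A natural number in unary. -/
def Data.ofNat (k : ℕ) : Data F := Data.ofList (List.replicate k .nil)

def Data.ofBool : Bool → Data F
  | false => .nil
  | true => .cons .nil .nil

/-- A finite family as the list of the encodings of its members. -/
def Data.ofFamily {X : Type} {k : ℕ} (enc : X → Data F) (v : Fin k → X) : Data F :=
  Data.ofList (List.ofFn fun i => enc (v i))

/-- A vector as the list of its entries. -/
def Data.ofVec {k : ℕ} (v : Fin k → F) : Data F := Data.ofFamily .elt v

/-- The public data: `t` and `ℓ` in unary, the points, the vector `h` and the parity-check matrix. -/
def Setup.toData [Field F] [DecidableEq F] {t : ℕ} (S : Setup F t) (ℓ : ℕ) : Data F :=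
  Data.ofList [Data.ofNat t, Data.ofNat ℓ, Data.ofVec S.pts, Data.ofVec S.h,
    Data.ofFamily Data.ofVec fun i => S.H i]

/-- A message of Alice over one channel as data. -/
def Reply.toData [Field F] {t ℓ : ℕ} (z : Reply F t ℓ) : Data F :=
  Data.ofList [Data.ofFamily Data.ofBool fun j => decide (j ∈ z.pub.I),
    Data.ofVec fun j => if hj : j ∈ z.pub.I then z.pub.coeff ⟨j, hj⟩ else 0,
    Data.ofVec z.pub.special, Data.ofVec z.pub.mask₁, Data.ofVec z.pub.mask₂,
    Data.ofVec z.basis, Data.ofVec z.syn]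

end

/-- The programs `bob₁`, `alice`, `bob₂` carry out the three computations of the improved protocol
with setup `S`, each in at most `N` steps on every input. -/
def Implements (bob₁ alice bob₂ : Prog) {F : Type} [Field F] [Fintype F] [DecidableEq F] {t : ℕ}
    (S : Setup F t) (ℓ N : ℕ) : Prop :=
  (∀ u : Fin (t + ℓ + 1) → Fin (t + 1) → F,
    let out := bob₁.run (.cons (S.toData ℓ) (Data.ofFamily Data.ofVec u))
    out.1 = Data.ofFamily Data.ofVec ((protocol S ℓ).send u) ∧ out.2 ≤ N) ∧
  (∀ (s : Fin ℓ → F) (y : Fin (2 * t + 1) → Fin (t + ℓ + 1) → F),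
    let out := alice.run (.cons (S.toData ℓ) (.cons (Data.ofVec s) (Data.ofFamily Data.ofVec y)))
    out.1 = Data.ofFamily Reply.toData ((protocol S ℓ).reply s y) ∧ out.2 ≤ N) ∧
  (∀ (u : Fin (t + ℓ + 1) → Fin (t + 1) → F) (z : Fin (2 * t + 1) → Reply F t ℓ),
    let out := bob₂.run (.cons (S.toData ℓ)
      (.cons (Data.ofFamily Data.ofVec u) (Data.ofFamily Reply.toData z)))
    out.1 = Data.ofVec ((protocol S ℓ).output u z) ∧ out.2 ≤ N)

end PSMT

/-! Reliability. Let `T` be the set of at most `t` corrupted channels. All errors `y - x` live on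
`T`, and as the code has distance `t + 1`, an error on `T` is determined by its syndrome. So linear
relations between syndromes are relations between errors, and every error vanishes where those on
the pseudo-basis vanish (`error_eq_zero`). Bob recovers the pseudo-basis once he knows `m` corrupted
channels for the level `m` in use (`genDecode_eq`), and the special word supplies them
(`basisLevel_le_weight`). An undecodable word has an error of weight above `t / 2`. A decoded
combination of weight between `t / 3` and `2t / 3` is either the true error or differs from it by a
nonzero codeword, and then the true weight exceeds `t / 3` as well. If the search ends without
passing `t / 3`, the supports have piled up without cancellation, and independence of the syndromes
makes their union at least as large as the pseudo-basis. Finally, the global support is either large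
enough to read the syndromes, or so small that Alice's own decoding was right (`bobOutput_eq`).

Privacy. Apart from the masks, Alice's message depends only on syndromes and on words of the
pseudo-basis. Adding to each masking word a codeword that vanishes on the corrupted channels and has
value `s - s'` under `h` is a bijection of Bob's coins that turns executions with secret `s` into
executions with secret `s'` and the same view (`shiftCoins_bijective`, `view_shiftCoins`).

Communication. Per channel, `ℓ` symbols are needed for the words, `2ℓ` for the masks, about `2ℓ` for
the syndromes and `O(n)` for the rest (`bits_le`).

Computation. Decoding is reduced to linear systems, for Reed–Solomon codes by the method of
Berlekamp and Welch. Programs are evaluated under a common bound on the length of loops, and the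
number of steps is then a polynomial in that bound (`Prog.run_of_eval`). -/

namespace PSMT

/-! ### Evaluation of programs with a bound on the length of loops -/

section Evaluation

variable {F : Type}

/-- Loop through a list of at most `k` items. -/
def Data.foldO (step : Data F → Option (Data F)) : ℕ → Data F → Data F → Option (Data F)
  | _, .nil, a => some a
  | _, .elt _, a => some a
  | 0, .cons _ _, _ => none
  | k + 1, .cons d l, a => (step (.cons d a)).bind fun b => Data.foldO step k l b

/-- Case distinction between `nil` and other data. -/
def Data.ifNil {X : Type} (d : Data F) (x y : X) : X :=
  match d with
  | .nil => x
  | _ => y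

/-- The result of a program, if every loop it executes has at most `N` passes. -/
def Prog.eval [Field F] [DecidableEq F] (N : ℕ) : Prog → Data F → Option (Data F)
  | .pair f g, d => (f.eval N d).bind fun a => (g.eval N d).bind fun b => some (.cons a b)
  | .comp f g, d => (g.eval N d).bind fun a => f.eval N a
  | .cond c f g, d => (c.eval N d).bind fun a => a.ifNil (f.eval N d) (g.eval N d)
  | .fold f, .cons l a => Data.foldO (f.eval N) N l a
  | .fold _, _ => some .nil
  | p, d => some (p.run d).1

/-- Bound for the number of steps of a program all of whose loops have at most `N` passes. -/
def Prog.cost {R : Type} [CommSemiring R] (N : R) : Prog → R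
  | .pair f g => f.cost N + g.cost N + 1
  | .comp f g => g.cost N + f.cost N + 1
  | .cond c f g => c.cost N + f.cost N + g.cost N + 1
  | .fold f => N * (f.cost N + 1) + 1
  | _ => 1

/-- The cost is built from sums and products, so it can be formed once in a polynomial ring and then
evaluated at `n` and `ℓ`. -/
theorem Prog.map_cost {R R' : Type} [CommSemiring R] [CommSemiring R'] (φ : R →+* R') (N : R)
    (p : Prog) : φ (p.cost N) = p.cost (φ N) := by
  induction p <;> simp [Prog.cost, *]

theorem Data.fold_of_foldO {step : Data F → Option (Data F)} {run : Data F → Data F × ℕ} {c : ℕ}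
    (h : ∀ d r, step d = some r → (run d).1 = r ∧ (run d).2 ≤ c) (k : ℕ) (l a r : Data F)
    (b : ℕ) (hr : Data.foldO step k l a = some r) :
    (Data.fold run l (a, b)).1 = r ∧ (Data.fold run l (a, b)).2 ≤ b + k * (c + 1) := by
  induction k generalizing l a b with
  | zero =>
    cases l <;> simp [Data.foldO] at hr <;> simp [Data.fold, hr]
  | succ k ih =>
    cases l with
    | nil => simp [Data.foldO] at hr; simp [Data.fold, hr]
    | elt x => simp [Data.foldO] at hr; simp [Data.fold, hr]
    | cons d l =>
      simp only [Data.foldO, Option.bind_eq_some_iff] at hr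
      obtain ⟨a', h1, h2⟩ := hr
      obtain ⟨h3, h4⟩ := h _ _ h1
      have := ih l a' (b + (run (.cons d a)).2 + 1) h2
      simp only [Data.fold, h3]
      refine ⟨this.1, this.2.trans ?_⟩
      have : (k + 1) * (c + 1) = k * (c + 1) + c + 1 := by ring
      omega

/-- Reduces every claim about running time to correctness: once evaluation with loops bounded by `N`
succeeds, the number of steps is bounded in terms of the program text and `N` alone. -/
theorem Prog.run_of_eval [Field F] [DecidableEq F] {N : ℕ} (p : Prog) (d r : Data F)
    (h : p.eval N d = some r) : (p.run d).1 = r ∧ (p.run d).2 ≤ p.cost N := by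
  induction p generalizing d r with
  | pair f g ihf ihg =>
    simp only [Prog.eval, Option.bind_eq_some_iff, Option.some.injEq] at h
    obtain ⟨a, ha, b, hb, rfl⟩ := h
    obtain ⟨h1, h2⟩ := ihf _ _ ha
    obtain ⟨h3, h4⟩ := ihg _ _ hb
    simp only [Prog.run, Prog.cost, h1, h3, true_and]
    omega
  | comp f g ihf ihg =>
    simp only [Prog.eval, Option.bind_eq_some_iff] at h
    obtain ⟨a, ha, hb⟩ := h
    obtain ⟨h1, h2⟩ := ihg _ _ ha
    obtain ⟨h3, h4⟩ := ihf _ _ hb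
    simp only [Prog.run, Prog.cost, h1, h3, true_and]
    omega
  | cond c f g ihc ihf ihg =>
    simp only [Prog.eval, Option.bind_eq_some_iff] at h
    obtain ⟨a, ha, hb⟩ := h
    obtain ⟨h1, h2⟩ := ihc _ _ ha
    cases a with
    | nil =>
      obtain ⟨h3, h4⟩ := ihf _ _ hb
      simp only [Prog.run, Prog.cost, h1, h3, true_and]
      omega
    | elt x =>
      obtain ⟨h3, h4⟩ := ihg _ _ hb
      simp only [Prog.run, Prog.cost, h1, h3, true_and]
      omega
    | cons x y =>
      obtain ⟨h3, h4⟩ := ihg _ _ hb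
      simp only [Prog.run, Prog.cost, h1, h3, true_and]
      omega
  | fold f ih =>
    cases d with
    | nil => simp [Prog.eval] at h; simp [Prog.run, Prog.cost, h]
    | elt x => simp [Prog.eval] at h; simp [Prog.run, Prog.cost, h]
    | cons l a =>
      simp only [Prog.eval] at h
      have := Data.fold_of_foldO ih N l a r 1 h
      simp only [Prog.run, Prog.cost]
      refine ⟨this.1, this.2.trans ?_⟩
      omega
  | _ =>
    simp only [Prog.eval, Option.some.injEq] at h
    refine ⟨h, ?_⟩
    -- A primitive operation inspects at most the top cell and its two components.
    rcases d with _ | _ | ⟨_ | _ | _, _ | _ | _⟩ <;> simp [Prog.run, Prog.cost]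

end Evaluation

/-! ### Programs with named variables

The input of a program is read as an environment `cons v₀ (cons v₁ …)`. -/

section Encodings

variable {F : Type}

@[simp] theorem Data.ifNil_nil {X : Type} (x y : X) : (Data.nil : Data F).ifNil x y = x := rfl

@[simp] theorem Data.ifNil_cons {X : Type} (a b : Data F) (x y : X) :
    (Data.cons a b).ifNil x y = y := rfl

@[simp] theorem Data.ifNil_ofBool {X : Type} (b : Bool) (x y : X) :
    (Data.ofBool b : Data F).ifNil x y = if b = true then y else x := by
  cases b <;> rfl

/-- The list of the members of a finite family of data. -/
abbrev Data.fam {k : ℕ} (d : Fin k → Data F) : Data F := Data.ofList (List.ofFn d)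

theorem Data.ofNat_zero : (Data.ofNat 0 : Data F) = .nil := rfl

theorem Data.ofNat_succ (k : ℕ) : (Data.ofNat (k + 1) : Data F) = .cons .nil (Data.ofNat k) := rfl

@[simp] theorem Data.ifNil_ofNat {X : Type} (k : ℕ) (x y : X) :
    (Data.ofNat k : Data F).ifNil x y = if k = 0 then x else y := by
  cases k <;> rfl

theorem Data.fam_succ {k : ℕ} (d : Fin (k + 1) → Data F) :
    Data.fam d = .cons (d 0) (Data.fam fun i => d i.succ) := by
  simp [Data.fam, List.ofFn_succ, Data.ofList]

theorem Data.foldO_ofList {X σ : Type} {step : Data F → Option (Data F)} {enc : X → Data F}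
    {encS : σ → Data F} {f : σ → X → σ} (k : ℕ) (L : List X) (s : σ) (hL : L.length ≤ k)
    (h : ∀ x ∈ L, ∀ s, step (.cons (enc x) (encS s)) = some (encS (f s x))) :
    Data.foldO step k (Data.ofList (L.map enc)) (encS s) = some (encS (L.foldl f s)) := by
  induction L generalizing k s with
  | nil => cases k <;> rfl
  | cons x L ih =>
    cases k with
    | zero => simp at hL
    | succ k =>
      simp only [List.map_cons, Data.ofList, Data.foldO, h x (by simp), Option.bind_some,
        List.foldl_cons]
      exact ih k (f s x) (by simpa using hL) fun y hy => h y (by simp [hy])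

end Encodings

section Language

variable {F : Type} [Field F] [DecidableEq F] {N : ℕ}

@[simp] theorem eval_pair (f g : Prog) (d : Data F) : (Prog.pair f g).eval N d =
    (f.eval N d).bind fun a => (g.eval N d).bind fun b => some (.cons a b) := rfl

@[simp] theorem eval_comp (f g : Prog) (d : Data F) : (Prog.comp f g).eval N d =
    (g.eval N d).bind fun a => f.eval N a := rfl

@[simp] theorem eval_cond (c f g : Prog) (d : Data F) : (Prog.cond c f g).eval N d =
    (c.eval N d).bind fun a => a.ifNil (f.eval N d) (g.eval N d) := rfl

@[simp] theorem eval_id (d : Data F) : Prog.id.eval N d = some d := rfl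

@[simp] theorem eval_nil (d : Data F) : Prog.nil.eval N d = some .nil := rfl

@[simp] theorem eval_zero (d : Data F) : Prog.zero.eval N d = some (.elt 0) := rfl

@[simp] theorem eval_one (d : Data F) : Prog.one.eval N d = some (.elt 1) := rfl

@[simp] theorem eval_fst (a b : Data F) : Prog.fst.eval N (.cons a b) = some a := rfl

@[simp] theorem eval_snd (a b : Data F) : Prog.snd.eval N (.cons a b) = some b := rfl

@[simp] theorem eval_add (a b : F) :
    Prog.add.eval N (.cons (.elt a) (.elt b)) = some (.elt (a + b)) := rfl

@[simp] theorem eval_mul (a b : F) :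
    Prog.mul.eval N (.cons (.elt a) (.elt b)) = some (.elt (a * b)) := rfl

@[simp] theorem eval_neg (a : F) : Prog.neg.eval N (.elt a) = some (.elt (-a)) := rfl

@[simp] theorem eval_inv (a : F) : Prog.inv.eval N (.elt a) = some (.elt a⁻¹) := rfl

@[simp] theorem eval_isZero (a : F) :
    Prog.isZero.eval N (.elt a) = some (Data.ofBool (decide (a ≠ 0))) := by
  by_cases h : a = 0 <;> simp [Prog.eval, Prog.run, h, Data.ofBool]

/-- The variable number `k` of the environment. -/
def V : ℕ → Prog
  | 0 => .fst
  | k + 1 => .comp (V k) .snd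

@[simp] theorem eval_V_zero (a b : Data F) : (V 0).eval N (.cons a b) = some a := rfl

@[simp] theorem eval_V_succ (k : ℕ) (a b : Data F) :
    (V (k + 1)).eval N (.cons a b) = (V k).eval N b := rfl

/-- The value of `e` becomes variable `0` of `b`. -/
def letE (e b : Prog) : Prog := .comp b (.pair e .id)

@[simp] theorem eval_letE (e b : Prog) (ρ : Data F) :
    (letE e b).eval N ρ = (e.eval N ρ).bind fun d => b.eval N (.cons d ρ) := by
  simp [letE, Option.bind_assoc]

theorem eval_letE_of {e b : Prog} {ρ d : Data F} {r : Option (Data F)} (he : e.eval N ρ = some d)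
    (hb : b.eval N (.cons d ρ) = r) : (letE e b).eval N ρ = r := by
  simp [he, hb]

def addE (a b : Prog) : Prog := .comp .add (.pair a b)

@[simp] theorem eval_addE (a b : Prog) (ρ : Data F) : (addE a b).eval N ρ =
    (a.eval N ρ).bind fun x => (b.eval N ρ).bind fun y => Prog.add.eval N (.cons x y) := by
  simp [addE, Option.bind_assoc]

def mulE (a b : Prog) : Prog := .comp .mul (.pair a b)

@[simp] theorem eval_mulE (a b : Prog) (ρ : Data F) : (mulE a b).eval N ρ =
    (a.eval N ρ).bind fun x => (b.eval N ρ).bind fun y => Prog.mul.eval N (.cons x y) := by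
  simp [mulE, Option.bind_assoc]

def subE (a b : Prog) : Prog := addE a (.comp .neg b)

@[simp] theorem eval_subE (a b : Prog) (ρ : Data F) : (subE a b).eval N ρ =
    (a.eval N ρ).bind fun x => (b.eval N ρ).bind fun y =>
      (Prog.neg.eval N y).bind fun z => Prog.add.eval N (.cons x z) := by
  simp [subE, Option.bind_assoc]

/-- `foldE l i b`: loop through the list `l`, starting from the state `i`; in the body `b` the item
is variable `0` and the state is variable `1`. -/
def foldE (l i b : Prog) : Prog :=
  .comp .fst (.comp (.fold (.pair b (.comp .snd .snd))) (.pair l (.pair i .id)))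

theorem eval_foldE {X σ : Type} {enc : X → Data F} {encS : σ → Data F} (f : σ → X → σ)
    {l i b : Prog} {ρ : Data F} {L : List X} {s : σ}
    (hl : l.eval N ρ = some (Data.ofList (L.map enc))) (hi : i.eval N ρ = some (encS s))
    (hL : L.length ≤ N)
    (hb : ∀ x ∈ L, ∀ s, b.eval N (.cons (enc x) (.cons (encS s) ρ)) = some (encS (f s x))) :
    (foldE l i b).eval N ρ = some (encS (L.foldl f s)) := by
  -- A loop body sees only the item and the state, so the environment `ρ` travels in the state.
  have key := Data.foldO_ofList (step := (Prog.pair b (.comp .snd .snd)).eval N) (enc := enc)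
    (encS := fun s => Data.cons (encS s) ρ) (f := f) N L s hL
    (fun x hx s => by simp [hb x hx s])
  have : (Prog.fold (Prog.pair b (.comp .snd .snd))).eval N
      (.cons (Data.ofList (L.map enc)) (.cons (encS s) ρ)) = _ := key
  simp [foldE, hl, hi, this]

/-- The program `b` after removal of variable `1`. -/
def skipState (b : Prog) : Prog := .comp b (.pair .fst (.comp .snd .snd))

@[simp] theorem eval_skipState (b : Prog) (x s ρ : Data F) :
    (skipState b).eval N (.cons x (.cons s ρ)) = b.eval N (.cons x ρ) := by
  simp [skipState]

/-- Loops extend lists at the head, so the lists they collect come out backwards and have to be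
reversed at the end. -/
def revP : Prog := foldE .fst .nil (.pair (V 0) (V 1))

theorem eval_revP {L : List (Data F)} (hL : L.length ≤ N) (ρ : Data F) :
    revP.eval N (.cons (Data.ofList L) ρ) = some (Data.ofList L.reverse) := by
  have := eval_foldE (N := N) (enc := fun x => x) (encS := Data.ofList (F := F))
    (fun (s : List (Data F)) x => x :: s) (l := .fst) (i := .nil) (b := .pair (V 0) (V 1))
    (ρ := .cons (Data.ofList L) ρ) (L := L) (s := []) (by simp) rfl hL (by simp [Data.ofList])
  rw [revP, this, ← List.foldr_reverse]
  simp

/-- The list of the values of `b` on the items of `l`. -/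
def mapE (l b : Prog) : Prog :=
  .comp revP (.pair (foldE l .nil (.pair (skipState b) (V 1))) .nil)

theorem eval_mapE {X : Type} {enc : X → Data F} {g : X → Data F} {l b : Prog} {ρ : Data F}
    {L : List X} (hl : l.eval N ρ = some (Data.ofList (L.map enc))) (hL : L.length ≤ N)
    (hb : ∀ x ∈ L, b.eval N (.cons (enc x) ρ) = some (g x)) :
    (mapE l b).eval N ρ = some (Data.ofList (L.map g)) := by
  have := eval_foldE (N := N) (enc := enc) (encS := Data.ofList (F := F))
    (fun (s : List (Data F)) x => g x :: s) (l := l) (i := .nil) (b := .pair (skipState b) (V 1))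
    (ρ := ρ) (L := L) (s := []) hl rfl hL (fun x hx s => by simp [hb x hx, Data.ofList])
  have h2 : L.foldl (fun (s : List (Data F)) x => g x :: s) [] = (L.map g).reverse := by
    rw [← List.foldl_map (f := g) (g := fun (s : List (Data F)) x => x :: s), ← List.foldr_reverse]
    simp
  rw [h2] at this
  simp only [mapE, eval_comp, eval_pair, this, Option.bind_some, eval_nil]
  rw [eval_revP (by simpa using hL)]
  simp

theorem eval_mapE_fam {k : ℕ} {d g : Fin k → Data F} {l b : Prog} {ρ : Data F}
    (hl : l.eval N ρ = some (Data.fam d)) (hk : k ≤ N)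
    (hb : ∀ i, b.eval N (.cons (d i) ρ) = some (g i)) :
    (mapE l b).eval N ρ = some (Data.fam g) := by
  have := eval_mapE (enc := d) (g := g) (L := List.finRange k) (b := b) (l := l) (N := N) (ρ := ρ)
    (by simpa [Data.fam, List.ofFn_eq_map] using hl) (by simpa using hk) (fun i _ => hb i)
  simpa [Data.fam, List.ofFn_eq_map] using this

/-- The length of a list. -/
def lenE (l : Prog) : Prog := mapE l .nil

theorem eval_lenE_fam {k : ℕ} {d : Fin k → Data F} {l : Prog} {ρ : Data F}
    (hl : l.eval N ρ = some (Data.fam d)) (hk : k ≤ N) :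
    (lenE l).eval N ρ = some (Data.ofNat k) := by
  rw [lenE, eval_mapE_fam hl hk (g := fun _ => .nil) (by simp)]
  simp [Data.ofNat, Data.fam]

/-- The list of the numbers less than `k`. -/
def rangeE (k : Prog) : Prog :=
  .comp revP (.pair (.comp .snd
    (foldE k (.pair .nil .nil)
      (.pair (.pair .nil (.comp .fst (V 1))) (.pair (.comp .fst (V 1)) (.comp .snd (V 1)))))) .nil)

theorem eval_rangeE {k : ℕ} {e : Prog} {ρ : Data F} (he : e.eval N ρ = some (Data.ofNat k))
    (hk : k ≤ N) :
    (rangeE e).eval N ρ = some (Data.ofList ((List.finRange k).map fun i : Fin k => Data.ofNat i)) := by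
  -- Invariant: after `s` passes the state is the number `s` together with the numbers below `s`,
  -- largest first.
  have := eval_foldE (N := N) (enc := fun x : Data F => x)
    (encS := fun s : ℕ => Data.cons (Data.ofNat s)
      (Data.ofList ((List.range s).map fun i => Data.ofNat i).reverse))
    (fun (s : ℕ) _ => s + 1) (l := e) (i := .pair .nil .nil)
    (b := .pair (.pair .nil (.comp .fst (V 1))) (.pair (.comp .fst (V 1)) (.comp .snd (V 1))))
    (ρ := ρ) (L := List.replicate k .nil) (s := 0) (by simpa [Data.ofNat] using he)
    (by simp [Data.ofNat, Data.ofList]) (by simpa using hk)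
    (fun x hx s => by simp [Data.ofNat_succ, List.range_succ, Data.ofList])
  have h2 : (List.replicate k (Data.nil : Data F)).foldl (fun (s : ℕ) _ => s + 1) 0 = k := by
    rw [List.foldl_const]; simp
  rw [h2] at this
  simp only [rangeE, eval_comp, eval_pair, this, Option.bind_some, eval_snd, eval_nil]
  rw [eval_revP (by simpa using hk), List.reverse_reverse]
  congr 2
  rw [← List.map_coe_finRange_eq_range, List.map_map]
  rfl

/-- The list of the values of `b` on the numbers less than `k`. -/
def tabE (k b : Prog) : Prog := mapE (rangeE k) b

theorem eval_tabE {k : ℕ} {g : Fin k → Data F} {e b : Prog} {ρ : Data F}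
    (he : e.eval N ρ = some (Data.ofNat k)) (hk : k ≤ N)
    (hb : ∀ i : Fin k, b.eval N (.cons (Data.ofNat i) ρ) = some (g i)) :
    (tabE e b).eval N ρ = some (Data.fam g) := by
  rw [tabE, eval_mapE (eval_rangeE he hk) (by simpa using hk) (fun i _ => hb i),
    Data.fam, List.ofFn_eq_map]

/-- The sum of the values of `b` on the numbers less than `k`. -/
def sumE (k b : Prog) : Prog := foldE (rangeE k) .zero (addE (V 1) (skipState b))

theorem eval_sumE {k : ℕ} {g : Fin k → F} {e b : Prog} {ρ : Data F}
    (he : e.eval N ρ = some (Data.ofNat k)) (hk : k ≤ N)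
    (hb : ∀ i : Fin k, b.eval N (.cons (Data.ofNat i) ρ) = some (.elt (g i))) :
    (sumE e b).eval N ρ = some (.elt (∑ i, g i)) := by
  rw [sumE, eval_foldE (encS := Data.elt) (fun (s : F) i => s + g i) (eval_rangeE he hk)
    (s := 0) (by simp) (by simpa using hk) (fun i _ s => by simp [hb i]), Fin.sum_univ_def,
    List.sum_eq_foldl, List.foldl_map]

/-- The number of the `i` less than `k` for which the value of `b` is not `nil`. -/
def countE (k b : Prog) : Prog :=
  foldE (rangeE k) .nil (.cond (skipState b) (V 1) (.pair .nil (V 1)))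

theorem eval_countE {k : ℕ} {p : Fin k → Bool} {e b : Prog} {ρ : Data F}
    (he : e.eval N ρ = some (Data.ofNat k)) (hk : k ≤ N)
    (hb : ∀ i : Fin k, b.eval N (.cons (Data.ofNat i) ρ) = some (Data.ofBool (p i))) :
    (countE e b).eval N ρ = some (Data.ofNat (Finset.univ.filter fun i => p i = true).card) := by
  rw [countE, eval_foldE (encS := Data.ofNat) (fun (s : ℕ) i => s + if p i = true then 1 else 0)
    (eval_rangeE he hk) (s := 0) (by simp [Data.ofNat_zero]) (by simpa using hk) (fun i _ s => by
      cases h : p i <;> simp [hb i, h, Data.ofNat_succ]),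
    Finset.card_filter, Fin.sum_univ_def, List.sum_eq_foldl, List.foldl_map]

/-- Whether the value of `b` is not `nil` for some `i` less than `k`. -/
def anyE (k b : Prog) : Prog := .cond (countE k b) .nil (.pair .nil .nil)

theorem eval_anyE {k : ℕ} {p : Fin k → Bool} {e b : Prog} {ρ : Data F}
    (he : e.eval N ρ = some (Data.ofNat k)) (hk : k ≤ N)
    (hb : ∀ i : Fin k, b.eval N (.cons (Data.ofNat i) ρ) = some (Data.ofBool (p i))) :
    (anyE e b).eval N ρ = some (Data.ofBool (decide (∃ i, p i = true))) := by
  simp only [anyE, eval_cond, eval_countE he hk hb, Option.bind_some, Data.ifNil_ofNat,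
    Finset.card_eq_zero, Finset.filter_eq_empty_iff]
  by_cases h : ∃ i, p i = true
  · rw [if_neg (by simpa using h)]; simp [h, Data.ofBool]
  · rw [if_pos (by simpa using h)]; simp [h, Data.ofBool]

def notE (b : Prog) : Prog := .cond b (.pair .nil .nil) .nil

@[simp] theorem eval_notE (b : Prog) (ρ : Data F) : (notE b).eval N ρ =
    (b.eval N ρ).bind fun d => some (Data.ofBool (d.ifNil true false)) := by
  simp only [notE, eval_cond]
  congr 1; funext d; cases d <;> rfl

/-- The numbers less than `k` for which the value of `b` is not `nil`. -/
def filterE (k b : Prog) : Prog :=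
  .comp revP (.pair
    (foldE (rangeE k) .nil (.cond (skipState b) (V 1) (.pair (V 0) (V 1)))) .nil)

theorem eval_filterE {k : ℕ} {p : Fin k → Bool} {e b : Prog} {ρ : Data F}
    (he : e.eval N ρ = some (Data.ofNat k)) (hk : k ≤ N)
    (hb : ∀ i : Fin k, b.eval N (.cons (Data.ofNat i) ρ) = some (Data.ofBool (p i))) :
    (filterE e b).eval N ρ =
      some (Data.ofList (((List.finRange k).filter p).map fun i : Fin k => Data.ofNat i)) := by
  have := eval_foldE (N := N)
    (encS := fun s : List (Fin k) => Data.ofList (F := F) (s.map fun i : Fin k => Data.ofNat i))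
    (fun s i => if p i = true then i :: s else s)
    (b := .cond (skipState b) (V 1) (.pair (V 0) (V 1))) (i := .nil)
    (eval_rangeE he hk) (s := []) (by simp [Data.ofList]) (by simpa using hk) (fun i _ s => by
      cases h : p i <;> simp [hb i, h, Data.ofList])
  have h2 : ∀ (L : List (Fin k)) (s : List (Fin k)),
      L.foldl (fun s i => if p i = true then i :: s else s) s = (L.filter p).reverse ++ s := by
    intro L
    induction L with
    | nil => simp
    | cons x L ih => intro s; cases h : p x <;> simp [ih, h]
  rw [h2] at this
  simp only [filterE, eval_comp, eval_pair, this, Option.bind_some, eval_nil]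
  rw [eval_revP (by
    have := List.length_filter_le p (List.finRange k)
    simp at this ⊢; omega)]
  simp

/-- The entry of the list `l` with number `i`. -/
def nthE (l i : Prog) : Prog := .comp .fst (foldE i l (.comp .snd (V 1)))

/-- A number in unary is itself a list and serves as a loop counter: the entry with number `k` is
reached by taking `k` tails. -/
theorem foldl_drop {X : Type} (k : ℕ) (L : List X) :
    (List.replicate k ()).foldl (fun (s : List X) _ => s.tail) L = L.drop k := by
  induction k generalizing L with
  | zero => simp
  | succ k ih => simp [List.replicate_succ, ih]

theorem eval_drop {l i : Prog} {ρ : Data F} {L : List (Data F)} {k : ℕ}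
    (hl : l.eval N ρ = some (Data.ofList L)) (hi : i.eval N ρ = some (Data.ofNat k)) (hk : k ≤ N) :
    (foldE i l (.comp .snd (V 1))).eval N ρ = some (Data.ofList (L.drop k)) := by
  rw [eval_foldE (enc := fun _ : Unit => Data.nil) (encS := Data.ofList (F := F))
    (fun s _ => s.tail) (L := List.replicate k ()) (s := L) (by simpa [Data.ofNat] using hi) hl
    (by simpa using hk), foldl_drop]
  intro _ _ s
  cases s
  · rfl
  · simp [Data.ofList]

theorem eval_nthE_getD {l i : Prog} {ρ : Data F} {L : List (Data F)} {k : ℕ}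
    (hl : l.eval N ρ = some (Data.ofList L)) (hi : i.eval N ρ = some (Data.ofNat k)) (hk : k ≤ N) :
    (nthE l i).eval N ρ = some (L.getD k .nil) := by
  simp only [nthE, eval_comp, eval_drop hl hi hk, Option.bind_some]
  rw [List.getD_eq_getElem?_getD, ← List.head?_drop]
  cases L.drop k
  · rfl
  · simp [Data.ofList]

theorem eval_nthE {l i : Prog} {ρ : Data F} {n : ℕ} {d : Fin n → Data F} {k : Fin n}
    (hl : l.eval N ρ = some (Data.fam d)) (hi : i.eval N ρ = some (Data.ofNat k)) (hn : n ≤ N) :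
    (nthE l i).eval N ρ = some (d k) := by
  rw [eval_nthE_getD hl hi (by omega)]
  simp [List.getD_eq_getElem?_getD]

/-- The entry of the list `l` with number `i`, or `0` if there is none. -/
def nthZeroE (l i : Prog) : Prog :=
  letE (foldE i l (.comp .snd (V 1))) (.cond (V 0) .zero (.comp .fst (V 0)))

theorem eval_nthZeroE {l i : Prog} {ρ : Data F} {n : ℕ} {v : Fin n → F} {k : ℕ}
    (hl : l.eval N ρ = some (Data.ofVec v)) (hi : i.eval N ρ = some (Data.ofNat k)) (hk : k ≤ N) :
    (nthZeroE l i).eval N ρ = some (.elt (if h : k < n then v ⟨k, h⟩ else 0)) := by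
  simp only [nthZeroE, eval_letE, eval_drop (L := List.ofFn fun i => Data.elt (v i)) hl hi hk,
    Option.bind_some]
  by_cases h : k < n
  · rw [List.drop_eq_getElem_cons (by simpa using h)]
    simp [Data.ofList, h]
  · rw [List.drop_eq_nil_of_le (by simpa using h)]
    simp [Data.ofList, h]

/-! ### Arithmetic of natural numbers in unary -/

def addN (a b : Prog) : Prog := foldE a b (.pair .nil (V 1))

theorem eval_addN {a b : Prog} {ρ : Data F} {m n : ℕ} (ha : a.eval N ρ = some (Data.ofNat m))
    (hb : b.eval N ρ = some (Data.ofNat n)) (hm : m ≤ N) :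
    (addN a b).eval N ρ = some (Data.ofNat (n + m)) := by
  rw [addN, eval_foldE (enc := fun _ : Unit => Data.nil) (encS := Data.ofNat)
    (fun (s : ℕ) _ => s + 1) (L := List.replicate m ()) (s := n) (by simpa [Data.ofNat] using ha) hb
    (by simpa using hm) (by simp [Data.ofNat_succ]), List.foldl_const]
  simp

def subN (a b : Prog) : Prog := foldE b a (.comp .snd (V 1))

theorem eval_subN {a b : Prog} {ρ : Data F} {m n : ℕ} (ha : a.eval N ρ = some (Data.ofNat m))
    (hb : b.eval N ρ = some (Data.ofNat n)) (hn : n ≤ N) :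
    (subN a b).eval N ρ = some (Data.ofNat (m - n)) := by
  rw [subN, eval_drop (L := List.replicate m Data.nil) ha hb hn]
  simp [Data.ofNat]

def leE (a b : Prog) : Prog := notE (subN a b)

theorem eval_leE {a b : Prog} {ρ : Data F} {m n : ℕ} (ha : a.eval N ρ = some (Data.ofNat m))
    (hb : b.eval N ρ = some (Data.ofNat n)) (hn : n ≤ N) :
    (leE a b).eval N ρ = some (Data.ofBool (decide (m ≤ n))) := by
  simp only [leE, eval_notE, eval_subN ha hb hn, Option.bind_some, Data.ifNil_ofNat,
    Nat.sub_eq_zero_iff_le]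
  by_cases h : m ≤ n <;> simp [h]

/-- The program `b` after removal of the variables `0` and `1`. -/
def outer (b : Prog) : Prog := .comp b (.comp .snd .snd)

@[simp] theorem eval_outer (b : Prog) (x s ρ : Data F) :
    (outer b).eval N (.cons x (.cons s ρ)) = b.eval N ρ := by
  simp [outer]

def mulN (a b : Prog) : Prog := foldE a .nil (addN (outer b) (V 1))

theorem eval_mulN {a b : Prog} {ρ : Data F} {m n : ℕ} (ha : a.eval N ρ = some (Data.ofNat m))
    (hb : b.eval N ρ = some (Data.ofNat n)) (hm : m ≤ N) (hn : n ≤ N) :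
    (mulN a b).eval N ρ = some (Data.ofNat (m * n)) := by
  rw [mulN, eval_foldE (enc := fun _ : Unit => Data.nil) (encS := Data.ofNat)
    (fun (s : ℕ) _ => s + n) (L := List.replicate m ()) (s := 0) (by simpa [Data.ofNat] using ha)
    (by simp [Data.ofNat_zero]) (by simpa using hm), List.foldl_const]
  · congr 2
    simp [add_right_iterate]
  · intro _ _ s
    exact eval_addN (by simp [hb]) (by simp) hn

/-- Quotient and remainder. -/
def divModN (a b : Prog) : Prog :=
  foldE a (.pair .nil .nil)
    (.cond (subN (outer b) (.pair .nil (.comp .snd (V 1))))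
      (.pair (.pair .nil (.comp .fst (V 1))) .nil)
      (.pair (.comp .fst (V 1)) (.pair .nil (.comp .snd (V 1)))))

theorem eval_divModN {a b : Prog} {ρ : Data F} {m n : ℕ} (ha : a.eval N ρ = some (Data.ofNat m))
    (hb : b.eval N ρ = some (Data.ofNat n)) (hm : m ≤ N) (hn : n ≤ N) (h0 : 0 < n) :
    (divModN a b).eval N ρ = some (.cons (Data.ofNat (m / n)) (Data.ofNat (m % n))) := by
  rw [divModN, eval_foldE (enc := fun _ : Unit => Data.nil)
    (encS := fun s => Data.cons (Data.ofNat (s / n)) (Data.ofNat (s % n)))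
    (fun (s : ℕ) _ => s + 1) (L := List.replicate m ()) (s := 0) (by simpa [Data.ofNat] using ha)
    (by simp [Data.ofNat_zero]) (by simpa using hm), List.foldl_const]
  · simp
  · intro _ _ s
    have hs := Nat.mod_lt s h0
    -- The difference `n - (s % n + 1)` is `0` exactly when the remainder is about to wrap round and
    -- the quotient has to grow.
    have h1 : (subN (outer b) (.pair .nil (.comp .snd (V 1)))).eval N
        (.cons .nil (.cons (.cons (Data.ofNat (s / n)) (Data.ofNat (s % n))) ρ)) =
        some (Data.ofNat (n - (s % n + 1))) :=
      eval_subN (by simp [hb]) (by simp [Data.ofNat_succ]) (by omega)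
    have hd := Nat.div_add_mod s n
    simp only [eval_cond, h1, Option.bind_some, Data.ifNil_ofNat]
    split_ifs with h
    · have h2 : s + 1 = n * (s / n + 1) := by rw [mul_add]; omega
      have h3 : (s + 1) / n = s / n + 1 := by rw [h2, Nat.mul_div_cancel_left _ h0]
      have h4 : (s + 1) % n = 0 := by rw [h2, Nat.mul_mod_right]
      simp [h3, h4, Data.ofNat_succ, Data.ofNat_zero]
    · have h2 : (s + 1) / n = s / n ∧ (s + 1) % n = s % n + 1 :=
        (Nat.div_mod_unique h0).2 ⟨by omega, by omega⟩
      simp [h2.1, h2.2, Data.ofNat_succ]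

/-- A constant natural number. -/
def constN : ℕ → Prog
  | 0 => .nil
  | k + 1 => .pair .nil (constN k)

@[simp] theorem eval_constN (k : ℕ) (ρ : Data F) :
    (constN k).eval N ρ = some (Data.ofNat k) := by
  induction k with
  | zero => rfl
  | succ k ih => simp [constN, ih, Data.ofNat_succ]

/-- The power of a field element. -/
def powE (a k : Prog) : Prog := foldE k .one (mulE (V 1) (outer a))

theorem eval_powE {a e : Prog} {ρ : Data F} {x : F} {k : ℕ} (ha : a.eval N ρ = some (.elt x))
    (he : e.eval N ρ = some (Data.ofNat k)) (hk : k ≤ N) :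
    (powE a e).eval N ρ = some (.elt (x ^ k)) := by
  rw [powE, eval_foldE (enc := fun _ : Unit => Data.nil) (encS := Data.elt)
    (fun (s : F) _ => s * x) (L := List.replicate k ()) (s := 1) (by simpa [Data.ofNat] using he)
    (by simp) (by simpa using hk) (by simp [ha]), List.foldl_const]
  congr 2
  simp [mul_right_iterate]

end Language
end PSMT

namespace PSMT

/-! ### Evaluation rules for values given by encodings -/

section Rules

variable {F : Type} [Field F] [DecidableEq F] {N : ℕ} {ρ : Data F}

theorem ev_pair {a b : Prog} {x y : Data F} (ha : a.eval N ρ = some x) (hb : b.eval N ρ = some y) :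
    (Prog.pair a b).eval N ρ = some (.cons x y) := by simp [ha, hb]

theorem ev_comp {f g : Prog} {x : Data F} {r : Option (Data F)} (hg : g.eval N ρ = some x)
    (hf : f.eval N x = r) : (Prog.comp f g).eval N ρ = r := by simp [hg, hf]

theorem ev_add {a b : Prog} {x y : F} (ha : a.eval N ρ = some (.elt x))
    (hb : b.eval N ρ = some (.elt y)) : (addE a b).eval N ρ = some (.elt (x + y)) := by
  simp [ha, hb]

theorem ev_mul {a b : Prog} {x y : F} (ha : a.eval N ρ = some (.elt x))
    (hb : b.eval N ρ = some (.elt y)) : (mulE a b).eval N ρ = some (.elt (x * y)) := by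
  simp [ha, hb]

theorem ev_sub {a b : Prog} {x y : F} (ha : a.eval N ρ = some (.elt x))
    (hb : b.eval N ρ = some (.elt y)) : (subE a b).eval N ρ = some (.elt (x - y)) := by
  simp [ha, hb, sub_eq_add_neg]

theorem ev_neg {a : Prog} {x : F} (ha : a.eval N ρ = some (.elt x)) :
    (Prog.comp .neg a).eval N ρ = some (.elt (-x)) := by simp [ha]

theorem ev_inv {a : Prog} {x : F} (ha : a.eval N ρ = some (.elt x)) :
    (Prog.comp .inv a).eval N ρ = some (.elt x⁻¹) := by simp [ha]

theorem ev_isZero {a : Prog} {x : F} (ha : a.eval N ρ = some (.elt x)) :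
    (Prog.comp .isZero a).eval N ρ = some (Data.ofBool (decide (x ≠ 0))) := by
  simp only [eval_comp, ha, Option.bind_some, eval_isZero]

theorem ev_not {a : Prog} {p : Bool} (ha : a.eval N ρ = some (Data.ofBool p)) :
    (notE a).eval N ρ = some (Data.ofBool (!p)) := by
  cases p <;> simp [ha]

/-- Truth is encoded by a value other than `nil`, so `g` is the branch taken when `P` holds. Each
branch only has to evaluate in the case in which it is taken. -/
theorem ev_cond {c f g : Prog} {P : Prop} [Decidable P] {x y : Option (Data F)}
    (hc : c.eval N ρ = some (Data.ofBool (decide P)))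
    (hg : P → g.eval N ρ = x) (hf : ¬ P → f.eval N ρ = y) :
    (Prog.cond c f g).eval N ρ = if P then x else y := by
  by_cases h : P
  · simp [hc, h, hg h]
  · simp [hc, h, hf h]

/-- A conditional whose branches compute values of one type. -/
theorem ev_ite {X : Type} {enc : X → Data F} {c f g : Prog} {P : Prop} [Decidable P] {x y : X}
    (hc : c.eval N ρ = some (Data.ofBool (decide P)))
    (hg : P → g.eval N ρ = some (enc x)) (hf : ¬ P → f.eval N ρ = some (enc y)) :
    (Prog.cond c f g).eval N ρ = some (enc (if P then x else y)) := by
  rw [ev_cond hc hg hf]; split_ifs <;> rfl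

def andE (a b : Prog) : Prog := .cond a .nil b

theorem ev_and {a b : Prog} {P Q : Prop} [Decidable P] [Decidable Q]
    (ha : a.eval N ρ = some (Data.ofBool (decide P)))
    (hb : P → b.eval N ρ = some (Data.ofBool (decide Q))) :
    (andE a b).eval N ρ = some (Data.ofBool (decide (P ∧ Q))) := by
  rw [andE, ev_cond ha hb (fun _ => eval_nil _)]
  by_cases h : P <;> simp [h, Data.ofBool]

def eqN (a b : Prog) : Prog := andE (leE a b) (leE b a)

theorem ev_eqN {a b : Prog} {m n : ℕ} (ha : a.eval N ρ = some (Data.ofNat m))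
    (hb : b.eval N ρ = some (Data.ofNat n)) (hm : m ≤ N) (hn : n ≤ N) :
    (eqN a b).eval N ρ = some (Data.ofBool (decide (m = n))) := by
  rw [eqN, ev_and (eval_leE ha hb hn) (fun _ => eval_leE hb ha hm)]
  congr 3; exact propext le_antisymm_iff.symm

theorem ev_nth {X : Type} {enc : X → Data F} {l i : Prog} {n : ℕ} {v : Fin n → X} {k : Fin n}
    (hl : l.eval N ρ = some (Data.ofFamily enc v)) (hi : i.eval N ρ = some (Data.ofNat k))
    (hn : n ≤ N) : (nthE l i).eval N ρ = some (enc (v k)) :=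
  eval_nthE hl hi hn

theorem ev_vec {l i : Prog} {n : ℕ} {v : Fin n → F} {k : Fin n}
    (hl : l.eval N ρ = some (Data.ofVec v)) (hi : i.eval N ρ = some (Data.ofNat k))
    (hn : n ≤ N) : (nthE l i).eval N ρ = some (.elt (v k)) :=
  eval_nthE hl hi hn

theorem ev_tab {X : Type} {enc : X → Data F} {k : ℕ} {v : Fin k → X} {e b : Prog}
    (he : e.eval N ρ = some (Data.ofNat k)) (hk : k ≤ N)
    (hb : ∀ i : Fin k, b.eval N (.cons (Data.ofNat i) ρ) = some (enc (v i))) :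
    (tabE e b).eval N ρ = some (Data.ofFamily enc v) :=
  eval_tabE he hk hb

theorem ev_tabVec {k : ℕ} {v : Fin k → F} {e b : Prog}
    (he : e.eval N ρ = some (Data.ofNat k)) (hk : k ≤ N)
    (hb : ∀ i : Fin k, b.eval N (.cons (Data.ofNat i) ρ) = some (.elt (v i))) :
    (tabE e b).eval N ρ = some (Data.ofVec v) :=
  eval_tabE he hk hb

theorem ev_map {X Y : Type} {enc : X → Data F} {enc' : Y → Data F} {k : ℕ} {v : Fin k → X}
    {w : Fin k → Y} {e b : Prog} (he : e.eval N ρ = some (Data.ofFamily enc v)) (hk : k ≤ N)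
    (hb : ∀ i : Fin k, b.eval N (.cons (enc (v i)) ρ) = some (enc' (w i))) :
    (mapE e b).eval N ρ = some (Data.ofFamily enc' w) :=
  eval_mapE_fam he hk hb

theorem ev_len {X : Type} {enc : X → Data F} {k : ℕ} {v : Fin k → X} {e : Prog}
    (he : e.eval N ρ = some (Data.ofFamily enc v)) (hk : k ≤ N) :
    (lenE e).eval N ρ = some (Data.ofNat k) :=
  eval_lenE_fam he hk

theorem ev_fold {X σ : Type} {enc : X → Data F} {encS : σ → Data F} {k : ℕ} {v : Fin k → X}
    (f : σ → X → σ) {l i b : Prog} {s : σ}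
    (hl : l.eval N ρ = some (Data.ofFamily enc v)) (hi : i.eval N ρ = some (encS s))
    (hk : k ≤ N)
    (hb : ∀ i s, b.eval N (.cons (enc (v i)) (.cons (encS s) ρ)) = some (encS (f s (v i)))) :
    (foldE l i b).eval N ρ = some (encS ((List.ofFn v).foldl f s)) := by
  refine eval_foldE (L := List.ofFn v) (enc := enc) f ?_ hi (by simpa using hk) ?_
  · rw [hl, Data.ofFamily, List.map_ofFn]; rfl
  · intro x hx s
    obtain ⟨i, rfl⟩ := (List.mem_ofFn' v x).1 hx
    exact hb i s

end Rules

/-! ### Solving linear systems -/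

section Linear

theorem cons_dotProduct_cons {F : Type} [Field F] {k : ℕ} (b y : F) (a x : Fin k → F) :
    (Fin.cons b a : Fin (k + 1) → F) ⬝ᵥ (Fin.cons y x : Fin (k + 1) → F) = b * y + a ⬝ᵥ x := by
  simp [dotProduct, Fin.sum_univ_succ]

variable {F : Type} [Field F] [DecidableEq F]

/-- A member of the family `B` on which the linear form `a` does not vanish, or `0`. -/
def pivot {k m : ℕ} (a : Fin k → F) (B : Fin m → Fin k → F) : Fin k → F :=
  (List.ofFn B).foldl (fun p b => if a ⬝ᵥ b ≠ 0 then b else p) 0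

/-- From a spanning family of a subspace, one of the kernel of the linear form `a` on it. -/
def nullStep {k m : ℕ} (a : Fin k → F) (B : Fin m → Fin k → F) : Fin m → Fin k → F :=
  fun i j => B i j - (a ⬝ᵥ B i * (a ⬝ᵥ pivot a B)⁻¹) * pivot a B j

/-- A spanning family of the kernel of a matrix, given by its rows. -/
def nullBasis {r k : ℕ} (A : Fin r → Fin k → F) : Fin k → Fin k → F :=
  (List.ofFn A).foldl (fun B a => nullStep a B) fun i j => if (i : ℕ) = j then 1 else 0

/-- A nonzero kernel vector. -/
def kernelVec {r k : ℕ} (A : Fin r → Fin k → F) : Option (Fin k → F) :=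
  (List.ofFn (nullBasis A)).foldl (fun s v => if ∃ i, v i ≠ 0 then some v else s) none

/-- A solution of the linear system `A x = b`. -/
def solveLinear {r k : ℕ} (A : Fin r → Fin k → F) (b : Fin r → F) : Option (Fin k → F) :=
  (List.ofFn (nullBasis fun i => Fin.cons (-b i) (A i))).foldl
    (fun s v => if v 0 ≠ 0 then some (fun i => v i.succ * (v 0)⁻¹) else s) none

theorem pivot_mem_span {k m : ℕ} (a : Fin k → F) (B : Fin m → Fin k → F) :
    pivot a B ∈ Submodule.span F (Set.range B) := by
  have : ∀ (L : List (Fin k → F)) (p : Fin k → F), (∀ b ∈ L, b ∈ Set.range B) →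
      p ∈ Submodule.span F (Set.range B) →
      L.foldl (fun p b => if a ⬝ᵥ b ≠ 0 then b else p) p ∈ Submodule.span F (Set.range B) := by
    intro L
    induction L with
    | nil => intro p _ h; exact h
    | cons b L ih =>
      intro p hL hp
      refine ih _ (fun c hc => hL c (by simp [hc])) ?_
      dsimp only
      split_ifs
      · exact Submodule.subset_span (hL b (by simp))
      · exact hp
  exact this _ _ (fun b hb => (List.mem_ofFn' B b).1 hb) (Submodule.zero_mem _)

/-- Once the loop holds a vector on which `a` is nonzero, it never again holds one on which `a`
vanishes; a final value `0` therefore means that no such vector was met. -/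
theorem pivot_spec {k m : ℕ} (a : Fin k → F) (B : Fin m → Fin k → F) (h : a ⬝ᵥ pivot a B = 0)
    (i : Fin m) : a ⬝ᵥ B i = 0 := by
  have : ∀ (L : List (Fin k → F)) (p : Fin k → F),
      a ⬝ᵥ L.foldl (fun p b => if a ⬝ᵥ b ≠ 0 then b else p) p = 0 →
      a ⬝ᵥ p = 0 ∧ ∀ b ∈ L, a ⬝ᵥ b = 0 := by
    intro L
    induction L with
    | nil => intro p h; exact ⟨h, by simp⟩
    | cons b L ih =>
      intro p hp
      obtain ⟨h1, h2⟩ := ih _ hp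
      dsimp only at h1
      split_ifs at h1 with hb
      · exact absurd h1 hb
      · exact ⟨h1, by simpa using ⟨not_not.1 hb, h2⟩⟩
  exact (this _ _ h).2 _ (by simp)

/-- The step applies to each member of `B` the projection onto the kernel of `a` along the pivot,
which itself lies in the span. The projection fixes kernel vectors, so the span is mapped onto its
intersection with the kernel. -/
theorem mem_span_nullStep {k m : ℕ} (a : Fin k → F) (B : Fin m → Fin k → F) (x : Fin k → F) :
    x ∈ Submodule.span F (Set.range (nullStep a B)) ↔
      x ∈ Submodule.span F (Set.range B) ∧ a ⬝ᵥ x = 0 := by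
  set p := pivot a B with hp
  let φ : (Fin k → F) →ₗ[F] (Fin k → F) :=
    LinearMap.id - (LinearMap.toSpanSingleton F _ p).comp
      ((a ⬝ᵥ p)⁻¹ • (dotProductBilin F F a))
  have hφ : ∀ y, φ y = y - (a ⬝ᵥ y * (a ⬝ᵥ p)⁻¹) • p := by
    intro y
    simp [φ, mul_comm]
  have hstep : nullStep a B = φ ∘ B := by
    funext i; rw [Function.comp, hφ]; rfl
  rw [hstep, Set.range_comp, ← Submodule.map_span]
  constructor
  · rintro ⟨y, hy, rfl⟩
    refine ⟨?_, ?_⟩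
    · rw [hφ]
      exact Submodule.sub_mem _ hy (Submodule.smul_mem _ _ (pivot_mem_span a B))
    · rw [hφ, dotProduct_sub, dotProduct_smul, smul_eq_mul]
      -- If the pivot has value `0`, so has the inverse, and `φ` is the identity; but then `a`
      -- already vanishes on the whole span.
      by_cases h0 : a ⬝ᵥ p = 0
      · have : a ⬝ᵥ y = 0 := by
          have hle : Submodule.span F (Set.range B) ≤ LinearMap.ker (dotProductBilin F F a) := by
            rw [Submodule.span_le]
            rintro _ ⟨i, rfl⟩
            exact pivot_spec a B h0 i
          exact hle hy
        simp [h0, this]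
      · field_simp; ring
  · rintro ⟨hx, hax⟩
    exact ⟨x, hx, by simp [hφ, hax]⟩

/-- The unit vectors span everything, and each row in turn cuts the span down to its kernel. -/
theorem mem_span_nullBasis {r k : ℕ} (A : Fin r → Fin k → F) (x : Fin k → F) :
    x ∈ Submodule.span F (Set.range (nullBasis A)) ↔ ∀ i, A i ⬝ᵥ x = 0 := by
  have : ∀ (L : List (Fin k → F)) (B : Fin k → Fin k → F),
      x ∈ Submodule.span F (Set.range (L.foldl (fun B a => nullStep a B) B)) ↔
        x ∈ Submodule.span F (Set.range B) ∧ ∀ a ∈ L, a ⬝ᵥ x = 0 := by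
    intro L
    induction L with
    | nil => simp
    | cons a L ih => intro B; simp [ih, mem_span_nullStep, and_assoc]
  rw [nullBasis, this]
  have h1 : (fun i j : Fin k => if (i : ℕ) = j then (1 : F) else 0) = Pi.basisFun F (Fin k) := by
    funext i j
    simp [Pi.basisFun_apply, Pi.single_apply, Fin.ext_iff, eq_comm]
  rw [h1, Module.Basis.span_eq]
  simp [List.mem_ofFn']

theorem kernelVec_some {r k : ℕ} {A : Fin r → Fin k → F} {x : Fin k → F}
    (h : kernelVec A = some x) : x ≠ 0 ∧ ∀ i, A i ⬝ᵥ x = 0 := by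
  rw [← mem_span_nullBasis]
  have : ∀ (L : List (Fin k → F)) (s : Option (Fin k → F)), (∀ b ∈ L, b ∈ Set.range (nullBasis A)) →
      L.foldl (fun s v => if ∃ i, v i ≠ 0 then some v else s) s = some x →
      s = some x ∨ (x ≠ 0 ∧ x ∈ Submodule.span F (Set.range (nullBasis A))) := by
    intro L
    induction L with
    | nil => intro s _ h; exact Or.inl h
    | cons v L ih =>
      intro s hL hs
      rcases ih _ (fun b hb => hL b (by simp [hb])) hs with h1 | h1
      · dsimp only at h1
        split_ifs at h1 with hv
        · obtain rfl := Option.some.inj h1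
          exact Or.inr ⟨fun h0 => by simp [h0] at hv, Submodule.subset_span (hL _ (by simp))⟩
        · exact Or.inl h1
      · exact Or.inr h1
  exact (this _ _ (fun b hb => (List.mem_ofFn' _ b).1 hb) h).resolve_left (by simp)

theorem kernelVec_none {r k : ℕ} {A : Fin r → Fin k → F} (h : kernelVec A = none)
    (x : Fin k → F) (hx : ∀ i, A i ⬝ᵥ x = 0) : x = 0 := by
  rw [← mem_span_nullBasis] at hx
  have : ∀ (L : List (Fin k → F)) (s : Option (Fin k → F)),
      L.foldl (fun s v => if ∃ i, v i ≠ 0 then some v else s) s = none →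
      s = none ∧ ∀ v ∈ L, v = 0 := by
    intro L
    induction L with
    | nil => intro s h; exact ⟨h, by simp⟩
    | cons v L ih =>
      intro s hs
      obtain ⟨h1, h2⟩ := ih _ hs
      dsimp only at h1
      split_ifs at h1 with hv
      refine ⟨h1, ?_⟩
      push Not at hv
      simpa using ⟨funext hv, h2⟩
  have h0 := (this _ _ h).2
  have : Submodule.span F (Set.range (nullBasis A)) ≤ ⊥ := by
    rw [Submodule.span_le]
    rintro _ ⟨i, rfl⟩
    exact h0 _ (by simp)
  simpa using this hx

/-- Homogenization: `x` solves the system exactly if `(1, x)` is in the kernel of the rows `(-b i, A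
i)`. A spanning vector of this kernel with nonzero first entry is scaled to first entry `1`. -/
theorem solveLinear_some {r k : ℕ} {A : Fin r → Fin k → F} {b : Fin r → F} {x : Fin k → F}
    (h : solveLinear A b = some x) (i : Fin r) : A i ⬝ᵥ x = b i := by
  set B := nullBasis fun i => (Fin.cons (-b i) (A i) : Fin (k + 1) → F) with hB
  have : ∀ (L : List (Fin (k + 1) → F)) (s : Option (Fin k → F)), (∀ b ∈ L, b ∈ Set.range B) →
      L.foldl (fun s v => if v 0 ≠ 0 then some (fun i => v i.succ * (v 0)⁻¹) else s) s = some x →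
      s = some x ∨ (Fin.cons 1 x : Fin (k + 1) → F) ∈ Submodule.span F (Set.range B) := by
    intro L
    induction L with
    | nil => intro s _ h; exact Or.inl h
    | cons v L ih =>
      intro s hL hs
      rcases ih _ (fun b hb => hL b (by simp [hb])) hs with h1 | h1
      · dsimp only at h1
        split_ifs at h1 with hv
        · obtain rfl := Option.some.inj h1
          refine Or.inr ?_
          have : (Fin.cons 1 (fun i => v i.succ * (v 0)⁻¹) : Fin (k + 1) → F) = (v 0)⁻¹ • v := by
            funext j
            refine Fin.cases ?_ (fun j => ?_) j
            · simp [hv]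
            · simp [mul_comm]
          rw [this]
          exact Submodule.smul_mem _ _ (Submodule.subset_span (hL _ (by simp)))
        · exact Or.inl h1
      · exact Or.inr h1
  have h2 := (this _ _ (fun b hb => (List.mem_ofFn' _ b).1 hb) h).resolve_left (by simp)
  rw [mem_span_nullBasis] at h2
  have := h2 i
  rw [cons_dotProduct_cons] at this
  linear_combination this

/-- If all spanning vectors of the homogenized kernel begin with `0`, so does every vector in it,
and `(1, x)` is excluded. -/
theorem solveLinear_none {r k : ℕ} {A : Fin r → Fin k → F} {b : Fin r → F}
    (h : solveLinear A b = none) (x : Fin k → F) : ¬ ∀ i, A i ⬝ᵥ x = b i := by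
  intro hx
  set B := nullBasis fun i => (Fin.cons (-b i) (A i) : Fin (k + 1) → F) with hB
  have hmem : (Fin.cons 1 x : Fin (k + 1) → F) ∈ Submodule.span F (Set.range B) := by
    rw [mem_span_nullBasis]
    intro i
    rw [cons_dotProduct_cons, hx i]; ring
  have : ∀ (L : List (Fin (k + 1) → F)) (s : Option (Fin k → F)),
      L.foldl (fun s v => if v 0 ≠ 0 then some (fun i => v i.succ * (v 0)⁻¹) else s) s = none →
      s = none ∧ ∀ v ∈ L, v 0 = 0 := by
    intro L
    induction L with
    | nil => intro s h; exact ⟨h, by simp⟩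
    | cons v L ih =>
      intro s hs
      obtain ⟨h1, h2⟩ := ih _ hs
      dsimp only at h1
      split_ifs at h1 with hv
      exact ⟨h1, by simpa using ⟨not_not.1 hv, h2⟩⟩
  have h0 := (this _ _ h).2
  have hle : Submodule.span F (Set.range B) ≤
      LinearMap.ker (LinearMap.proj (R := F) (φ := fun _ : Fin (k + 1) => F) 0) := by
    rw [Submodule.span_le]
    rintro _ ⟨i, rfl⟩
    exact h0 _ ((List.mem_ofFn' _ _).2 ⟨i, rfl⟩)
  have := hle hmem
  simp at this

/-! ### Programs for linear algebra -/

variable {N : ℕ} {ρ : Data F}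

/-- A call of the program `p` with two arguments. -/
def call₂ (p a b : Prog) : Prog := .comp p (.pair a (.pair b .nil))

theorem ev_call₂ {p a b : Prog} {x y : Data F} {r : Option (Data F)} (ha : a.eval N ρ = some x)
    (hb : b.eval N ρ = some y) (hp : p.eval N (.cons x (.cons y .nil)) = r) :
    (call₂ p a b).eval N ρ = r :=
  ev_comp (ev_pair ha (ev_pair hb (eval_nil _))) hp

def dotP : Prog := sumE (lenE (V 0)) (mulE (nthE (V 1) (V 0)) (nthE (V 2) (V 0)))

def dotE (a b : Prog) : Prog := call₂ dotP a b

theorem ev_dot {a b : Prog} {k : ℕ} {x y : Fin k → F} (ha : a.eval N ρ = some (Data.ofVec x))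
    (hb : b.eval N ρ = some (Data.ofVec y)) (hk : k ≤ N) :
    (dotE a b).eval N ρ = some (.elt (x ⬝ᵥ y)) :=
  ev_call₂ ha hb <| eval_sumE (ev_len (v := x) rfl hk) hk fun _ =>
    ev_mul (ev_vec rfl rfl hk) (ev_vec rfl rfl hk)

/-- On a linear form, a family of vectors, and the length of the vectors as variable `3`. -/
def pivotP : Prog :=
  foldE (V 1) (tabE (V 3) .zero) (.cond (.comp .isZero (dotE (V 2) (V 0))) (V 1) (V 0))

theorem eval_pivotP {k m : ℕ} (hk : k ≤ N) (hm : m ≤ N) (a : Fin k → F) (B : Fin m → Fin k → F)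
    (x ρ : Data F) :
    pivotP.eval N (.cons (Data.ofVec a) (.cons (Data.ofFamily Data.ofVec B) (.cons x
      (.cons (Data.ofNat k) ρ)))) = some (Data.ofVec (pivot a B)) :=
  ev_fold (enc := Data.ofVec) _ rfl (ev_tabVec (v := fun _ => 0) rfl hk fun _ => rfl) hm
    fun _ _ => ev_ite (enc := Data.ofVec) (ev_isZero (ev_dot rfl rfl hk)) (fun _ => rfl) fun _ => rfl

def nullStepP : Prog :=
  letE pivotP (mapE (V 2) (tabE (V 5) (subE (nthE (V 1) (V 0))
    (mulE (mulE (dotE (V 3) (V 1)) (.comp .inv (dotE (V 3) (V 2)))) (nthE (V 2) (V 0))))))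

theorem eval_nullStepP {k m : ℕ} (hk : k ≤ N) (hm : m ≤ N) (a : Fin k → F)
    (B : Fin m → Fin k → F) (x ρ : Data F) :
    nullStepP.eval N (.cons (Data.ofVec a) (.cons (Data.ofFamily Data.ofVec B) (.cons x
      (.cons (Data.ofNat k) ρ)))) = some (Data.ofFamily Data.ofVec (nullStep a B)) :=
  eval_letE_of (eval_pivotP hk hm a B x ρ) <| ev_map (enc := Data.ofVec) rfl hm fun _ =>
    ev_tabVec rfl hk fun _ => ev_sub (ev_vec rfl rfl hk) <| ev_mul
      (ev_mul (ev_dot rfl rfl hk) (ev_inv (ev_dot rfl rfl hk))) (ev_vec rfl rfl hk)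

/-- On the list of the rows and their length. -/
def nullBasisP : Prog :=
  foldE (V 0) (tabE (V 1) (tabE (V 2) (.cond (eqN (V 1) (V 0)) .zero .one))) nullStepP

theorem eval_nullBasisP {r k : ℕ} (hk : k ≤ N) (hr : r ≤ N) (A : Fin r → Fin k → F) (ρ : Data F) :
    nullBasisP.eval N (.cons (Data.ofFamily Data.ofVec A) (.cons (Data.ofNat k) ρ)) =
      some (Data.ofFamily Data.ofVec (nullBasis A)) :=
  ev_fold (enc := Data.ofVec) (encS := Data.ofFamily Data.ofVec) _ rfl
    (ev_tab rfl hk fun i => ev_tabVec rfl hk fun j =>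
      ev_ite (enc := Data.elt) (ev_eqN rfl rfl (i.2.le.trans hk) (j.2.le.trans hk)) (fun _ => rfl)
        fun _ => rfl) hr
    fun _ _ => eval_nullStepP hk hk _ _ _ _

/-- An optional value as data. -/
def Data.ofOption {F X : Type} (enc : X → Data F) : Option X → Data F
  | none => .nil
  | some x => .cons (enc x) .nil

def kernelVecP : Prog :=
  letE nullBasisP (foldE (V 0) .nil (.cond (anyE (V 4) (.comp .isZero (nthE (V 1) (V 0)))) (V 1)
    (.pair (V 0) .nil)))

theorem eval_kernelVecP {r k : ℕ} (hk : k ≤ N) (hr : r ≤ N) (A : Fin r → Fin k → F) (ρ : Data F) :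
    kernelVecP.eval N (.cons (Data.ofFamily Data.ofVec A) (.cons (Data.ofNat k) ρ)) =
      some (Data.ofOption Data.ofVec (kernelVec A)) := by
  refine eval_letE_of (eval_nullBasisP hk hr A ρ) <|
    ev_fold (enc := Data.ofVec) (encS := Data.ofOption Data.ofVec) _ rfl rfl hk fun i s =>
      ev_ite (enc := Data.ofOption Data.ofVec) ?_ (fun _ => rfl) fun _ => rfl
  have := eval_anyE (p := fun j => decide (nullBasis A i j ≠ 0)) (N := N)
    (b := .comp .isZero (nthE (V 1) (V 0)))
    (ρ := .cons (Data.ofVec (nullBasis A i)) (.cons (Data.ofOption Data.ofVec s)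
      (.cons (Data.ofFamily Data.ofVec (nullBasis A))
        (.cons (Data.ofFamily Data.ofVec A) (.cons (Data.ofNat k) ρ)))))
    (e := V 4) rfl hk fun j => ev_isZero (ev_vec rfl rfl hk)
  simpa only [decide_eq_true_eq] using this

/-- On the list of the rows, the right-hand side and the number of unknowns. -/
def solveLinearP : Prog :=
  letE (call₂ nullBasisP
      (tabE (lenE (V 0)) (.pair (.comp .neg (nthE (V 2) (V 0))) (nthE (V 1) (V 0))))
      (.pair .nil (V 2)))
    (foldE (V 0) .nil (.cond (.comp .isZero (.comp .fst (V 0))) (V 1)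
      (.pair (tabE (V 5) (mulE (nthE (.comp .snd (V 1)) (V 0)) (.comp .inv (.comp .fst (V 1)))))
        .nil)))

theorem ofVec_succ {F : Type} {k : ℕ} (v : Fin (k + 1) → F) :
    Data.ofVec v = .cons (.elt (v 0)) (Data.ofVec fun i => v i.succ) :=
  Data.fam_succ _

/-- The strict bound on `k` leaves room for the extra unknown of the homogenized system. -/
theorem eval_solveLinearP {r k : ℕ} (hk : k < N) (hr : r ≤ N) (A : Fin r → Fin k → F)
    (b : Fin r → F) (ρ : Data F) :
    solveLinearP.eval N (.cons (Data.ofFamily Data.ofVec A) (.cons (Data.ofVec b)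
      (.cons (Data.ofNat k) ρ))) = some (Data.ofOption Data.ofVec (solveLinear A b)) := by
  refine eval_letE_of (ev_call₂ (ev_tab (enc := Data.ofVec)
    (v := fun i => (Fin.cons (-b i) (A i) : Fin (k + 1) → F)) (ev_len (v := A) rfl hr) hr
    fun i => ?_) rfl (eval_nullBasisP hk hr _ _)) <|
    ev_fold (enc := Data.ofVec) (encS := Data.ofOption Data.ofVec) _ rfl rfl hk fun i s => ?_
  · rw [ofVec_succ]
    exact ev_pair (ev_neg (ev_vec rfl rfl hr)) (ev_nth (enc := Data.ofVec) rfl rfl hr)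
  · rw [ofVec_succ]
    exact ev_ite (enc := Data.ofOption Data.ofVec) (ev_isZero rfl)
      (fun _ => ev_pair (ev_tabVec rfl hk.le fun j =>
        ev_mul (ev_vec (v := fun j => nullBasis _ i (Fin.succ j)) rfl rfl hk.le) (ev_inv rfl)) rfl)
      fun _ => rfl

end Linear
end PSMT

namespace PSMT

/-! ### Decoding of Reed–Solomon codes with erasures -/

section ReedSolomon

open Polynomial

variable {F : Type} [Field F] [DecidableEq F] {n : ℕ}

theorem eval_ofFn {k : ℕ} (c : Fin k → F) (x : F) :
    (ofFn k c).eval x = ∑ j, c j * x ^ (j : ℕ) := by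
  simp [ofFn_eq_sum_monomial, eval_finsetSum]

theorem rsEncoder_apply (α : Fin n → F) (k : ℕ) (c : Fin k → F) (i : Fin n) :
    rsEncoder α k c i = (ofFn k c).eval (α i) := by
  simp [rsEncoder, eval_ofFn, Matrix.mulVec, dotProduct, mul_comm]

theorem ofFn_eq_zero_of_eval {α : Fin n → F} (hα : Function.Injective α) {k : ℕ} {c : Fin k → F}
    {Z : Finset (Fin n)} (hZ : k ≤ Z.card) (h : ∀ i ∈ Z, (ofFn k c).eval (α i) = 0) :
    ofFn k c = 0 :=
  eq_zero_of_degree_lt_of_eval_index_eq_zero (v := α) Z hα.injOn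
    ((ofFn_degree_lt c).trans_le (by exact_mod_cast hZ)) h

/-- Coefficients of the equation `v i * E (α i) = Q (α i)` for a locator `E` of degree at most `τ`
and a polynomial `Q` of degree less than `τ + k`, with weight `g i`. -/
def locatorRow (α : Fin n → F) (τ k : ℕ) (g v : Fin n → F) (i : Fin n) :
    Fin ((τ + 1) + (τ + k)) → F :=
  fun p => if τ + 1 ≤ (p : ℕ) then -(g i * α i ^ ((p : ℕ) - (τ + 1))) else
    g i * v i * α i ^ (p : ℕ)

/-- The values of the locator at the points `α i`, with weights `g i`. -/
def locatorValue (α : Fin n → F) (τ k : ℕ) (g : Fin n → F) (x : Fin ((τ + 1) + (τ + k)) → F)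
    (i : Fin n) : F :=
  g i * ∑ c : Fin (τ + 1), x (Fin.castAdd (τ + k) c) * α i ^ (c : ℕ)

/-- The polynomial with `k` coefficients whose values differ from `v` in at most `τ` of the positions
where `g` is not zero. -/
def rsDecode (α : Fin n → F) (τ k : ℕ) (g v : Fin n → F) : Option (Fin k → F) :=
  match kernelVec (locatorRow α τ k g v) with
  | none => none
  | some x => solveLinear (fun i (c : Fin k) => locatorValue α τ k g x i * α i ^ (c : ℕ))
      fun i => locatorValue α τ k g x i * v i

theorem locatorRow_dotProduct (α : Fin n → F) (τ k : ℕ) (g v : Fin n → F) (i : Fin n)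
    (x : Fin ((τ + 1) + (τ + k)) → F) :
    locatorRow α τ k g v i ⬝ᵥ x =
      g i * (v i * (ofFn (τ + 1) fun c => x (Fin.castAdd _ c)).eval (α i) -
        (ofFn (τ + k) fun c => x (Fin.natAdd _ c)).eval (α i)) := by
  have h : ∀ c : Fin (τ + 1), ¬ τ + 1 ≤ (c : ℕ) := fun c => by omega
  rw [dotProduct, Fin.sum_univ_add]
  simp only [locatorRow, eval_ofFn, Fin.val_castAdd, Fin.val_natAdd,
    h, if_false, Nat.le_add_right, if_true, Nat.add_sub_cancel_left]
  rw [mul_sub, ← mul_assoc, Finset.mul_sum, Finset.mul_sum, sub_eq_add_neg, ← Finset.sum_neg_distrib]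
  congr 1 <;> exact Finset.sum_congr rfl fun c _ => by ring

variable {α : Fin n → F} {τ k : ℕ} {K : Finset (Fin n)} {v : Fin n → F}

/-- If the locator were zero, `Q` would vanish at the `n - |K| ≥ τ + k` points outside `K` although
its degree is less than `τ + k`; then `Q`, and with it `x`, would be zero. -/
theorem locator_ne_zero (hα : Function.Injective α) (hn : K.card + 2 * τ + k ≤ n)
    {x : Fin ((τ + 1) + (τ + k)) → F} (hx : x ≠ 0)
    (h : ∀ i ∉ K, v i * (ofFn (τ + 1) fun c => x (Fin.castAdd _ c)).eval (α i) =
        (ofFn (τ + k) fun c => x (Fin.natAdd _ c)).eval (α i)) :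
    ofFn (τ + 1) (fun c => x (Fin.castAdd (τ + k) c)) ≠ 0 := by
  intro h0
  have hc : Kᶜ.card = n - K.card := by simp [Finset.card_compl]
  have h1 : ofFn (τ + k) (fun c => x (Fin.natAdd (τ + 1) c)) = 0 :=
    ofFn_eq_zero_of_eval hα (Z := Kᶜ) (by omega) fun i hi => by
      rw [← h i (by simpa using hi), h0]; simp
  apply hx
  have e0 := injective_ofFn (τ + 1) (h0.trans (map_zero _).symm)
  have e1 := injective_ofFn (τ + k) (h1.trans (map_zero _).symm)
  funext p
  refine Fin.addCases (fun c => ?_) (fun c => ?_) p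
  · exact congrFun e0 c
  · exact congrFun e1 c

/-- Berlekamp–Welch decoding with erasures in `K`. The second linear system says that codeword and
`v` agree outside `K` wherever the locator `E` is nonzero, and a nonzero `E` of degree at most `τ`
has at most `τ` roots. -/
theorem rsDecode_some (hα : Function.Injective α) (hn : K.card + 2 * τ + k ≤ n) {c : Fin k → F}
    (h : rsDecode α τ k (fun i => if i ∈ K then 0 else 1) v = some c) :
    (Kᶜ.filter fun i => rsEncoder α k c i ≠ v i).card ≤ τ := by
  unfold rsDecode at h
  split at h
  · cases h
  · rename_i x hx
    obtain ⟨hx0, hx⟩ := kernelVec_some hx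
    set E := ofFn (τ + 1) fun c => x (Fin.castAdd (τ + k) c) with hE
    have hQ : ∀ i ∉ K, v i * E.eval (α i) =
        (ofFn (τ + k) fun c => x (Fin.natAdd _ c)).eval (α i) := by
      intro i hi
      have := hx i
      rw [locatorRow_dotProduct, if_neg hi, one_mul] at this
      exact sub_eq_zero.1 this
    have hE0 : E ≠ 0 := locator_ne_zero hα hn hx0 hQ
    set Z := Kᶜ.filter fun i => E.eval (α i) = 0 with hZ
    have hZc : Z.card ≤ τ := by
      by_contra hlt
      exact hE0 (ofFn_eq_zero_of_eval hα (Z := Z) (by omega) fun i hi => (Finset.mem_filter.1 hi).2)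
    refine (Finset.card_le_card ?_).trans hZc
    intro i hi
    rw [Finset.mem_filter] at hi ⊢
    refine ⟨hi.1, ?_⟩
    by_contra hne
    have hiK : i ∉ K := by simpa using hi.1
    have := solveLinear_some h i
    have hl : locatorValue α τ k (fun i => if i ∈ K then 0 else 1) x i = E.eval (α i) := by
      simp [locatorValue, hiK, hE, eval_ofFn]
    apply hi.2
    rw [rsEncoder_apply, eval_ofFn]
    apply mul_left_cancel₀ hne
    rw [← hl, ← this, dotProduct, Finset.mul_sum]
    exact Finset.sum_congr rfl fun c _ => by ring

/-- If a codeword had an error set `Z` of at most `τ` positions outside `K`, neither linear system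
could fail: the locator of `Z` gives a kernel vector for the first, and the codeword solves the
second for whichever kernel vector was found. -/
theorem rsDecode_none (hα : Function.Injective α) (hn : K.card + 2 * τ + k ≤ n) (hk : 0 < k)
    (h : rsDecode α τ k (fun i => if i ∈ K then 0 else 1) v = none) (c : Fin k → F) :
    τ < (Kᶜ.filter fun i => rsEncoder α k c i ≠ v i).card := by
  by_contra hlt
  set Z := Kᶜ.filter fun i => rsEncoder α k c i ≠ v i with hZ
  set f := ofFn k c with hf
  unfold rsDecode at h
  split at h
  · rename_i hker
    -- The locator of `Z`; together with `f * E` it is a nonzero kernel vector.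
    let E : F[X] := ∏ i ∈ Z, (X - C (α i))
    have hEm : E.Monic := monic_prod_of_monic _ _ fun i _ => monic_X_sub_C _
    have hEd : E.natDegree = Z.card := by
      rw [natDegree_prod_of_monic _ _ fun i _ => monic_X_sub_C _]; simp
    have hQd : (f * E).natDegree < τ + k := by
      have h1 := natDegree_mul_le (p := f) (q := E)
      have h2 := ofFn_natDegree_lt hk c
      rw [← hf] at h2
      omega
    have hx := kernelVec_none hker
      (Fin.append (toFn (τ + 1) E) (toFn (τ + k) (f * E))) fun i => by
        rw [locatorRow_dotProduct]
        simp only [Fin.append_left, Fin.append_right]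
        rw [ofFn_comp_toFn_eq_id_of_natDegree_lt (by omega),
          ofFn_comp_toFn_eq_id_of_natDegree_lt hQd]
        by_cases hi : i ∈ K
        · simp [hi]
        by_cases hz : i ∈ Z
        · have : E.eval (α i) = 0 := by
            rw [eval_prod]; exact Finset.prod_eq_zero hz (by simp)
          simp [this]
        · have : f.eval (α i) = v i := by
            rw [hf, ← rsEncoder_apply]
            by_contra hne
            exact hz (Finset.mem_filter.2 ⟨by simpa using hi, hne⟩)
          simp [this]
    have : E = 0 := by
      rw [← ofFn_comp_toFn_eq_id_of_natDegree_lt (n := τ + 1) (p := E) (by omega)]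
      have : toFn (τ + 1) E = 0 := by
        funext j
        have := congrFun hx (Fin.castAdd _ j)
        rwa [Fin.append_left] at this
      rw [this, map_zero]
    exact hEm.ne_zero this
  · rename_i x hx
    obtain ⟨hx0, hx⟩ := kernelVec_some hx
    set E := ofFn (τ + 1) fun c => x (Fin.castAdd (τ + k) c) with hE
    set Q := ofFn (τ + k) fun c => x (Fin.natAdd (τ + 1) c) with hQdef
    have hQ : ∀ i ∉ K, v i * E.eval (α i) = Q.eval (α i) := by
      intro i hi
      have := hx i
      rw [locatorRow_dotProduct, if_neg hi, one_mul] at this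
      exact sub_eq_zero.1 this
    have hd1 : (f * E).natDegree < τ + k := by
      have h1 := natDegree_mul_le (p := f) (q := E)
      have h2 := ofFn_natDegree_lt hk c
      have h3 := ofFn_natDegree_lt (by omega : 1 ≤ τ + 1) fun c => x (Fin.castAdd (τ + k) c)
      rw [← hf] at h2
      rw [← hE] at h3
      omega
    -- Outside `K` and `Z` at least `n - |K| - τ ≥ τ + k` points remain. There `Q` and `f * E`
    -- agree, and both have degree less than `τ + k`.
    have hcard : τ + k ≤ (Kᶜ \ Z).card := by
      have h1 := Finset.le_card_sdiff Z Kᶜ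
      have : Kᶜ.card = n - K.card := by simp [Finset.card_compl]
      omega
    have hdeg : (f * E).degree < ((Kᶜ \ Z).card : WithBot ℕ) :=
      (degree_le_natDegree).trans_lt (by exact_mod_cast hd1.trans_le hcard)
    have hQE : Q = f * E := by
      refine eq_of_degrees_lt_of_eval_index_eq (v := α) (Kᶜ \ Z) hα.injOn
        ((ofFn_degree_lt _).trans_le (by exact_mod_cast hcard)) hdeg fun i hi => ?_
      rw [Finset.mem_sdiff, Finset.mem_compl] at hi
      rw [← hQ i hi.1, Polynomial.eval_mul]
      congr 1
      rw [hf, ← rsEncoder_apply]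
      by_contra hne
      exact hi.2 (Finset.mem_filter.2 ⟨by simpa using hi.1, fun h => hne h.symm⟩)
    refine solveLinear_none h c fun i => ?_
    by_cases hi : i ∈ K
    · simp [locatorValue, hi, dotProduct]
    have hl : locatorValue α τ k (fun i => if i ∈ K then 0 else 1) x i = E.eval (α i) := by
      simp [locatorValue, hi, hE, eval_ofFn]
    rw [hl, mul_comm, hQ i hi, hQE, Polynomial.eval_mul, hf, eval_ofFn c, dotProduct,
      Finset.sum_mul]
    exact Finset.sum_congr rfl fun c _ => by ring

/-! ### The decoding program -/

variable {N : ℕ} {ρ : Data F}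

def call₃ (p a b c : Prog) : Prog := .comp p (.pair a (.pair b (.pair c .nil)))

theorem ev_call₃ {p a b c : Prog} {x y z : Data F} {r : Option (Data F)}
    (ha : a.eval N ρ = some x) (hb : b.eval N ρ = some y) (hc : c.eval N ρ = some z)
    (hp : p.eval N (.cons x (.cons y (.cons z .nil))) = r) : (call₃ p a b c).eval N ρ = r :=
  ev_comp (ev_pair ha (ev_pair hb (ev_pair hc (eval_nil _)))) hp

/-- A conditional on an optional value, which becomes variable `0` of `f` if it exists. -/
def matchE (e g f : Prog) : Prog :=
  letE e (.cond (V 0) (.comp g .snd) (.comp f (.pair (.comp .fst .fst) .snd)))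

theorem ev_match {X : Type} {enc : X → Data F} {e f g : Prog} {o : Option X} {r : Option (Data F)}
    (he : e.eval N ρ = some (Data.ofOption enc o)) (hg : o = none → g.eval N ρ = r)
    (hf : ∀ x, o = some x → f.eval N (.cons (enc x) ρ) = r) :
    (matchE e g f).eval N ρ = r := by
  cases o with
  | none => simp [matchE, he, Data.ofOption, hg]
  | some x => simp [matchE, he, Data.ofOption, hf]

/-- Arguments: the points, the weights, the received word, `τ`, `k`. -/
def rsDecodeP : Prog :=
  matchE (call₂ kernelVecP
      (tabE (lenE (V 0)) (tabE (addN (addN (V 5) (V 4)) (.pair .nil (V 4)))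
        (.cond (leE (.pair .nil (V 5)) (V 0))
          (mulE (mulE (nthE (V 3) (V 1)) (nthE (V 4) (V 1))) (powE (nthE (V 2) (V 1)) (V 0)))
          (.comp .neg (mulE (nthE (V 3) (V 1))
            (powE (nthE (V 2) (V 1)) (subN (V 0) (.pair .nil (V 5)))))))))
      (addN (addN (V 4) (V 3)) (.pair .nil (V 3))))
    .nil
    (letE (tabE (lenE (V 1)) (mulE (nthE (V 3) (V 0)) (sumE (.pair .nil (V 5))
        (mulE (nthE (V 2) (V 0)) (powE (nthE (V 3) (V 1)) (V 0))))))
      (call₃ solveLinearP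
        (tabE (lenE (V 2)) (tabE (V 7) (mulE (nthE (V 2) (V 1)) (powE (nthE (V 4) (V 1)) (V 0)))))
        (tabE (lenE (V 2)) (mulE (nthE (V 1) (V 0)) (nthE (V 5) (V 0))))
        (V 6)))

/-- The first linear system has `2 * τ + k + 1` unknowns, whence the bound. -/
theorem eval_rsDecodeP (α : Fin n → F) (τ k : ℕ) (g v : Fin n → F) (hn : n ≤ N)
    (hk : 2 * τ + k + 1 ≤ N) (hk' : k < N) (ρ : Data F) :
    rsDecodeP.eval N (.cons (Data.ofVec α) (.cons (Data.ofVec g) (.cons (Data.ofVec v)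
      (.cons (Data.ofNat τ) (.cons (Data.ofNat k) ρ))))) =
      some (Data.ofOption Data.ofVec (rsDecode α τ k g v)) := by
  have hτ : τ + 1 ≤ N := by omega
  have hs : τ + 1 + (τ + k) ≤ N := by omega
  refine ev_match (enc := Data.ofVec) (o := kernelVec (locatorRow α τ k g v)) (ev_call₂
    (ev_tab (enc := Data.ofVec) (v := locatorRow α τ k g v) (ev_len (v := α) rfl hn) hn fun i =>
      ev_tabVec (eval_addN (eval_addN rfl rfl hk'.le) rfl (by omega)) hs fun p =>
        ev_ite (enc := Data.elt) (eval_leE (m := τ + 1) rfl rfl (by omega))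
          (fun _ => ev_neg (ev_mul (ev_vec rfl rfl hn) (eval_powE (ev_vec rfl rfl hn)
            (eval_subN (n := τ + 1) rfl rfl hτ) (by omega))))
          fun _ => ev_mul (ev_mul (ev_vec rfl rfl hn) (ev_vec rfl rfl hn))
            (eval_powE (ev_vec rfl rfl hn) rfl (by omega)))
    (eval_addN (eval_addN rfl rfl hk'.le) rfl (by omega)) (eval_kernelVecP hs hn _ _))
    (fun h => by simp [rsDecode, h, Data.ofOption])
    fun x h => ?_
  have : rsDecode α τ k g v = solveLinear
      (fun i (c : Fin k) => locatorValue α τ k g x i * α i ^ (c : ℕ))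
      fun i => locatorValue α τ k g x i * v i := by simp [rsDecode, h]
  rw [this]
  exact eval_letE_of (ev_tabVec (v := locatorValue α τ k g x) (ev_len (v := α) rfl hn) hn fun i =>
      ev_mul (ev_vec rfl rfl hn) (eval_sumE (k := τ + 1) rfl hτ fun c =>
        ev_mul (ev_vec (k := Fin.castAdd _ c) rfl rfl hs)
          (eval_powE (ev_vec rfl rfl hn) rfl (by omega)))) <|
    ev_call₃ (ev_tab (enc := Data.ofVec) (ev_len (v := α) rfl hn) hn fun i => ev_tabVec rfl hk'.le
      fun c => ev_mul (ev_vec rfl rfl hn) (eval_powE (ev_vec rfl rfl hn) rfl (by omega)))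
      (ev_tabVec (ev_len (v := α) rfl hn) hn fun i => ev_mul (ev_vec rfl rfl hn) (ev_vec rfl rfl hn))
      rfl (eval_solveLinearP hk' hn _ _ _)

end ReedSolomon
end PSMT

namespace PSMT

/-! ### Uniqueness of decoding -/

section Codes

variable {F : Type} [Field F] [DecidableEq F] {t ℓ : ℕ}

theorem hammingNorm_le_of_support {n : ℕ} {e : Fin n → F} {K : Finset (Fin n)}
    (h : ∀ i ∉ K, e i = 0) : hammingNorm e ≤ K.card :=
  Finset.card_le_card fun i hi => by
    by_contra hK
    exact (Finset.mem_filter.1 hi).2 (h i hK)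

theorem IsMDS.eq_zero {k n d : ℕ} {g : (Fin k → F) →ₗ[F] (Fin n → F)} (hg : IsMDS g)
    {x : Fin n → F} (hx : x ∈ LinearMap.range g) (hw : hammingNorm x ≤ d) (hd : d + k < n + 1) :
    x = 0 := by
  by_contra h0
  have := hg.2.2 ⟨x, hx, h0, rfl⟩
  omega

theorem IsMDS.eq_of_card_ne {k n d : ℕ} {g : (Fin k → F) →ₗ[F] (Fin n → F)} (hg : IsMDS g)
    {c c' : Fin k → F} {K : Finset (Fin n)} (h : ∀ i ∉ K, g c i = g c' i) (hK : K.card ≤ d)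
    (hd : d + k < n + 1) : c = c' := by
  apply hg.1
  rw [← sub_eq_zero, ← map_sub]
  refine hg.eq_zero ⟨_, rfl⟩ ((hammingNorm_le_of_support (K := K) fun i hi => ?_).trans hK) hd
  simp [h i hi]

namespace Setup

variable (S : Setup F t)

theorem eq_zero_of_mem_of_weight {x : Fin (2 * t + 1) → F} (hx : x ∈ LinearMap.range S.gen)
    (hw : hammingNorm x ≤ t) : x = 0 :=
  S.gen_mds.eq_zero hx hw (by omega)

theorem sub_mem_of_syndrome_eq {x y : Fin (2 * t + 1) → F} (h : S.H.mulVec x = S.H.mulVec y) :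
    x - y ∈ LinearMap.range S.gen := by
  rw [← S.H_spec, Matrix.mulVec_sub, h, sub_self]

/-- The difference is a codeword of weight at most `t`, below the minimum distance `t + 1`. This is
why syndromes can stand for errors on a fixed set of corrupted channels. -/
theorem eq_of_syndrome_eq {e e' : Fin (2 * t + 1) → F} {K : Finset (Fin (2 * t + 1))}
    (hK : K.card ≤ t) (he : ∀ i ∉ K, e i = 0) (he' : ∀ i ∉ K, e' i = 0)
    (h : S.H.mulVec e = S.H.mulVec e') : e = e' := by
  rw [← sub_eq_zero]
  refine S.eq_zero_of_mem_of_weight (S.sub_mem_of_syndrome_eq h)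
    ((hammingNorm_le_of_support (K := K) fun i hi => ?_).trans hK)
  simp [he i hi, he' i hi]

/-- Only the sum of the weights is restricted, which serves in two ways: for uniqueness of decoding,
and contrapositively to show that a true error different from the decoded one must be heavy. -/
theorem eq_of_weight {e e' y : Fin (2 * t + 1) → F} (hy : y - e ∈ LinearMap.range S.gen)
    (hy' : y - e' ∈ LinearMap.range S.gen) (hw : hammingNorm e + hammingNorm e' ≤ t) : e = e' := by
  have h1 : e - e' ∈ LinearMap.range S.gen := by
    have := Submodule.sub_mem _ hy' hy
    simpa using this
  rw [← sub_eq_zero]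
  refine S.eq_zero_of_mem_of_weight h1 (le_trans ?_ hw)
  have h2 := hammingDist_triangle e 0 e'
  rw [hammingDist_zero_right, hammingDist_zero_left, hammingDist_comm,
    hammingDist_eq_hammingNorm] at h2
  rw [sub_eq_add_neg]
  simpa [sub_eq_add_neg, add_comm] using h2

end Setup

theorem decodeError_some {S : Setup F t} {y e : Fin (2 * t + 1) → F}
    (h : decodeError S y = some e) :
    2 * hammingNorm e ≤ t ∧ y - e ∈ LinearMap.range S.gen := by
  unfold decodeError at h
  split_ifs at h with he
  obtain rfl := Option.some.inj h
  exact he.choose_spec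

theorem decodeError_eq_some {S : Setup F t} {y e : Fin (2 * t + 1) → F}
    (hw : 2 * hammingNorm e ≤ t) (he : y - e ∈ LinearMap.range S.gen) :
    decodeError S y = some e := by
  have hex : ∃ e : Fin (2 * t + 1) → F,
    2 * hammingNorm e ≤ t ∧ y - e ∈ LinearMap.range S.gen := ⟨e, hw, he⟩
  rw [decodeError, dif_pos hex]
  have := hex.choose_spec
  rw [S.eq_of_weight this.2 he (by omega)]

theorem decodeError_eq_none {S : Setup F t} {y : Fin (2 * t + 1) → F} :
    decodeError S y = none ↔
      ∀ e, y - e ∈ LinearMap.range S.gen → t < 2 * hammingNorm e := by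
  constructor
  · intro h e he
    by_contra hlt
    rw [decodeError_eq_some (not_lt.1 hlt) he] at h
    cases h
  · intro h
    rw [decodeError, dif_neg]
    rintro ⟨e, hw, he⟩
    exact absurd (h e he) (by omega)

/-- The codewords of two admissible messages differ at most on `K` and on `t - |K|` further
positions for each, together at most `2t - |K| ≤ 2t - m`, which is below the distance `2t + 1 - m`.
-/
theorem genDecode_eq {S : Setup F t} {m : ℕ} {K : Finset (Fin (2 * t + 1))}
    {v : Fin (2 * t + 1) → F} (hm : m ≤ K.card) (hK : K.card ≤ t) {c : Fin (m + 1) → F}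
    (hc : (Kᶜ.filter fun i => S.bgen m c i ≠ v i).card ≤ t - K.card) : genDecode S m K v = c := by
  have hex : m ≤ K.card ∧ K.card ≤ t ∧ ∃ c : Fin (m + 1) → F,
    (Kᶜ.filter fun i => S.bgen m c i ≠ v i).card ≤ t - K.card := ⟨hm, hK, c, hc⟩
  rw [genDecode, dif_pos hex]
  have h2 := hex.2.2.choose_spec
  refine (S.bgen_mds m (hm.trans hK)).eq_of_card_ne (d := 2 * t - m)
    (K := K ∪ ((Kᶜ.filter fun i => S.bgen m hex.2.2.choose i ≠ v i) ∪
      (Kᶜ.filter fun i => S.bgen m c i ≠ v i))) (fun i hi => ?_) ?_ (by omega)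
  · simp only [Finset.mem_union, Finset.mem_filter, Finset.mem_compl, not_or, not_and, not_not]
      at hi
    rw [hi.2.1 hi.1, hi.2.2 hi.1]
  · refine (Finset.card_union_le _ _).trans ?_
    have h1 := Finset.card_union_le (Kᶜ.filter fun i => S.bgen m hex.2.2.choose i ≠ v i)
      (Kᶜ.filter fun i => S.bgen m c i ≠ v i)
    omega

theorem genDecode_of_not {S : Setup F t} {m : ℕ} {K : Finset (Fin (2 * t + 1))}
    {v : Fin (2 * t + 1) → F} (h : ¬ (m ≤ K.card ∧ K.card ≤ t)) : genDecode S m K v = 0 := by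
  rw [genDecode, dif_neg]
  exact fun h' => h ⟨h'.1, h'.2.1⟩

theorem genDecode_of_forall {S : Setup F t} {m : ℕ} {K : Finset (Fin (2 * t + 1))}
    {v : Fin (2 * t + 1) → F}
    (h : ∀ c, t - K.card < (Kᶜ.filter fun i => S.bgen m c i ≠ v i).card) :
    genDecode S m K v = 0 := by
  rw [genDecode, dif_neg]
  rintro ⟨_, _, c, hc⟩
  have h1 := h c
  have h2 : (Kᶜ.filter fun i => S.bgen m c i ≠ v i).card ≤ t - K.card := by convert hc
  omega

theorem errorOfSyndrome_eq {S : Setup F t} {K : Finset (Fin (2 * t + 1))} {σ : Fin t → F}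
    (hK : K.card ≤ t) {e : Fin (2 * t + 1) → F} (he : ∀ i ∉ K, e i = 0)
    (hσ : S.H.mulVec e = σ) : errorOfSyndrome S K σ = e := by
  have hex : K.card ≤ t ∧ ∃ e : Fin (2 * t + 1) → F, (∀ i ∉ K, e i = 0) ∧ S.H.mulVec e = σ :=
    ⟨hK, e, he, hσ⟩
  rw [errorOfSyndrome, dif_pos hex]
  have := hex.2.choose_spec
  exact S.eq_of_syndrome_eq hK this.1 he (this.2.trans hσ.symm)

theorem mem_pseudoBasis {S : Setup F t} {r : ℕ} {y : Fin r → Fin (2 * t + 1) → F} {j : Fin r} :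
    j ∈ pseudoBasis S y ↔
      S.H.mulVec (y j) ∉ Submodule.span F ((fun i => S.H.mulVec (y i)) '' {i | i < j}) := by
  simp [pseudoBasis]

end Codes

/-! ### Decoding by linear algebra -/

section Algorithms

variable {F : Type} [Field F] [DecidableEq F] {t : ℕ} {S : Setup F t}

/-- There are no erasures and the radius is `t / 2`; the condition for decoding reads `2 * (t / 2) +
(t + 1) ≤ 2 * t + 1`. -/
theorem decodeError_eq_rsDecode (hS : S.IsReedSolomon) (y : Fin (2 * t + 1) → F) :
    decodeError S y = (rsDecode S.pts (t / 2) (t + 1) (fun _ => 1) y).map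
      fun c i => y i - rsEncoder S.pts (t + 1) c i := by
  have hg : (fun _ => 1 : Fin (2 * t + 1) → F) =
      fun i => if i ∈ (∅ : Finset (Fin (2 * t + 1))) then 0 else 1 := by simp
  rw [hg]
  have hn : (∅ : Finset (Fin (2 * t + 1))).card + 2 * (t / 2) + (t + 1) ≤ 2 * t + 1 := by
    simp; omega
  cases h : rsDecode S.pts (t / 2) (t + 1)
      (fun i => if i ∈ (∅ : Finset (Fin (2 * t + 1))) then 0 else 1) y with
  | none =>
    rw [Option.map_none, decodeError_eq_none]
    rintro e ⟨c, hc⟩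
    have := rsDecode_none S.pts_injective hn (by omega) h c
    have h2 : ((∅ : Finset (Fin (2 * t + 1)))ᶜ.filter fun i =>
        rsEncoder S.pts (t + 1) c i ≠ y i).card = hammingNorm e := by
      rw [hammingNorm]
      congr 1
      ext i
      have : rsEncoder S.pts (t + 1) c i = y i - e i := by rw [← hS.1, hc]; rfl
      simp [this]
    omega
  | some c =>
    have := rsDecode_some S.pts_injective hn h
    rw [Option.map_some]
    refine decodeError_eq_some ?_ ⟨c, ?_⟩
    · have h2 : ((∅ : Finset (Fin (2 * t + 1)))ᶜ.filter fun i =>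
          rsEncoder S.pts (t + 1) c i ≠ y i).card =
          hammingNorm fun i => y i - rsEncoder S.pts (t + 1) c i := by
        rw [hammingNorm]
        congr 1
        ext i
        simp [sub_eq_zero, @eq_comm _ (y i)]
      omega
    · rw [hS.1]; funext i; simp

/-- With erasures `K`, radius `t - |K|` and `m + 1` coefficients, the condition `|K| + 2 (t - |K|) +
(m + 1) ≤ 2t + 1` amounts to `m ≤ |K|`. -/
theorem genDecode_eq_rsDecode (hS : S.IsReedSolomon) (m : ℕ) (K : Finset (Fin (2 * t + 1)))
    (v : Fin (2 * t + 1) → F) :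
    genDecode S m K v = if m ≤ K.card ∧ K.card ≤ t then
      (rsDecode S.pts (t - K.card) (m + 1) (fun i => if i ∈ K then 0 else 1) v).getD 0 else 0 := by
  split_ifs with hK
  · have hm := hS.2 m (hK.1.trans hK.2)
    cases h : rsDecode S.pts (t - K.card) (m + 1) (fun i => if i ∈ K then 0 else 1) v with
    | none =>
      refine genDecode_of_forall fun c => ?_
      rw [hm]
      exact rsDecode_none S.pts_injective (by omega) (by omega) h c
    | some c =>
      refine genDecode_eq hK.1 hK.2 ?_
      rw [hm]
      exact rsDecode_some S.pts_injective (by omega) h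
  · exact genDecode_of_not hK

/-- With the columns of `H` outside `K` set to zero, the unknowns there are irrelevant, so any
solution may be cut off to `K`. -/
theorem errorOfSyndrome_eq_solveLinear (S : Setup F t) (K : Finset (Fin (2 * t + 1)))
    (σ : Fin t → F) :
    errorOfSyndrome S K σ = if K.card ≤ t then
      fun i => if i ∈ K then
        ((solveLinear (fun a i => if i ∈ K then S.H a i else 0) σ).getD 0) i else 0 else 0 := by
  have key : ∀ (x : Fin (2 * t + 1) → F) (a : Fin t),
      (fun i => if i ∈ K then S.H a i else 0) ⬝ᵥ x =
        S.H.mulVec (fun i => if i ∈ K then x i else 0) a := by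
    intro x a
    simp only [Matrix.mulVec, dotProduct]
    exact Finset.sum_congr rfl fun i _ => by split_ifs <;> simp
  split_ifs with hK
  · cases h : solveLinear (fun a i => if i ∈ K then S.H a i else 0) σ with
    | none =>
      rw [errorOfSyndrome, dif_neg]
      · funext i; simp
      · rintro ⟨_, e, he, rfl⟩
        refine solveLinear_none h e fun a => ?_
        rw [key]
        congr 2
        funext i
        by_cases hi : i ∈ K <;> simp [hi, he]
    | some x =>
      refine errorOfSyndrome_eq hK (fun i hi => by simp [hi]) (funext fun a => ?_)
      rw [← solveLinear_some h a, key]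
      rfl
  · rw [errorOfSyndrome, dif_neg]
    exact fun h => hK h.1

/-- Membership in the span of the earlier syndromes is solvability of a system in which the other
columns are set to zero. -/
theorem mem_pseudoBasis_iff_solveLinear {r : ℕ} (y : Fin r → Fin (2 * t + 1) → F) (j : Fin r) :
    j ∈ pseudoBasis S y ↔ solveLinear
      (fun a (i : Fin r) => if (j : ℕ) ≤ i then 0 else S.H.mulVec (y i) a)
      (S.H.mulVec (y j)) = none := by
  have key : ∀ x : Fin r → F, (∀ a, (fun i : Fin r => if (j : ℕ) ≤ i then 0 else
      S.H.mulVec (y i) a) ⬝ᵥ x = S.H.mulVec (y j) a) ↔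
      ∑ i ∈ Finset.univ.filter (· < j), x i • S.H.mulVec (y i) = S.H.mulVec (y j) := by
    intro x
    rw [funext_iff]
    refine forall_congr' fun a => ?_
    rw [Finset.sum_apply, dotProduct, Finset.sum_filter]
    have : ∀ i : Fin r, (if (j : ℕ) ≤ i then 0 else S.H.mulVec (y i) a) * x i =
        if i < j then (x i • S.H.mulVec (y i)) a else 0 := by
      intro i
      by_cases h : i < j
      · have : ¬ (j : ℕ) ≤ i := by simpa using h
        simp [h, this, mul_comm]
      · have : (j : ℕ) ≤ i := by simpa using h
        simp [h, this]
    rw [Finset.sum_congr rfl fun i _ => this i]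
  rw [mem_pseudoBasis]
  have hspan : S.H.mulVec (y j) ∈ Submodule.span F ((fun i => S.H.mulVec (y i)) '' {i | i < j}) ↔
      ∃ x : Fin r → F,
        ∑ i ∈ Finset.univ.filter (· < j), x i • S.H.mulVec (y i) = S.H.mulVec (y j) := by
    have hc : {i : Fin r | i < j} =
        ((Finset.univ.filter (· < j) : Finset (Fin r)) : Set (Fin r)) := by
      ext; simp
    rw [hc, Submodule.mem_span_image_finset_iff_exists_fun]
    constructor
    · rintro ⟨c, hx⟩
      refine ⟨fun i => if h : i ∈ Finset.univ.filter (· < j) then c ⟨i, h⟩ else 0, ?_⟩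
      rw [← hx, ← Finset.sum_coe_sort]
      exact Finset.sum_congr rfl fun i _ => by dsimp only; rw [dif_pos i.2]
    · rintro ⟨x, hx⟩
      exact ⟨fun i => x i, (Finset.sum_coe_sort _ fun i => x i • S.H.mulVec (y i)).trans hx⟩
  rw [hspan]
  constructor
  · intro h
    cases hs : solveLinear (fun a (i : Fin r) => if (j : ℕ) ≤ i then 0 else S.H.mulVec (y i) a)
      (S.H.mulVec (y j)) with
    | none => rfl
    | some x => exact absurd ⟨x, (key x).1 (solveLinear_some hs)⟩ h
  · rintro h ⟨x, hx⟩
    exact solveLinear_none h x ((key x).2 hx)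

end Algorithms
end PSMT

namespace PSMT

/-! ### Subroutines: search, sets, syndromes, decoding, pseudo-basis, multipliers -/

section Subroutines

variable {F : Type} [Field F] [DecidableEq F] {N : ℕ} {ρ : Data F}

theorem ev_eq {p : Prog} {x y : Data F} (h : p.eval N ρ = some x) (hxy : x = y) :
    p.eval N ρ = some y := hxy ▸ h

/-- The environment without its first `k` variables. -/
def D : ℕ → Prog
  | 0 => .id
  | k + 1 => .comp (D k) .snd

/-- The first item of `l` for which the value of `b` is not `nil`. -/
def findE (l b : Prog) : Prog :=
  foldE l .nil (.cond (V 1) (.cond (skipState b) .nil (.pair (V 0) .nil)) (V 1))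

theorem ev_find {X : Type} {enc : X → Data F} {L : List X} {p : X → Bool} {l b : Prog}
    (hl : l.eval N ρ = some (Data.ofList (L.map enc))) (hL : L.length ≤ N)
    (hb : ∀ x ∈ L, b.eval N (.cons (enc x) ρ) = some (Data.ofBool (p x))) :
    (findE l b).eval N ρ = some (Data.ofOption enc (L.find? p)) := by
  rw [findE, eval_foldE (encS := Data.ofOption enc)
    (fun s x => match s with | some y => some y | none => if p x = true then some x else none)
    hl (s := none) rfl hL]
  · congr 2
    have : ∀ (L : List X) (s : Option X), L.foldl (fun s x => match s with
        | some y => some y | none => if p x = true then some x else none) s =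
        s.or (L.find? p) := by
      intro L
      induction L with
      | nil => intro s; cases s <;> rfl
      | cons x L ih =>
        intro s
        rw [List.foldl_cons, ih]
        cases s with
        | some y => simp
        | none => cases h : p x <;> simp [h]
    rw [this]; simp
  · intro x hx s
    cases s with
    | some y => simp [Data.ofOption]
    | none => cases h : p x <;> simp [Data.ofOption, hb x hx, h]

/-- The value at a point of the polynomial with given coefficients. -/
def polyP : Prog := sumE (lenE (V 0)) (mulE (powE (V 2) (V 0)) (nthE (V 1) (V 0)))

theorem ev_poly {a b : Prog} {n k : ℕ} {α : Fin n → F} {c : Fin k → F} {i : Fin n}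
    (ha : a.eval N ρ = some (Data.ofVec c)) (hb : b.eval N ρ = some (.elt (α i))) (hk : k ≤ N) :
    (call₂ polyP a b).eval N ρ = some (.elt (rsEncoder α k c i)) :=
  ev_call₂ ha hb <| eval_sumE (ev_len (v := c) rfl hk) hk fun j =>
    ev_mul (eval_powE rfl rfl (j.2.le.trans hk)) (ev_vec rfl rfl hk)

/-- The Hamming weight. -/
def weightP : Prog := countE (lenE (V 0)) (.comp .isZero (nthE (V 1) (V 0)))

theorem eval_weightP {n : ℕ} (e : Fin n → F) (hn : n ≤ N) (ρ : Data F) :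
    weightP.eval N (.cons (Data.ofVec e) ρ) = some (Data.ofNat (hammingNorm e)) := by
  refine ev_eq (eval_countE (p := fun i => decide (e i ≠ 0)) (ev_len (v := e) rfl hn) hn fun i =>
    ev_isZero (ev_vec rfl rfl hn)) ?_
  simp [hammingNorm]

/-- A subset of `Fin n` as the list of its indicator values. -/
def Data.ofSet {F : Type} {n : ℕ} (I : Finset (Fin n)) : Data F :=
  Data.ofFamily Data.ofBool fun i => decide (i ∈ I)

theorem ev_mem {n : ℕ} {l i : Prog} {I : Finset (Fin n)} {k : Fin n}
    (hl : l.eval N ρ = some (Data.ofSet I)) (hi : i.eval N ρ = some (Data.ofNat k)) (hn : n ≤ N) :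
    (nthE l i).eval N ρ = some (Data.ofBool (decide (k ∈ I))) :=
  ev_nth (enc := Data.ofBool) (v := fun i => decide (i ∈ I)) hl hi hn

/-- Both lists are increasing, free of repetitions and have the same members. -/
theorem filter_finRange_mem {r : ℕ} (I : Finset (Fin r)) :
    (List.finRange r).filter (fun i => decide (i ∈ I)) = I.sort (· ≤ ·) := by
  refine List.Perm.eq_of_pairwise' (r := (· ≤ ·)) ?_ (Finset.pairwise_sort I _) ?_
  · exact (List.pairwise_le_finRange r).filter _
  · rw [List.perm_ext_iff_of_nodup ((List.nodup_finRange r).filter _) (Finset.sort_nodup _ _)]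
    simp

/-- A list of indices as data. -/
def Data.ofIndices {F : Type} {r : ℕ} (L : List (Fin r)) : Data F :=
  Data.ofList (L.map fun i : Fin r => Data.ofNat i)

/-- The members of a set in increasing order. -/
def membersP : Prog := filterE (lenE (V 0)) (nthE (V 1) (V 0))

theorem eval_membersP {r : ℕ} (I : Finset (Fin r)) (hr : r ≤ N) (ρ : Data F) :
    membersP.eval N (.cons (Data.ofSet I) ρ) = some (Data.ofIndices (I.sort (· ≤ ·))) := by
  rw [← filter_finRange_mem]
  exact eval_filterE (ev_len (v := fun i => decide (i ∈ I)) rfl hr) hr fun i =>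
    ev_mem rfl rfl hr

/-- The members of the complement of a set in increasing order. -/
def complementP : Prog := filterE (lenE (V 0)) (notE (nthE (V 1) (V 0)))

theorem eval_complementP {r : ℕ} (I : Finset (Fin r)) (hr : r ≤ N) (ρ : Data F) :
    complementP.eval N (.cons (Data.ofSet I) ρ) = some (Data.ofIndices (Iᶜ.sort (· ≤ ·))) := by
  rw [← filter_finRange_mem]
  refine ev_eq (eval_filterE (ev_len (v := fun i => decide (i ∈ I)) rfl hr) hr fun i =>
    ev_not (ev_mem rfl rfl hr)) ?_
  simp [Data.ofIndices]

theorem eval_countSet {r : ℕ} {e b : Prog} (I : Finset (Fin r)) (hr : r ≤ N)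
    (he : e.eval N ρ = some (Data.ofNat r))
    (hb : ∀ i : Fin r, b.eval N (.cons (Data.ofNat i) ρ) = some (Data.ofBool (decide (i ∈ I)))) :
    (countE e b).eval N ρ = some (Data.ofNat I.card) := by
  refine ev_eq (eval_countE he hr hb) ?_
  simp

/-- The number of members of a set. -/
def cardP : Prog := countE (lenE (V 0)) (nthE (V 1) (V 0))

theorem eval_cardP {r : ℕ} (I : Finset (Fin r)) (hr : r ≤ N) (ρ : Data F) :
    cardP.eval N (.cons (Data.ofSet I) ρ) = some (Data.ofNat I.card) :=
  eval_countSet I hr (ev_len (v := fun i => decide (i ∈ I)) rfl hr) fun _ =>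
    ev_mem rfl rfl hr

variable {t : ℕ} {ℓ : ℕ} {S : Setup F t}

def syndromeP : Prog := mapE (V 5) (dotE (V 0) (V 1))

theorem eval_syndromeP (y : Fin (2 * t + 1) → F) (hN : 2 * t + 1 ≤ N) :
    syndromeP.eval N (.cons (Data.ofVec y) (S.toData ℓ)) = some (Data.ofVec (S.H.mulVec y)) :=
  ev_map (enc := Data.ofVec) (enc' := Data.elt) (v := fun a => S.H a) rfl (by omega) fun a =>
    ev_dot rfl rfl hN

def decodeErrorP : Prog :=
  matchE (.comp rsDecodeP (.pair (V 3) (.pair (mapE (V 3) .one) (.pair (V 0)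
      (.pair (.comp .fst (divModN (V 1) (constN 2))) (.pair (.pair .nil (V 1)) .nil))))))
    .nil
    (.pair (tabE (lenE (V 4)) (subE (nthE (V 2) (V 0)) (call₂ polyP (V 1) (nthE (V 5) (V 0)))))
      .nil)

theorem eval_decodeErrorP (hS : S.IsReedSolomon) (y : Fin (2 * t + 1) → F) (hN : 2 * t + 2 ≤ N) :
    decodeErrorP.eval N (.cons (Data.ofVec y) (S.toData ℓ)) =
      some (Data.ofOption Data.ofVec (decodeError S y)) := by
  have hn : 2 * t + 1 ≤ N := by omega
  have ht : t ≤ N := by omega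
  rw [decodeError_eq_rsDecode hS]
  refine ev_match (enc := Data.ofVec) (o := rsDecode S.pts (t / 2) (t + 1) (fun _ => 1) y)
    (ev_comp (ev_pair rfl (ev_pair (ev_map (enc := Data.elt) (v := S.pts) (enc' := Data.elt)
      (w := fun _ => 1) rfl hn fun _ => rfl) (ev_pair rfl (ev_pair
      (ev_comp (eval_divModN rfl (eval_constN 2 _) ht (by omega) (by omega)) rfl)
      (ev_pair (ev_pair rfl rfl) rfl)))))
      (eval_rsDecodeP S.pts (t / 2) (t + 1) _ y hn (by omega) (by omega) _))
    (fun h => by rw [h]; rfl) fun c h => ?_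
  rw [h]
  exact ev_pair (ev_tabVec (ev_len (v := S.pts) rfl hn) hn fun i =>
    ev_sub (ev_vec rfl rfl hn) (ev_poly rfl (ev_vec rfl rfl hn) (by omega))) rfl

def pseudoBasisP : Prog :=
  letE (mapE (V 0) (.comp syndromeP (.pair (V 0) (D 2))))
    (tabE (lenE (V 0)) (notE (call₃ solveLinearP
      (tabE (V 3) (tabE (lenE (V 2))
        (.cond (leE (V 2) (V 0)) (nthE (nthE (V 3) (V 0)) (V 1)) .zero)))
      (nthE (V 1) (V 0)) (lenE (V 1)))))

theorem eval_pseudoBasisP {r : ℕ} (y : Fin r → Fin (2 * t + 1) → F) (hN : 2 * t + 1 ≤ N)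
    (hr : r < N) :
    pseudoBasisP.eval N (.cons (Data.ofFamily Data.ofVec y) (S.toData ℓ)) =
      some (Data.ofSet (pseudoBasis S y)) := by
  refine eval_letE_of (ev_map (enc := Data.ofVec) (enc' := Data.ofVec)
    (w := fun j => S.H.mulVec (y j)) rfl hr.le fun j =>
      ev_comp (ev_pair rfl rfl) (eval_syndromeP _ hN)) <|
    ev_tab (enc := Data.ofBool) (ev_len (v := fun j => S.H.mulVec (y j)) rfl hr.le) hr.le fun j => ?_
  have := ev_call₃ (N := N) (ρ := .cons (Data.ofNat j) (.cons
      (Data.ofFamily Data.ofVec fun j => S.H.mulVec (y j)) (.cons (Data.ofFamily Data.ofVec y)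
      (S.toData ℓ))))
    (ev_tab (enc := Data.ofVec)
      (v := fun a (i : Fin r) => if (j : ℕ) ≤ i then 0 else S.H.mulVec (y i) a) (e := V 3)
      (b := tabE (lenE (V 2)) (.cond (leE (V 2) (V 0)) (nthE (nthE (V 3) (V 0)) (V 1)) .zero))
      rfl (by omega)
      fun a => ev_tabVec (ev_len (v := fun j => S.H.mulVec (y j)) rfl hr.le) hr.le fun i =>
        ev_ite (enc := Data.elt) (eval_leE rfl rfl (by omega)) (fun _ => rfl) fun _ =>
          ev_vec (ev_nth (enc := Data.ofVec) (v := fun j => S.H.mulVec (y j)) rfl rfl hr.le) rfl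
            (by omega))
    (ev_nth (enc := Data.ofVec) (l := V 1) (i := V 0) (v := fun j => S.H.mulVec (y j)) rfl rfl hr.le)
    (ev_len (e := V 1) (v := fun j => S.H.mulVec (y j)) rfl hr.le)
    (eval_solveLinearP hr (by omega) _ _ _)
  rw [eval_notE, this, Option.bind_some]
  simp only [mem_pseudoBasis_iff_solveLinear]
  generalize solveLinear (F := F) _ _ = o
  cases o <;> rfl

/-- Arguments: `f`, `e`, the points. -/
def pickP : Prog :=
  matchE (findE (V 2) (andE (.comp .isZero (V 0)) (notE (anyE (lenE (V 1))
      (andE (.comp .isZero (nthE (V 2) (V 0)))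
        (notE (.comp .isZero (addE (nthE (V 2) (V 0)) (mulE (V 1) (nthE (V 3) (V 0)))))))))))
    .one (V 0)

theorem eval_pickP (f e : Fin (2 * t + 1) → F) (hN : 2 * t + 1 ≤ N) (ρ : Data F) :
    pickP.eval N (.cons (Data.ofVec f) (.cons (Data.ofVec e) (.cons (Data.ofVec S.pts) ρ))) =
      some (.elt (pickMultiplier S f e)) := by
  refine ev_match (enc := Data.elt) (o := (List.ofFn S.pts).find? fun a =>
    decide (a ≠ 0 ∧ ∀ j, f j ≠ 0 → f j + a * e j ≠ 0)) (ev_find ?_ (by simpa using hN)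
      fun a _ => ?_) (fun h => ?_) fun a h => ?_
  · rw [List.map_ofFn]; rfl
  · refine ev_and (ev_isZero rfl) fun _ => ev_eq (ev_not (eval_anyE
      (p := fun j => decide (f j ≠ 0 ∧ f j + a * e j = 0)) (ev_len (v := f) rfl hN) hN fun j =>
        ev_and (ev_isZero (ev_vec rfl rfl hN)) fun _ => ev_eq (ev_not (ev_isZero (ev_add
          (ev_vec rfl rfl hN) (ev_mul rfl (ev_vec rfl rfl hN))))) ?_)) ?_
    · congr 1; simp
    · congr 1; rw [← decide_not]; simp
  · rw [pickMultiplier, h]; rfl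
  · rw [pickMultiplier, h]; rfl

end Subroutines
end PSMT

namespace PSMT

/-! ### The special word and generalized broadcast as programs -/

section AlicePrograms

variable {F : Type} [Field F] [DecidableEq F] {N : ℕ} {t ℓ : ℕ} {S : Setup F t}

/-- One pass of the search for the special word; the state holds whether the search is finished,
the error and its coefficients. -/
noncomputable def combineStep (S : Setup F t) {r : ℕ} (e : Fin r → Fin (2 * t + 1) → F)
    (s : Bool × (Fin (2 * t + 1) → F) × (Fin r → F)) (i : Fin r) :
    Bool × (Fin (2 * t + 1) → F) × (Fin r → F) :=
  if s.1 = true then s else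
    let a := pickMultiplier S s.2.1 (e i)
    let f' := s.2.1 + a • e i
    (decide (¬ 3 * hammingNorm f' ≤ t), f', s.2.2 + Pi.single i a)

/-- A loop of a program always runs through its whole list; stopping early is imitated by a flag
after which the state no longer changes. -/
theorem combine_eq_foldl {r : ℕ} (e : Fin r → Fin (2 * t + 1) → F) (L : List (Fin r))
    (f : Fin (2 * t + 1) → F) (c : Fin r → F) :
    combine S e L f c = (L.foldl (combineStep S e) (false, f, c)).2.2 := by
  have htrue : ∀ (L : List (Fin r)) f c,
      L.foldl (combineStep S e) (true, f, c) = (true, f, c) := by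
    intro L
    induction L with
    | nil => intros; rfl
    | cons i L ih => intro f c; rw [List.foldl_cons, combineStep, if_pos rfl, ih]
  induction L generalizing f c with
  | nil => rfl
  | cons i L ih =>
    by_cases h : t < 3 * hammingNorm (f + pickMultiplier S f (e i) • e i)
    · simp [combine, combineStep, h, htrue]
    · simp [combine, combineStep, h, ih]

/-- The state of the search as data. -/
def Data.ofState {F : Type} {n r : ℕ} (s : Bool × (Fin n → F) × (Fin r → F)) : Data F :=
  .cons (Data.ofBool s.1) (.cons (Data.ofVec s.2.1) (Data.ofVec s.2.2))

/-- Arguments: the error `e i`, the index `i`, the error and the coefficients of the state, `t`, the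
points. -/
def combineStepP : Prog :=
  letE (.comp pickP (.pair (V 2) (.pair (V 0) (.pair (V 5) .nil))))
    (letE (tabE (lenE (V 3)) (addE (nthE (V 4) (V 0)) (mulE (V 1) (nthE (V 2) (V 0)))))
      (.pair (notE (leE (mulN (constN 3) weightP) (V 6))) (.pair (V 0)
        (tabE (lenE (V 5)) (addE (nthE (V 6) (V 0)) (.cond (eqN (V 0) (V 4)) .zero (V 2)))))))

theorem hammingNorm_le {F : Type} [Field F] [DecidableEq F] {n : ℕ} (e : Fin n → F) :
    hammingNorm e ≤ n := by
  simpa using hammingNorm_le_card_fintype (x := e)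

theorem ofVec_single {r : ℕ} {e b : Prog} {ρ : Data F} {i : Fin r} {a : F}
    (he : e.eval N ρ = some (Data.ofNat r)) (hr : r ≤ N)
    (hb : ∀ j : Fin r, b.eval N (.cons (Data.ofNat j) ρ) =
      some (.elt (if (j : ℕ) = i then a else 0))) :
    (tabE e b).eval N ρ = some (Data.ofVec (Pi.single i a : Fin r → F)) := by
  refine ev_tabVec he hr fun j => ev_eq (hb j) ?_
  simp [Pi.single_apply, Fin.ext_iff]

theorem eval_combineStepP {r : ℕ} (e : Fin r → Fin (2 * t + 1) → F) (i : Fin r)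
    (f : Fin (2 * t + 1) → F) (c : Fin r → F) (hN : 6 * t + 3 ≤ N) (hr : r ≤ N) :
    combineStepP.eval N (.cons (Data.ofVec (e i)) (.cons (Data.ofNat i) (.cons (Data.ofVec f)
      (.cons (Data.ofVec c) (.cons (Data.ofNat t) (.cons (Data.ofVec S.pts) .nil)))))) =
      some (Data.ofState (combineStep S e (false, f, c) i)) := by
  have hn : 2 * t + 1 ≤ N := by omega
  refine eval_letE_of (ev_comp (ev_pair rfl (ev_pair rfl (ev_pair rfl rfl)))
    (eval_pickP (S := S) f (e i) hn .nil)) <| eval_letE_of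
    (ev_tabVec (v := f + pickMultiplier S f (e i) • e i) (ev_len (v := f) rfl hn) hn fun j =>
      ev_add (ev_vec rfl rfl hn) (ev_mul rfl (ev_vec rfl rfl hn))) <|
    ev_pair (ev_eq (ev_not (eval_leE (eval_mulN (eval_constN 3 _) (eval_weightP _ hn _) (by omega)
      ((hammingNorm_le _).trans hn)) rfl (by omega))) ?_) <|
    ev_pair rfl (ev_tabVec (ev_len (v := c) rfl hr) hr fun j => ev_eq (ev_add (ev_vec rfl rfl hr)
      (ev_ite (enc := Data.elt) (ev_eqN rfl rfl (by omega) (by omega)) (fun _ => rfl)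
        fun _ => rfl)) ?_)
  · rw [← decide_not]; rfl
  · simp [combineStep, Pi.single_apply, Fin.ext_iff]

/-- Arguments: the words, the pseudo-basis, and the public data. -/
def specialCoeffP : Prog :=
  letE (mapE (V 0) (.comp decodeErrorP (.pair (V 0) (D 3))))
    (letE (mapE (V 0) (matchE (V 0) (tabE (lenE (V 6)) .zero) (V 0)))
      (letE (.comp membersP (.pair (V 3) .nil))
        (matchE (findE (V 0) (notE (nthE (V 3) (V 0))))
          (matchE (findE (V 0) (notE (leE (mulN (constN 3) (.comp weightP
              (.pair (nthE (V 2) (V 0)) .nil))) (V 6))))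
            (.cond (V 0) (tabE (lenE (V 3)) .zero)
              (.comp .snd (.comp .snd (foldE (.comp .snd (V 0))
                (.pair .nil (.pair (nthE (V 1) (.comp .fst (V 0)))
                  (tabE (lenE (V 3)) (.cond (eqN (V 0) (.comp .fst (V 1))) .zero .one))))
                (.cond (.comp .fst (V 1))
                  (.comp combineStepP (.pair (nthE (V 3) (V 0)) (.pair (V 0)
                    (.pair (.comp .fst (.comp .snd (V 1))) (.pair (.comp .snd (.comp .snd (V 1)))
                      (.pair (V 7) (.pair (V 9) .nil)))))))
                  (V 1))))))
            (tabE (lenE (V 4)) (.cond (eqN (V 0) (V 1)) .zero .one)))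
          (tabE (lenE (V 4)) (.cond (eqN (V 0) (V 1)) .zero .one)))))

theorem eval_specialCoeffP (hS : S.IsReedSolomon) {r : ℕ} (y : Fin r → Fin (2 * t + 1) → F)
    (I : Finset (Fin r)) (hN : 6 * t + 3 ≤ N) (hr : r ≤ N) :
    specialCoeffP.eval N (.cons (Data.ofFamily Data.ofVec y) (.cons (Data.ofSet I)
      (S.toData ℓ))) = some (Data.ofVec (specialCoeff S y I)) := by
  have hn : 2 * t + 1 ≤ N := by omega
  have hI : (I.sort (· ≤ ·)).length ≤ N := by
    rw [Finset.length_sort]; exact ((Finset.card_le_univ I).trans (by simp)).trans hr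
  refine eval_letE_of (ev_map (enc := Data.ofVec) (enc' := Data.ofOption Data.ofVec) rfl hr
    fun j => ev_comp (ev_pair rfl rfl) (eval_decodeErrorP hS (y j) (by omega))) ?_
  refine eval_letE_of (ev_map (enc := Data.ofOption Data.ofVec) (enc' := Data.ofVec)
    (w := fun j => (decodeError S (y j)).getD 0) rfl hr fun j =>
      ev_match (enc := Data.ofVec) (o := decodeError S (y j)) rfl (fun h => by
        rw [h]
        exact ev_tabVec (v := (0 : Fin (2 * t + 1) → F)) (ev_len (v := S.pts) rfl hn) hn
          fun _ => rfl)
        fun e h => by rw [h]; rfl) ?_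
  refine eval_letE_of (ev_comp (ev_pair rfl rfl) (eval_membersP I hr _)) ?_
  refine ev_match (enc := fun i : Fin r => Data.ofNat i)
    (o := (I.sort (· ≤ ·)).find? fun i => (decodeError S (y i)).isNone)
    (ev_find rfl hI fun i _ => ?_) (fun h1 => ?_) fun i h1 => ?_
  · have := ev_nth (N := N) (l := V 3) (i := V 0) (k := i) (enc := Data.ofOption Data.ofVec)
      (ρ := .cons (Data.ofNat i) (.cons (Data.ofIndices (I.sort (· ≤ ·))) (.cons
        (Data.ofFamily Data.ofVec fun j => (decodeError S (y j)).getD 0)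
        (.cons (Data.ofFamily (Data.ofOption Data.ofVec) fun j => decodeError S (y j))
          (.cons (Data.ofFamily Data.ofVec y) (.cons (Data.ofSet I) (S.toData ℓ)))))))
      (v := fun j => decodeError S (y j)) rfl rfl hr
    rw [eval_notE, this, Option.bind_some]
    generalize decodeError S (y i) = o
    cases o <;> rfl
  · refine ev_match (enc := fun i : Fin r => Data.ofNat i)
      (o := (I.sort (· ≤ ·)).find? fun i =>
        decide (t < 3 * hammingNorm ((decodeError S (y i)).getD 0)))
      (ev_find rfl hI fun i _ => ?_) (fun h2 => ?_) fun i h2 => ?_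
    · refine ev_eq (ev_not (eval_leE (eval_mulN (eval_constN 3 _) (ev_comp (ev_pair
        (ev_nth (enc := Data.ofVec) (k := i) (v := fun j => (decodeError S (y j)).getD 0) rfl rfl hr)
        rfl) (eval_weightP _ hn _)) (by omega) ((hammingNorm_le _).trans hn)) rfl (by omega))) ?_
      rw [← decide_not]; simp
    · cases hL : I.sort (· ≤ ·) with
      | nil =>
        have : specialCoeff S y I = 0 := by simp [specialCoeff, hL]
        rw [this]
        exact ev_tabVec (v := (0 : Fin r → F)) (ev_len (v := y) rfl hr) hr fun _ => rfl
      | cons i L =>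
        have : specialCoeff S y I = combine S (fun j => (decodeError S (y j)).getD 0) L
            ((decodeError S (y i)).getD 0) (Pi.single i 1) := by
          simp only [specialCoeff, h1, h2]
          simp only [hL]
        rw [this, combine_eq_foldl]
        rw [hL] at hI
        refine ev_comp (ev_comp (eval_foldE (L := L) (enc := fun i : Fin r => Data.ofNat i)
          (encS := Data.ofState)
          (combineStep S fun j => (decodeError S (y j)).getD 0)
          (s := (false, (decodeError S (y i)).getD 0, Pi.single i 1)) rfl
          (ev_pair rfl (ev_pair (ev_nth (enc := Data.ofVec) (k := i)
            (v := fun j => (decodeError S (y j)).getD 0) rfl rfl hr)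
            (ofVec_single (ev_len (v := y) rfl hr) hr fun j =>
              ev_ite (enc := Data.elt) (ev_eqN rfl rfl (by omega) (by omega)) (fun _ => rfl)
                fun _ => rfl))) (by simp at hI; omega) ?_) rfl) rfl
        rintro j _ ⟨d, f, c⟩
        cases d with
        | true => rfl
        | false =>
          exact ev_comp (ev_pair (ev_nth (enc := Data.ofVec) (k := j)
            (v := fun j => (decodeError S (y j)).getD 0) rfl rfl hr) (ev_pair rfl (ev_pair rfl
            (ev_pair rfl (ev_pair rfl (ev_pair rfl rfl))))))
            (eval_combineStepP (fun j => (decodeError S (y j)).getD 0) j f c hN hr)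
    · have : specialCoeff S y I = Pi.single i 1 := by simp only [specialCoeff, h1, h2]
      rw [this]
      exact ofVec_single (ev_len (v := y) rfl hr) hr fun j =>
        ev_ite (enc := Data.elt) (ev_eqN rfl rfl (by omega) (by omega)) (fun _ => rfl) fun _ => rfl
  · have : specialCoeff S y I = Pi.single i 1 := by simp only [specialCoeff, h1]
    rw [this]
    exact ofVec_single (ev_len (v := y) rfl hr) hr fun j =>
      ev_ite (enc := Data.elt) (ev_eqN rfl rfl (by omega) (by omega)) (fun _ => rfl) fun _ => rfl

/-- Arguments: an array, its row length, and a position. -/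
def flatP : Prog :=
  letE (divModN (V 2) (V 1)) (nthZeroE (nthE (V 1) (.comp .fst (V 0))) (.comp .snd (V 0)))

/-- The row and the column of position `p` are its quotient and remainder by `b`. -/
theorem eval_flatP {a b : ℕ} (M : Fin a → Fin b → F) (p : ℕ) (hb : 0 < b) (hbN : b ≤ N)
    (hp : p ≤ N) (ρ : Data F) :
    flatP.eval N (.cons (Data.ofFamily Data.ofVec M) (.cons (Data.ofNat b) (.cons (Data.ofNat p) ρ)))
      = some (.elt (flatten M p)) := by
  refine eval_letE_of (eval_divModN rfl rfl hp hbN hb) ?_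
  have hmod := Nat.mod_lt p hb
  have hdiv := Nat.div_le_self p b
  have h1 := eval_nthE_getD (N := N) (l := V 1) (i := .comp .fst (V 0)) (k := p / b)
    (ρ := .cons (.cons (Data.ofNat (p / b)) (Data.ofNat (p % b))) (.cons
      (Data.ofFamily Data.ofVec M) (.cons (Data.ofNat b) (.cons (Data.ofNat p) ρ))))
    (L := List.ofFn fun i => Data.ofVec (M i)) rfl rfl (by omega)
  by_cases hq : p / b < a
  · have hpab : p < a * b := (Nat.div_lt_iff_lt_mul hb).1 hq
    rw [List.getD_eq_getElem _ _ (by simpa using hq), List.getElem_ofFn] at h1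
    refine ev_eq (eval_nthZeroE h1 (k := p % b) rfl (by omega)) ?_
    rw [dif_pos hmod, flatten, dif_pos hpab]
    rfl
  -- Beyond the last row the list has no entry; the resulting `nil` is read as an empty vector and
  -- yields the padding `0`.
  · have hpab : ¬ p < a * b := fun h => hq ((Nat.div_lt_iff_lt_mul hb).2 h)
    rw [List.getD_eq_default _ _ (by simpa using hq)] at h1
    refine ev_eq (eval_nthZeroE (n := 0) (v := fun _ => 0) (k := p % b) h1 rfl (by omega)) ?_
    rw [flatten, dif_neg hpab]
    simp

/-- Arguments: an array, its numbers of rows and columns, the level, the points. -/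
def genBroadcastP : Prog :=
  letE (.comp .fst (divModN (addN (V 3) (mulN (V 1) (V 2))) (.pair .nil (V 3))))
    (mapE (V 5) (tabE (V 1) (sumE (.pair .nil (V 6)) (mulE (powE (V 2) (V 0))
      (call₃ flatP (V 4) (V 6) (addN (V 0) (mulN (V 1) (.pair .nil (V 7)))))))))

theorem numBlocks_mul_le (A m : ℕ) : numBlocks A m * (m + 1) ≤ A + m := Nat.div_mul_le_self _ _

theorem numBlocks_le (A m : ℕ) : numBlocks A m ≤ A + m := Nat.div_le_self _ _

theorem eval_genBroadcastP (hS : S.IsReedSolomon) {a b m : ℕ} (M : Fin a → Fin b → F) (hm : m ≤ t)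
    (hN : a * b + m + 1 ≤ N) (hn : 2 * t + 1 ≤ N) (ha : a ≤ N) (hb : b ≤ N) (ρ : Data F) :
    genBroadcastP.eval N (.cons (Data.ofFamily Data.ofVec M) (.cons (Data.ofNat a)
      (.cons (Data.ofNat b) (.cons (Data.ofNat m) (.cons (Data.ofVec S.pts) ρ))))) =
      some (Data.ofFamily Data.ofVec (genBroadcast S m M)) := by
  have hnb := numBlocks_mul_le (a * b) m
  have hnb' := numBlocks_le (a * b) m
  refine eval_letE_of (ev_comp (eval_divModN (n := m + 1) (eval_addN rfl (eval_mulN rfl rfl ha hb)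
    (by omega)) rfl (by omega) (by omega) (by omega)) rfl) ?_
  refine ev_map (enc := Data.elt) (v := S.pts) rfl hn fun i => ?_
  refine ev_tabVec (k := numBlocks (a * b) m) rfl (by omega) fun k => ?_
  have hk := k.2
  have hle : (k + 1) * (m + 1) ≤ numBlocks (a * b) m * (m + 1) := Nat.mul_le_mul_right _ hk
  -- Division by `b` is legitimate because an array without columns has no blocks at all.
  have hb0 : 0 < b := by
    rcases Nat.eq_zero_or_pos b with h0 | h0
    · have : numBlocks (a * b) m = 0 := by
        rw [h0, mul_zero, numBlocks, zero_add]; exact Nat.div_eq_of_lt (by omega)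
      omega
    · exact h0
  rw [genBroadcast, hS.2 m hm]
  have hkk : (k : ℕ) ≤ k * (m + 1) := Nat.le_mul_of_pos_right _ (by omega)
  rw [add_mul] at hle
  refine eval_sumE (k := m + 1) rfl (by omega) fun c => ev_mul (eval_powE rfl rfl (by omega)) <|
    ev_call₃ rfl rfl (eval_addN rfl (eval_mulN (n := m + 1) rfl rfl (by omega) (by omega))
      (by omega)) (eval_flatP M _ hb0 hb ?_ _)
  have := c.2
  omega

end AlicePrograms
end PSMT

namespace PSMT

/-! ### Bob's first program and Alice's program -/

section MainPrograms

variable {F : Type} [Field F] [DecidableEq F] {N : ℕ} {t ℓ : ℕ} {S : Setup F t}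

/-- The quadratic bound covers the longest loops, those over the positions of the flattened
pseudo-basis and of the flattened syndromes. -/
theorem loop_bounds (h : 4 * (t + ℓ + 2) ^ 2 ≤ N) :
    6 * t + 3 ≤ N ∧ t + ℓ + 1 < N ∧ (t + ℓ + 1) * (2 * t + 1) + t + 1 ≤ N ∧ ℓ * t + t + 1 ≤ N := by
  refine ⟨?_, ?_, ?_, ?_⟩ <;> nlinarith [Nat.zero_le (t * ℓ), Nat.zero_le (ℓ * ℓ)]

/-- Bob's first program. -/
def bobSendP : Prog := mapE (.comp (V 2) (V 0)) (mapE (D 2) (call₂ polyP (V 0) (V 1)))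

theorem eval_bobSendP [Fintype F] (hS : S.IsReedSolomon) (hN : 4 * (t + ℓ + 2) ^ 2 ≤ N)
    (u : Fin (t + ℓ + 1) → Fin (t + 1) → F) :
    bobSendP.eval N (.cons (S.toData ℓ) (Data.ofFamily Data.ofVec u)) =
      some (Data.ofFamily Data.ofVec ((protocol S ℓ).send u)) := by
  obtain ⟨h1, h2, h3, h4⟩ := loop_bounds hN
  refine ev_map (enc := Data.elt) (v := S.pts) (ev_comp rfl rfl) (by omega) fun i => ?_
  refine ev_map (enc := Data.ofVec) (enc' := Data.elt) (v := u) rfl (by omega) fun j => ?_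
  show _ = some (Data.elt (S.gen (u j) i))
  rw [hS.1]
  exact ev_poly rfl rfl (by omega)

def minN (a b : Prog) : Prog := .cond (leE a b) b a

theorem ev_minN {a b : Prog} {ρ : Data F} {m n : ℕ} (ha : a.eval N ρ = some (Data.ofNat m))
    (hb : b.eval N ρ = some (Data.ofNat n)) (hn : n ≤ N) :
    (minN a b).eval N ρ = some (Data.ofNat (min m n)) := by
  rw [min_def]
  exact ev_ite (enc := Data.ofNat) (eval_leE ha hb hn) (fun _ => ha) fun _ => hb

/-- `basisLevel t w`, on arguments `t`, `w`. -/
def basisLevelP : Prog := minN (V 1) (.comp .fst (divModN (addN (constN 2) (V 0)) (constN 3)))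

theorem eval_basisLevelP (w : ℕ) (ht : 6 * t + 3 ≤ N) (ρ : Data F) :
    basisLevelP.eval N (.cons (Data.ofNat t) (.cons (Data.ofNat w) ρ)) =
      some (Data.ofNat (basisLevel t w)) :=
  ev_minN rfl (ev_comp (eval_divModN (eval_addN (eval_constN 2 _) rfl (by omega))
    (eval_constN 3 _) (by omega) (by omega) (by omega)) rfl) (by omega)

theorem basisLevel_le (t w : ℕ) : basisLevel t w ≤ t := by
  unfold basisLevel; omega

def syndromeLevelP : Prog := .comp .fst (divModN (.pair .nil (V 0)) (constN 2))

theorem eval_syndromeLevelP (ht : 6 * t + 3 ≤ N) (ρ : Data F) :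
    syndromeLevelP.eval N (.cons (Data.ofNat t) ρ) = some (Data.ofNat (syndromeLevel t)) :=
  ev_comp (eval_divModN (m := t + 1) rfl (eval_constN 2 _) (by omega) (by omega) (by omega)) rfl

theorem syndromeLevel_le (t : ℕ) : syndromeLevel t ≤ t := by
  unfold syndromeLevel; omega

theorem ofList_sort_eq {F X : Type} {r : ℕ} (I : Finset (Fin r)) (y : Fin r → X)
    (enc : X → Data F) :
    Data.ofList ((I.sort (· ≤ ·)).map fun j => enc (y j)) =
      Data.ofFamily enc fun a : Fin I.card => y (I.orderEmbOfFin rfl a) := by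
  unfold Data.ofFamily
  congr 1
  refine List.ext_getElem (by simp) fun i h1 h2 => ?_
  simp [Finset.orderEmbOfFin_apply]

/-- The members of a family with indices in a set, on arguments the family and the set. -/
def selectP : Prog := mapE (.comp membersP (.pair (V 1) .nil)) (nthE (V 1) (V 0))

theorem eval_selectP {r n : ℕ} (y : Fin r → Fin n → F) (I : Finset (Fin r)) (hr : r ≤ N)
    (ρ : Data F) :
    selectP.eval N (.cons (Data.ofFamily Data.ofVec y) (.cons (Data.ofSet I) ρ)) =
      some (Data.ofFamily Data.ofVec fun a : Fin I.card => y (I.orderEmbOfFin rfl a)) := by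
  rw [← ofList_sort_eq I y Data.ofVec]
  refine eval_mapE (enc := fun i : Fin r => Data.ofNat i) (L := I.sort (· ≤ ·))
    (ev_comp (ev_pair rfl rfl) (eval_membersP I hr _)) ?_ fun i _ =>
      ev_nth (enc := Data.ofVec) rfl rfl hr
  rw [Finset.length_sort]; exact ((Finset.card_le_univ I).trans (by simp)).trans hr

/-- The members of a family whose indices are the first `ℓ` ones outside a set, on arguments the
family, the set and `ℓ`. -/
def remainingP : Prog :=
  letE (.comp complementP (.pair (V 1) .nil)) (tabE (V 3) (nthE (V 2) (nthE (V 1) (V 0))))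

theorem eval_remainingP {n : ℕ} (y : Fin (t + ℓ + 1) → Fin n → F) (I : Finset (Fin (t + ℓ + 1)))
    (hr : t + ℓ + 1 ≤ N) (ρ : Data F) :
    remainingP.eval N (.cons (Data.ofFamily Data.ofVec y) (.cons (Data.ofSet I)
      (.cons (Data.ofNat ℓ) ρ))) =
      some (Data.ofFamily Data.ofVec fun j : Fin ℓ => y (remaining I j)) := by
  refine eval_letE_of (ev_comp (ev_pair rfl rfl) (eval_complementP I hr _)) ?_
  refine ev_tab (enc := Data.ofVec) rfl (by omega) fun j => ev_nth (enc := Data.ofVec) rfl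
    (ev_eq (eval_nthE_getD (k := j) rfl rfl (by omega)) ?_) hr
  rw [remaining]
  simp only [List.getD_eq_getElem?_getD, List.getElem?_map]
  cases (Iᶜ.sort (· ≤ ·))[(j : ℕ)]? <;> rfl

/-- Arguments: the words, the secrets, and the public data. -/
def aliceBodyP : Prog :=
  letE (.comp pseudoBasisP (.pair (V 0) (D 2)))
  -- the pseudo-basis; then the coefficients and the special word
  (letE (.comp specialCoeffP (.pair (V 1) (.pair (V 0) (D 3))))
  (letE (tabE (lenE (V 0)) (.cond (nthE (V 2) (V 0)) .zero (nthE (V 1) (V 0))))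
  (letE (tabE (lenE (V 7)) (sumE (lenE (V 1)) (mulE (nthE (V 2) (V 0)) (nthE (nthE (V 5) (V 0)) (V 1)))))
  -- the remaining words and the masks
  (letE (call₃ remainingP (V 4) (V 3) (V 7))
  (letE (tabE (V 8) (addE (nthE (V 7) (V 0)) (dotE (V 11) (nthE (V 1) (V 0)))))
  (letE (tabE (V 9) (matchE (.comp decodeErrorP (.pair (nthE (V 2) (V 0)) (D 9))) .zero
      (addE (nthE (V 9) (V 1)) (dotE (V 13)
        (tabE (lenE (V 0)) (subE (nthE (nthE (V 4) (V 2)) (V 0)) (nthE (V 1) (V 0))))))))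
  -- the generalized broadcasts
  (letE (.comp cardP (.pair (V 6) .nil))
  (letE (.comp genBroadcastP (.pair (call₂ selectP (V 8) (V 7)) (.pair (V 0) (.pair (lenE (V 12))
      (.pair (call₂ basisLevelP (V 10) (V 0)) (.pair (V 12) .nil))))))
  (letE (.comp genBroadcastP (.pair (mapE (V 4) (.comp syndromeP (.pair (V 0) (D 12))))
      (.pair (V 12) (.pair (V 11) (.pair (.comp syndromeLevelP (.pair (V 11) .nil))
        (.pair (V 13) .nil))))))
  (tabE (lenE (V 14)) (.pair (V 10) (.pair (V 8) (.pair (V 7) (.pair (V 5) (.pair (V 4)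
    (.pair (nthE (V 2) (V 0)) (.pair (nthE (V 1) (V 0)) .nil)))))))))))))))))

/-- Each `eval_letE_of` settles the value of one local variable of the program, in the order of its
text. -/
theorem eval_aliceBodyP (hS : S.IsReedSolomon) (hN : 4 * (t + ℓ + 2) ^ 2 ≤ N)
    (s : Fin ℓ → F) (y : Fin (2 * t + 1) → Fin (t + ℓ + 1) → F) :
    aliceBodyP.eval N (.cons (Data.ofFamily Data.ofVec (words y)) (.cons (Data.ofVec s)
      (S.toData ℓ))) = some (Data.ofFamily Reply.toData (aliceReply S s y)) := by
  obtain ⟨h1, h2, h3, h4⟩ := loop_bounds hN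
  have hn : 2 * t + 1 ≤ N := by omega
  have hr : t + ℓ + 1 ≤ N := by omega
  have hℓ : ℓ ≤ N := by omega
  set W := words y with hW
  set I := pseudoBasis S W with hI
  set R := fun j : Fin ℓ => W (remaining I j) with hR
  have hIc : I.card ≤ t + ℓ + 1 := (Finset.card_le_univ I).trans (by simp)
  refine eval_letE_of (ev_comp (ev_pair rfl rfl) (eval_pseudoBasisP W hn h2)) ?_
  refine eval_letE_of (ev_comp (ev_pair rfl (ev_pair rfl rfl)) (eval_specialCoeffP hS W I h1 hr)) ?_
  -- The coefficients are extended by `0` to all indices, so that the special word can be computed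
  -- as a sum over all words.
  refine eval_letE_of (ev_tabVec (v := fun j => if j ∈ I then specialCoeff S W I j else 0)
    (ev_len (v := specialCoeff S W I) rfl hr) hr fun j => ev_ite (enc := Data.elt)
      (ev_mem rfl rfl hr) (fun _ => ev_vec rfl rfl hr) fun _ => rfl) ?_
  refine eval_letE_of (ev_tabVec (v := ∑ i ∈ I, specialCoeff S W I i • W i)
    (ev_len (v := S.pts) rfl hn) hn fun c => ev_eq (eval_sumE (k := t + ℓ + 1)
      (ev_len (v := fun j => if j ∈ I then specialCoeff S W I j else 0) rfl hr) hr fun j =>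
        ev_mul (ev_vec rfl rfl hr) (ev_vec (k := c) (ev_nth (k := j) (v := W) (enc := Data.ofVec)
          rfl rfl hr) rfl hn)) ?_) ?_
  · congr 1
    simp [Finset.sum_apply, ite_mul, Finset.sum_ite_mem]
  refine eval_letE_of (ev_call₃ rfl rfl rfl (eval_remainingP W I hr _)) ?_
  refine eval_letE_of (ev_tabVec (v := fun j => s j + S.h ⬝ᵥ R j) rfl hℓ fun j =>
    ev_add (ev_vec rfl rfl hℓ) (ev_dot rfl (ev_nth (k := j) (v := R) (enc := Data.ofVec) rfl rfl hℓ)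
      hn)) ?_
  refine eval_letE_of (ev_tabVec (v := (alicePublic S s W).mask₂) rfl hℓ fun j =>
    ev_match (enc := Data.ofVec) (o := decodeError S (R j)) (ev_comp (ev_pair
      (ev_nth (k := j) (v := R) (enc := Data.ofVec) rfl rfl hℓ) rfl)
      (eval_decodeErrorP hS (R j) (by omega))) (fun h => ?_) fun e h => ?_) ?_
  · have : (alicePublic S s W).mask₂ j = 0 := by
      simp only [alicePublic]
      rw [show decodeError S (W (remaining (pseudoBasis S W) j)) = none from h]
    rw [this]; rfl
  · have : (alicePublic S s W).mask₂ j = s j + S.h ⬝ᵥ (R j - e) := by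
      simp only [alicePublic]
      rw [show decodeError S (W (remaining (pseudoBasis S W) j)) = some e from h]
    rw [this]
    exact ev_add (ev_vec rfl rfl hℓ) (ev_dot rfl (ev_tabVec (ev_len (v := e) rfl hn) hn fun c =>
      ev_sub (ev_vec (k := c) (ev_nth (k := j) (v := R) (enc := Data.ofVec) rfl rfl hℓ) rfl hn)
        (ev_vec rfl rfl hn)) hn)
  refine eval_letE_of (ev_comp (ev_pair rfl rfl) (eval_cardP I hr _)) ?_
  refine eval_letE_of (ev_comp (ev_pair (ev_call₂ rfl rfl (eval_selectP W I hr _)) (ev_pair rfl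
    (ev_pair (ev_len (v := S.pts) rfl hn) (ev_pair (ev_call₂ rfl rfl
      (eval_basisLevelP I.card h1 _)) (ev_pair rfl rfl)))))
    (eval_genBroadcastP hS _ (basisLevel_le t I.card) ?_ hn (by omega) hn _)) ?_
  · have := Nat.mul_le_mul_right (2 * t + 1) hIc
    have := basisLevel_le t I.card
    omega
  refine eval_letE_of (ev_comp (ev_pair (ev_map (enc := Data.ofVec) (enc' := Data.ofVec) (v := R)
      (w := fun j => S.H.mulVec (R j)) rfl hℓ fun j =>
        ev_comp (ev_pair rfl rfl) (eval_syndromeP (R j) hn))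
    (ev_pair rfl (ev_pair rfl (ev_pair (ev_comp (ev_pair rfl rfl) (eval_syndromeLevelP h1 _))
      (ev_pair rfl rfl)))))
    (eval_genBroadcastP hS (fun j => S.H.mulVec (R j)) (syndromeLevel_le t) ?_ hn hℓ (by omega) _)) ?_
  · have := syndromeLevel_le t
    omega
  exact ev_tab (enc := Reply.toData) (ev_len (v := S.pts) rfl hn) hn fun i =>
    ev_pair rfl (ev_pair rfl (ev_pair rfl (ev_pair rfl (ev_pair rfl
      (ev_pair (ev_nth (enc := Data.ofVec) (k := i) (v := genBroadcast S (basisLevel t I.card)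
          fun a => W (I.orderEmbOfFin rfl a)) rfl rfl hn)
        (ev_pair (ev_nth (enc := Data.ofVec) (k := i)
          (v := genBroadcast S (syndromeLevel t) fun j => S.H.mulVec (R j)) rfl rfl hn) rfl))))))

/-- Alice's program. -/
def aliceP : Prog :=
  .comp aliceBodyP (.pair
    (tabE (.pair .nil (addN (.comp (V 1) (V 0)) (.comp (V 0) (V 0)))) (mapE (D 3) (nthE (V 0) (V 1))))
    (.pair (V 1) (V 0)))

theorem eval_aliceP [Fintype F] (hS : S.IsReedSolomon) (hN : 4 * (t + ℓ + 2) ^ 2 ≤ N)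
    (s : Fin ℓ → F) (y : Fin (2 * t + 1) → Fin (t + ℓ + 1) → F) :
    aliceP.eval N (.cons (S.toData ℓ) (.cons (Data.ofVec s) (Data.ofFamily Data.ofVec y))) =
      some (Data.ofFamily Reply.toData ((protocol S ℓ).reply s y)) := by
  obtain ⟨h1, h2, h3, h4⟩ := loop_bounds hN
  refine ev_comp (ev_pair (ev_tab (enc := Data.ofVec) (v := words y) (k := t + ℓ + 1)
    (ev_pair rfl (eval_addN (ev_comp rfl rfl) (ev_comp rfl rfl) (by omega))) (by omega) fun j => ?_)
    (ev_pair rfl rfl)) (eval_aliceBodyP hS hN s y)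
  exact ev_map (enc := Data.ofVec) (enc' := Data.elt) (v := y) rfl (by omega) fun i =>
    ev_vec (v := y i) (k := j) rfl rfl (by omega)

end MainPrograms
end PSMT

namespace PSMT

/-! ### Recovery of generalized broadcasts and the majority as programs -/

section BobSubroutines

variable {F : Type} [Field F] [DecidableEq F] {N : ℕ} {t ℓ : ℕ} {S : Setup F t}

theorem card_le_of_fin {n : ℕ} (K : Finset (Fin n)) : K.card ≤ n :=
  (Finset.card_le_univ K).trans (by simp)

/-- Arguments: the received word, the set of known corrupted channels, the level, and the public
data. -/
def genDecodeP : Prog :=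
  letE (.comp cardP (.pair (V 1) .nil))
    (.cond (andE (leE (V 3) (V 0)) (leE (V 0) (V 4)))
      (tabE (.pair .nil (V 3)) .zero)
      (matchE (.comp rsDecodeP (.pair (V 6) (.pair
          (tabE (lenE (V 6)) (.cond (nthE (V 3) (V 0)) .one .zero)) (.pair (V 1)
          (.pair (subN (V 4) (V 0)) (.pair (.pair .nil (V 3)) .nil))))))
        (tabE (.pair .nil (V 3)) .zero) (V 0)))

theorem eval_genDecodeP (hS : S.IsReedSolomon) {m : ℕ} (hm : m ≤ t) (K : Finset (Fin (2 * t + 1)))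
    (v : Fin (2 * t + 1) → F) (hN : 6 * t + 3 ≤ N) :
    genDecodeP.eval N (.cons (Data.ofVec v) (.cons (Data.ofSet K) (.cons (Data.ofNat m)
      (S.toData ℓ)))) = some (Data.ofVec (genDecode S m K v)) := by
  have hn : 2 * t + 1 ≤ N := by omega
  have hK := card_le_of_fin K
  rw [genDecode_eq_rsDecode hS]
  refine eval_letE_of (ev_comp (ev_pair rfl rfl) (eval_cardP K hn _)) <|
    ev_ite (enc := Data.ofVec) (ev_and (eval_leE rfl rfl (by omega)) fun _ =>
      eval_leE rfl rfl (by omega)) (fun h => ?_) fun _ =>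
      ev_tabVec (v := (0 : Fin (m + 1) → F)) rfl (by omega) fun _ => rfl
  refine ev_match (enc := Data.ofVec)
    (o := rsDecode S.pts (t - K.card) (m + 1) (fun i => if i ∈ K then 0 else 1) v)
    (ev_comp (ev_pair rfl (ev_pair (ev_tabVec (ev_len (v := S.pts) rfl hn) hn fun i =>
      ev_ite (enc := Data.elt) (ev_mem rfl rfl hn) (fun _ => rfl) fun _ => rfl) (ev_pair rfl
      (ev_pair (eval_subN rfl rfl (by omega)) (ev_pair rfl rfl)))))
      (eval_rsDecodeP S.pts (t - K.card) (m + 1) _ v hn (by omega) (by omega) _))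
    (fun h => ?_) fun c h => ?_
  · rw [h]
    exact ev_tabVec (v := (0 : Fin (m + 1) → F)) rfl (by omega) fun _ => rfl
  · rw [h]; rfl

/-- Arguments: the position of the symbol, the symbols received on the channels, the set of known
corrupted channels, the level, and the public data. -/
def genReceiveP : Prog :=
  letE (divModN (V 0) (.pair .nil (V 3)))
    (letE (mapE (V 2) (nthZeroE (V 0) (.comp .fst (V 1))))
      (nthE (.comp genDecodeP (.pair (V 0) (.pair (V 4) (.pair (V 5) (D 6))))) (.comp .snd (V 1))))

/-- The number `len c` of symbols may vary with the channel, since a corrupted channel can deliver a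
reply with another pseudo-basis and hence of another length; missing symbols are read as `0`. -/
theorem eval_genReceiveP (hS : S.IsReedSolomon) {m a b : ℕ} (hm : m ≤ t)
    (K : Finset (Fin (2 * t + 1))) {len : Fin (2 * t + 1) → ℕ} (vs : ∀ i, Fin (len i) → F)
    (i : Fin a) (j : Fin b) (hN : 6 * t + 3 ≤ N) (hab : a * b ≤ N) :
    genReceiveP.eval N (.cons (Data.ofNat (finProdFinEquiv (i, j) : ℕ)) (.cons
      (Data.fam fun c => Data.ofVec (vs c)) (.cons (Data.ofSet K) (.cons (Data.ofNat m)
      (S.toData ℓ))))) =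
      some (.elt (genReceive S m K (fun c k => if h : k < len c then vs c ⟨k, h⟩ else 0) a b i j)) := by
  have hp : (finProdFinEquiv (i, j) : ℕ) < a * b := (finProdFinEquiv (i, j)).2
  have hn : 2 * t + 1 ≤ N := by omega
  have hd := Nat.div_le_self (finProdFinEquiv (i, j) : ℕ) (m + 1)
  refine eval_letE_of (eval_divModN (n := m + 1) rfl rfl (by omega) (by omega) (by omega)) ?_
  refine eval_letE_of (eval_mapE_fam (g := fun c => .elt _) rfl hn fun c =>
    eval_nthZeroE rfl rfl (by omega)) ?_
  exact ev_vec (k := Fin.ofNat (m + 1) (finProdFinEquiv (i, j) : ℕ)) (ev_comp (ev_pair rfl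
    (ev_pair rfl (ev_pair rfl rfl))) (eval_genDecodeP hS hm K _ hN)) rfl (by omega)

/-- Arguments: the syndrome, the set of known corrupted channels, and the public data. -/
def errorOfSyndromeP : Prog :=
  .cond (leE (.comp cardP (.pair (V 1) .nil)) (V 2))
    (tabE (lenE (V 4)) .zero)
    (letE (matchE (call₃ solveLinearP
        (mapE (V 6) (tabE (lenE (V 5)) (.cond (nthE (V 3) (V 0)) .zero (nthE (V 1) (V 0)))))
        (V 0) (lenE (V 4))) (tabE (lenE (V 4)) .zero) (V 0))
      (tabE (lenE (V 5)) (.cond (nthE (V 3) (V 0)) .zero (nthE (V 1) (V 0)))))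

theorem eval_errorOfSyndromeP (K : Finset (Fin (2 * t + 1))) (σ : Fin t → F)
    (hN : 6 * t + 3 ≤ N) :
    errorOfSyndromeP.eval N (.cons (Data.ofVec σ) (.cons (Data.ofSet K) (S.toData ℓ))) =
      some (Data.ofVec (errorOfSyndrome S K σ)) := by
  have hn : 2 * t + 1 ≤ N := by omega
  rw [errorOfSyndrome_eq_solveLinear]
  refine ev_ite (enc := Data.ofVec) (eval_leE (ev_comp (ev_pair rfl rfl) (eval_cardP K hn _)) rfl
    (by omega)) (fun _ => ?_) fun _ =>
      ev_tabVec (v := (0 : Fin (2 * t + 1) → F)) (ev_len (v := S.pts) rfl hn) hn fun _ => rfl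
  have hA : ∀ a : Fin t, (tabE (lenE (V 5)) (.cond (nthE (V 3) (V 0)) .zero (nthE (V 1) (V 0)))).eval
      N (.cons (Data.ofVec (S.H a)) (.cons (Data.ofVec σ) (.cons (Data.ofSet K) (S.toData ℓ)))) =
      some (Data.ofVec fun i => if i ∈ K then S.H a i else 0) := fun a =>
    ev_tabVec (ev_len (v := S.pts) rfl hn) hn fun i => ev_ite (enc := Data.elt)
      (ev_mem rfl rfl hn) (fun _ => ev_vec rfl rfl hn) fun _ => rfl
  refine eval_letE_of (d := Data.ofVec
      ((solveLinear (fun a i => if i ∈ K then S.H a i else 0) σ).getD 0))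
    (ev_match (enc := Data.ofVec) (o := solveLinear (fun a i => if i ∈ K then S.H a i else 0) σ)
      (ev_call₃ (ev_map (enc := Data.ofVec) (enc' := Data.ofVec) rfl (by omega) hA) rfl
        (ev_len (v := S.pts) rfl hn) (eval_solveLinearP (by omega) (by omega) _ _ _))
      (fun h => ?_) fun e h => ?_) ?_
  · rw [h]
    exact ev_tabVec (v := (0 : Fin (2 * t + 1) → F)) (ev_len (v := S.pts) rfl hn) hn fun _ => rfl
  · rw [h]; rfl
  · exact ev_tabVec (ev_len (v := S.pts) rfl hn) hn fun i => ev_ite (enc := Data.elt)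
      (ev_mem rfl rfl hn) (fun _ => ev_vec rfl rfl hn) fun _ => rfl

def eqVecP : Prog :=
  notE (anyE (lenE (V 0)) (.comp .isZero (subE (nthE (V 1) (V 0)) (nthE (V 2) (V 0)))))

theorem eval_eqVecP {k : ℕ} (a b : Fin k → F) (hk : k ≤ N) (ρ : Data F) :
    eqVecP.eval N (.cons (Data.ofVec a) (.cons (Data.ofVec b) ρ)) =
      some (Data.ofBool (decide (a = b))) := by
  refine ev_eq (ev_not (eval_anyE (p := fun i => decide (a i - b i ≠ 0)) (ev_len (v := a) rfl hk) hk
    fun i => ev_isZero (ev_sub (ev_vec rfl rfl hk) (ev_vec rfl rfl hk)))) ?_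
  rw [← decide_not]
  congr 2
  simp [sub_eq_zero, funext_iff]

def eqSetP : Prog :=
  notE (anyE (lenE (V 0)) (.cond (nthE (V 1) (V 0)) (nthE (V 2) (V 0)) (notE (nthE (V 2) (V 0)))))

theorem eval_eqSetP {k : ℕ} (I J : Finset (Fin k)) (hk : k ≤ N) (ρ : Data F) :
    eqSetP.eval N (.cons (Data.ofSet I) (.cons (Data.ofSet J) ρ)) =
      some (Data.ofBool (decide (I = J))) := by
  refine ev_eq (ev_not (eval_anyE (p := fun i => if i ∈ I then !decide (i ∈ J) else decide (i ∈ J))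
    (ev_len (v := fun i => decide (i ∈ I)) rfl hk) hk fun i => ev_ite (enc := Data.ofBool)
      (ev_mem rfl rfl hk) (fun _ => ev_not (ev_mem rfl rfl hk)) fun _ => ev_mem rfl rfl hk)) ?_
  rw [← decide_not]
  congr 2
  rw [not_exists, Finset.ext_iff]
  refine propext (forall_congr' fun i => ?_)
  by_cases h1 : i ∈ I <;> by_cases h2 : i ∈ J <;> simp [h1, h2]

/-- The coefficients of the special word, extended by zero. -/
def Public.coeffExt {F : Type} [Field F] {t ℓ : ℕ} (p : Public F t ℓ) (j : Fin (t + ℓ + 1)) : F :=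
  if hj : j ∈ p.I then p.coeff ⟨j, hj⟩ else 0

/-- The type of `coeff` depends on `I`; extension by zero makes the coefficients of two messages
comparable before their index sets are known to agree. -/
theorem Public.eq_iff {F : Type} [Field F] {t ℓ : ℕ} (p p' : Public F t ℓ) : p = p' ↔
    p.I = p'.I ∧ p.coeffExt = p'.coeffExt ∧ p.special = p'.special ∧ p.mask₁ = p'.mask₁ ∧
      p.mask₂ = p'.mask₂ := by
  constructor
  · rintro rfl; simp
  · obtain ⟨I, c, s, a, b⟩ := p
    obtain ⟨I', c', s', a', b'⟩ := p'
    rintro ⟨h1, h2, h3, h4, h5⟩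
    dsimp only at h1 h3 h4 h5
    subst h1 h3 h4 h5
    congr 1
    funext ⟨j, hj⟩
    have := congrFun h2 j
    simpa [Public.coeffExt, hj] using this

/-- Whether the public parts of two replies agree. -/
def eqPublicP : Prog :=
  andE (call₂ eqSetP (.comp (V 0) (V 0)) (.comp (V 0) (V 1)))
  (andE (call₂ eqVecP (.comp (V 1) (V 0)) (.comp (V 1) (V 1)))
  (andE (call₂ eqVecP (.comp (V 2) (V 0)) (.comp (V 2) (V 1)))
  (andE (call₂ eqVecP (.comp (V 3) (V 0)) (.comp (V 3) (V 1)))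
    (call₂ eqVecP (.comp (V 4) (V 0)) (.comp (V 4) (V 1))))))

open scoped Classical in
theorem eval_eqPublicP (z z' : Reply F t ℓ) (hn : 2 * t + 1 ≤ N) (hr : t + ℓ + 1 ≤ N) (ρ : Data F) :
    eqPublicP.eval N (.cons z.toData (.cons z'.toData ρ)) =
      some (Data.ofBool (decide (z.pub = z'.pub))) := by
  refine ev_eq (ev_and (ev_call₂ (ev_comp rfl rfl) (ev_comp rfl rfl)
      (eval_eqSetP z.pub.I z'.pub.I hr _)) fun _ =>
    ev_and (ev_call₂ (ev_comp rfl rfl) (ev_comp rfl rfl)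
      (eval_eqVecP z.pub.coeffExt z'.pub.coeffExt hr _)) fun _ =>
    ev_and (ev_call₂ (ev_comp rfl rfl) (ev_comp rfl rfl)
      (eval_eqVecP z.pub.special z'.pub.special hn _)) fun _ =>
    ev_and (ev_call₂ (ev_comp rfl rfl) (ev_comp rfl rfl)
      (eval_eqVecP z.pub.mask₁ z'.pub.mask₁ (by omega) _)) fun _ =>
    ev_call₂ (ev_comp rfl rfl) (ev_comp rfl rfl)
      (eval_eqVecP z.pub.mask₂ z'.pub.mask₂ (by omega) _)) ?_
  congr 1
  rw [decide_eq_decide]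
  exact (Public.eq_iff _ _).symm

open scoped Classical in
-- Two different values with more than `t` occurrences each would need `2t + 2` channels.
theorem majority_eq_some {X : Type} {t : ℕ} {v : Fin (2 * t + 1) → X} {x : X}
    (h : t < (Finset.univ.filter fun i => v i = x).card) : majority t v = some x := by
  have hex : ∃ x, t < (Finset.univ.filter fun i => v i = x).card := ⟨x, h⟩
  rw [majority, dif_pos hex]
  congr 1
  by_contra hne
  have h1 := hex.choose_spec
  have hd : Disjoint (Finset.univ.filter fun i => v i = hex.choose)
      (Finset.univ.filter fun i => v i = x) := by
    rw [Finset.disjoint_filter]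
    intro i _ h2 h3
    exact hne (h2.symm.trans h3)
  have h4 := Finset.card_le_univ ((Finset.univ.filter fun i => v i = hex.choose) ∪
      (Finset.univ.filter fun i => v i = x))
  rw [Finset.card_union_of_disjoint hd, Fintype.card_fin] at h4
  omega

open scoped Classical in
-- A majority value occurs among the received ones, so it suffices to try the `2t + 1` replies.
theorem majority_eq_find {F : Type} {t ℓ : ℕ} (z : Fin (2 * t + 1) → Reply F t ℓ) :
    majority t (fun i => (z i).pub) = ((List.ofFn z).find? fun x =>
      decide (¬ (Finset.univ.filter fun i => (z i).pub = x.pub).card ≤ t)).map Reply.pub := by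
  cases h : (List.ofFn z).find? fun x =>
      decide (¬ (Finset.univ.filter fun i => (z i).pub = x.pub).card ≤ t) with
  | none =>
    rw [List.find?_eq_none] at h
    rw [majority, dif_neg, Option.map_none]
    rintro ⟨x, hx⟩
    obtain ⟨i, hi⟩ := Finset.card_pos.1 (t.zero_le.trans_lt hx)
    have h1 := (Finset.mem_filter.1 hi).2
    subst h1
    have := h (z i) ((List.mem_ofFn' _ _).2 ⟨i, rfl⟩)
    simp at this
    omega
  | some x =>
    have := List.find?_some h
    rw [Option.map_some]
    exact majority_eq_some (by simpa using this)

end BobSubroutines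
end PSMT

namespace PSMT

/-! ### Bob's second program -/

section BobProgram

variable {F : Type} [Field F] [DecidableEq F] {N : ℕ} {t ℓ : ℕ} {S : Setup F t}

theorem sum_coeff_smul_apply {F : Type} [Field F] {t ℓ n : ℕ}
    (x : Fin (t + ℓ + 1) → Fin n → F) (p : Public F t ℓ) (c : Fin n) :
    (∑ i : p.I, p.coeff i • x i) c = ∑ j, p.coeffExt j * x j c := by
  rw [Finset.sum_apply]
  have : ∀ i : p.I, (p.coeff i • x i) c = p.coeffExt i * x i c := fun i => by
    simp [Public.coeffExt, i.2]
  rw [Finset.sum_congr rfl fun i _ => this i, Finset.sum_coe_sort p.I fun j => p.coeffExt j * x j c]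
  refine Finset.sum_subset (Finset.subset_univ _) fun j _ hj => ?_
  simp [Public.coeffExt, hj]

/-- Arguments: a reply with the public part that Bob accepts, his words, the received replies, and
the public data. -/
def bobDecodeP : Prog :=
  letE (.comp (V 0) (V 0))
  (letE (.comp cardP (.pair (V 0) .nil))
  -- support of the error of the special word
  (letE (tabE (lenE (V 7)) (.comp .isZero (subE (nthE (.comp (V 2) (V 3)) (V 0))
      (sumE (lenE (V 4)) (mulE (nthE (.comp (V 1) (V 4)) (V 0)) (nthE (nthE (V 5) (V 0)) (V 1)))))))
  (letE (call₂ basisLevelP (V 6) (V 1))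
  (letE (call₂ selectP (V 5) (V 3))
  (letE (mapE (V 7) (.comp (V 5) (V 0)))
  -- global support of the errors
  (letE (tabE (lenE (V 11)) (anyE (V 5) (.comp .isZero (subE
      (.comp genReceiveP (.pair (addN (mulN (lenE (V 13)) (V 0)) (V 1)) (.pair (V 2) (.pair (V 5)
        (.pair (V 4) (D 11))))))
      (nthE (nthE (V 3) (V 0)) (V 1))))))
  (letE (mapE (V 9) (.comp (V 6) (V 0)))
  (letE (call₃ remainingP (V 9) (V 7) (V 12))
  (tabE (V 13) (.cond (leE (V 13) (mulN (constN 2) (.comp cardP (.pair (V 3) .nil))))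
    (subE (nthE (.comp (V 4) (V 10)) (V 0)) (dotE (V 16) (nthE (V 1) (V 0))))
    (letE (.comp errorOfSyndromeP (.pair
        (tabE (V 13) (.comp genReceiveP (.pair (addN (mulN (V 14) (V 1)) (V 0)) (.pair (V 3)
          (.pair (V 4) (.pair (.comp syndromeLevelP (.pair (V 14) .nil)) (D 14)))))))
        (.pair (V 3) (D 13))))
      (subE (nthE (.comp (V 3) (V 11)) (V 1)) (dotE (V 17) (tabE (lenE (V 0))
        (addE (nthE (nthE (V 3) (V 2)) (V 0)) (nthE (V 1) (V 0)))))))))))))))))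

/-- Agreement with `bobOutput` is needed on every input, also on replies that occur in no execution.
Hence only `|I| ≤ t + ℓ + 1` is available here, not `|I| ≤ t`. -/
theorem eval_bobDecodeP (hS : S.IsReedSolomon) (hN : 4 * (t + ℓ + 2) ^ 2 ≤ N)
    (x : Fin (t + ℓ + 1) → Fin (2 * t + 1) → F) (z : Fin (2 * t + 1) → Reply F t ℓ)
    (z₀ : Reply F t ℓ) (hz : majority t (fun i => (z i).pub) = some z₀.pub) :
    bobDecodeP.eval N (.cons z₀.toData (.cons (Data.ofFamily Data.ofVec x)
      (.cons (Data.ofFamily Reply.toData z) (S.toData ℓ)))) =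
      some (Data.ofVec (bobOutput S x z)) := by
  obtain ⟨h1, h2, h3, h4⟩ := loop_bounds hN
  have hn : 2 * t + 1 ≤ N := by omega
  have hr : t + ℓ + 1 ≤ N := by omega
  have hℓ : ℓ ≤ N := by omega
  set p := z₀.pub with hp
  set I := p.I with hI
  have hIc : I.card ≤ t + ℓ + 1 := card_le_of_fin I
  have hIn : I.card * (2 * t + 1) ≤ N := by
    have := Nat.mul_le_mul_right (2 * t + 1) hIc
    omega
  set K := globalSupport S x p z with hK
  refine eval_letE_of (d := Data.ofSet I) (ev_comp rfl rfl) ?_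
  refine eval_letE_of (ev_comp (ev_pair rfl rfl) (eval_cardP I hr _)) ?_
  refine eval_letE_of (d := Data.ofSet (specialSupport x p)) (ev_tab (enc := Data.ofBool)
    (ev_len (v := S.pts) rfl hn) hn fun c => ev_eq (ev_isZero (ev_sub
      (ev_vec (v := p.special) (k := c) (ev_comp rfl rfl) rfl hn)
      (eval_sumE (ev_len (v := x) rfl hr) hr fun j =>
        ev_mul (ev_vec (v := p.coeffExt) (k := j) (ev_comp rfl rfl) rfl hr)
          (ev_vec (k := c) (ev_nth (k := j) (v := x) (enc := Data.ofVec) rfl rfl hr) rfl hn)))) ?_) ?_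
  · congr 1
    rw [decide_eq_decide, specialSupport, Finset.mem_filter, Pi.sub_apply, sum_coeff_smul_apply]
    simp
  refine eval_letE_of (ev_call₂ rfl rfl (eval_basisLevelP I.card h1 _)) ?_
  refine eval_letE_of (ev_call₂ rfl rfl (eval_selectP x I hr _)) ?_
  refine eval_letE_of (ev_map (enc := Reply.toData) (v := z) (w := z)
    (enc' := fun z => Data.ofVec z.basis) rfl hn fun i => ev_comp rfl rfl) ?_
  refine eval_letE_of (d := Data.ofSet K) (ev_tab (enc := Data.ofBool)
    (ev_len (v := S.pts) rfl hn) hn fun c => ev_eq (eval_anyE (k := I.card)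
      (p := fun a => decide (genReceive S (basisLevel t I.card) (specialSupport x p)
        (fun i => (z i).basisSymbol) I.card (2 * t + 1) a c - x (I.orderEmbOfFin rfl a) c ≠ 0))
      rfl (by omega) fun a => ev_isZero (ev_sub (ev_comp (ev_pair (eval_addN (eval_mulN
        (ev_len (v := S.pts) rfl hn) rfl hn (by omega)) rfl ?_)
        (ev_pair rfl (ev_pair rfl (ev_pair rfl rfl))))
        (eval_genReceiveP hS (basisLevel_le t I.card) (specialSupport x p) (fun i => (z i).basis)
          a c h1 hIn))
        (ev_vec (k := c) (ev_nth (k := a) (v := fun a => x (I.orderEmbOfFin rfl a))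
          (enc := Data.ofVec) rfl rfl (by omega)) rfl hn))) ?_) ?_
  -- `finProdFinEquiv` numbers the entries row by row, as the program does.
  · have := (finProdFinEquiv (a, c)).2
    have h5 : (finProdFinEquiv (a, c) : ℕ) = c + (2 * t + 1) * a := rfl
    omega
  · congr 1
    simp only [hK, globalSupport, Finset.mem_filter, Finset.mem_univ, true_and,
      decide_eq_true_eq, decide_eq_decide]
    exact Iff.rfl
  refine eval_letE_of (ev_map (enc := Reply.toData) (v := z) (w := z)
    (enc' := fun z => Data.ofVec z.syn) rfl hn fun i => ev_comp rfl rfl) ?_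
  refine eval_letE_of (ev_call₃ rfl rfl rfl (eval_remainingP x I hr _)) ?_
  refine ev_tabVec (k := ℓ) rfl hℓ fun j => ?_
  have hout : bobOutput S x z j = if t ≤ 2 * K.card then
      p.mask₁ j - S.h ⬝ᵥ (x (remaining I j) + errorOfSyndrome S K
        (genReceive S (syndromeLevel t) K (fun i => (z i).synSymbol) ℓ t j))
      else p.mask₂ j - S.h ⬝ᵥ x (remaining I j) := by
    rw [bobOutput, hz]
  rw [hout]
  have hKc := card_le_of_fin K
  refine ev_ite (enc := Data.elt) (eval_leE rfl (eval_mulN (eval_constN 2 _)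
    (ev_comp (ev_pair rfl rfl) (eval_cardP K hn _)) (by omega) (by omega)) (by omega))
    (fun _ => ?_) fun _ => ?_
  · refine eval_letE_of (ev_comp (ev_pair (ev_tabVec (k := t)
      (v := genReceive S (syndromeLevel t) K (fun i => (z i).synSymbol) ℓ t j) rfl (by omega)
      fun a => ev_comp (ev_pair (eval_addN (eval_mulN rfl rfl (by omega) (by omega)) rfl ?_)
        (ev_pair rfl (ev_pair rfl (ev_pair (ev_comp (ev_pair rfl rfl) (eval_syndromeLevelP h1 _))
          rfl)))) (eval_genReceiveP hS (syndromeLevel_le t) K (fun i => (z i).syn) j a h1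
            (by omega))) (ev_pair rfl rfl)) (eval_errorOfSyndromeP K _ h1)) ?_
    · have := (finProdFinEquiv (j, a)).2
      have h5 : (finProdFinEquiv (j, a) : ℕ) = a + t * j := rfl
      omega
    · exact ev_sub (ev_vec (v := p.mask₁) (k := j) (ev_comp rfl rfl) rfl hℓ) (ev_dot rfl
        (ev_tabVec (ev_len (v := errorOfSyndrome S K _) rfl hn) hn fun c => ev_add
          (ev_vec (k := c) (ev_nth (k := j) (v := fun j => x (remaining I j)) (enc := Data.ofVec)
            rfl rfl hℓ) rfl hn) (ev_vec rfl rfl hn)) hn)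
  · exact ev_sub (ev_vec (v := p.mask₂) (k := j) (ev_comp rfl rfl) rfl hℓ) (ev_dot rfl
      (ev_nth (k := j) (v := fun j => x (remaining I j)) (enc := Data.ofVec) rfl rfl hℓ) hn)

/-- Bob's second program. -/
def bobOutputP : Prog :=
  .comp
    (matchE (findE (V 1) (notE (leE (countE (lenE (V 5)) (call₂ eqPublicP (nthE (V 3) (V 0)) (V 1)))
        (V 3))))
      (tabE (V 3) .zero) bobDecodeP)
    (.pair (mapE (V 1) (mapE (.comp (V 2) (V 1)) (call₂ polyP (V 1) (V 0)))) (.pair (D 2) (V 0)))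

open scoped Classical in
theorem eval_bobOutputP [Fintype F] (hS : S.IsReedSolomon) (hN : 4 * (t + ℓ + 2) ^ 2 ≤ N)
    (u : Fin (t + ℓ + 1) → Fin (t + 1) → F) (z : Fin (2 * t + 1) → Reply F t ℓ) :
    bobOutputP.eval N (.cons (S.toData ℓ)
      (.cons (Data.ofFamily Data.ofVec u) (Data.ofFamily Reply.toData z))) =
      some (Data.ofVec ((protocol S ℓ).output u z)) := by
  obtain ⟨h1, h2, h3, h4⟩ := loop_bounds hN
  have hn : 2 * t + 1 ≤ N := by omega
  have hr : t + ℓ + 1 ≤ N := by omega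
  refine ev_comp (ev_pair (ev_map (enc := Data.ofVec) (enc' := Data.ofVec) (v := u)
    (w := fun j => S.gen (u j)) rfl hr fun j => ev_map (enc := Data.elt) (enc' := Data.elt)
      (v := S.pts) (w := S.gen (u j)) (ev_comp rfl rfl) hn fun i => ?_) (ev_pair rfl rfl)) ?_
  · rw [hS.1]
    exact ev_poly rfl rfl (by omega)
  have hmaj := majority_eq_find z
  refine ev_match (enc := Reply.toData) (o := (List.ofFn z).find? fun x =>
      decide (¬ (Finset.univ.filter fun i => (z i).pub = x.pub).card ≤ t))
    (ev_find ?_ (by simpa using hn) fun z' _ => ?_) (fun h => ?_) fun z₀ h => ?_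
  · rw [List.map_ofFn]; rfl
  · refine ev_eq (ev_not (eval_leE (eval_countSet (r := 2 * t + 1)
      (Finset.univ.filter fun i => (z i).pub = z'.pub) hn (ev_len (v := S.pts) rfl hn) fun i =>
        ev_eq (ev_call₂ (ev_nth (k := i) (v := z) (enc := Reply.toData) rfl rfl hn) rfl
          (eval_eqPublicP (z i) z' hn hr _)) (by simp)) rfl (by omega))) ?_
    rw [← decide_not]
  · rw [h, Option.map_none] at hmaj
    have : (protocol S ℓ).output u z = 0 := by
      show bobOutput S _ z = 0
      rw [bobOutput, hmaj]
    rw [this]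
    exact ev_tabVec (v := (0 : Fin ℓ → F)) rfl (by omega) fun _ => rfl
  · rw [h, Option.map_some] at hmaj
    exact eval_bobDecodeP hS hN (fun j => S.gen (u j)) z z₀ hmaj

end BobProgram

/-- The loop bound is a polynomial in `n` and `ℓ`, so the three costs are polynomials too, and their
sum serves for all three programs. -/
theorem exists_programs :
    ∃ (bob₁ alice bob₂ : Prog) (p : MvPolynomial (Fin 2) ℕ),
      ∀ (F : Type) [Field F] [Fintype F] [DecidableEq F] (t ℓ : ℕ) (S : Setup F t),
        2 * t + 1 < Fintype.card F → S.IsReedSolomon →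
          Implements bob₁ alice bob₂ S ℓ (MvPolynomial.eval ![2 * t + 1, ℓ] p) := by
  let X : MvPolynomial (Fin 2) ℕ := 4 * (MvPolynomial.X 0 + MvPolynomial.X 1 + 2) ^ 2
  refine ⟨bobSendP, aliceP, bobOutputP, bobSendP.cost X + aliceP.cost X + bobOutputP.cost X, ?_⟩
  intro F _ _ _ t ℓ S _ hS
  set N := MvPolynomial.eval ![2 * t + 1, ℓ] X with hNdef
  have hX : N = 4 * (2 * t + 1 + ℓ + 2) ^ 2 := by simp [hNdef, X]
  have hN : 4 * (t + ℓ + 2) ^ 2 ≤ N := by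
    rw [hX]; gcongr; omega
  have hcost : ∀ p : Prog, MvPolynomial.eval ![2 * t + 1, ℓ] (p.cost X) = p.cost N :=
    fun p => Prog.map_cost _ _ _
  rw [map_add, map_add, hcost, hcost, hcost]
  refine ⟨fun u => ?_, fun s y => ?_, fun u z => ?_⟩
  · have := Prog.run_of_eval _ _ _ (eval_bobSendP hS hN u)
    exact ⟨this.1, by omega⟩
  · have := Prog.run_of_eval _ _ _ (eval_aliceP hS hN s y)
    exact ⟨this.1, by omega⟩
  · have := Prog.run_of_eval _ _ _ (eval_bobOutputP hS hN u z)
    exact ⟨this.1, by omega⟩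

end PSMT

namespace PSMT

/-! ### Reliability -/

section PseudoBasis

variable {F : Type} [Field F] [DecidableEq F] {t r : ℕ} (S : Setup F t)
  (y : Fin r → Fin (2 * t + 1) → F)

/-- By strong induction: a syndrome that was not admitted is a combination of earlier ones, which
are already in the span. -/
theorem syndrome_mem_span (j : Fin r) : S.H.mulVec (y j) ∈
    Submodule.span F ((fun i => S.H.mulVec (y i)) '' (pseudoBasis S y : Set (Fin r))) := by
  induction j using WellFoundedLT.induction with
  | ind j ih =>
    by_cases hj : j ∈ pseudoBasis S y
    · exact Submodule.subset_span ⟨j, hj, rfl⟩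
    · rw [mem_pseudoBasis, not_not] at hj
      refine (Submodule.span_le.2 ?_) hj
      rintro _ ⟨i, hi, rfl⟩
      exact ih i hi

/-- Greedy choice: indices are admitted in increasing order, each only if its syndrome lies outside
the span of all earlier ones and thus of those already admitted. -/
theorem linearIndepOn_pseudoBasis :
    LinearIndepOn F (fun i => S.H.mulVec (y i)) (pseudoBasis S y : Set (Fin r)) := by
  have : ∀ k ≤ r, LinearIndepOn F (fun i => S.H.mulVec (y i))
      {i : Fin r | i ∈ pseudoBasis S y ∧ (i : ℕ) < k} := by
    intro k
    induction k with
    | zero => intro _; simp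
    | succ k ih =>
      intro hk
      have ih := ih (by omega)
      by_cases hj : (⟨k, hk⟩ : Fin r) ∈ pseudoBasis S y
      · have h1 : {i : Fin r | i ∈ pseudoBasis S y ∧ (i : ℕ) < k + 1} =
            insert ⟨k, hk⟩ {i : Fin r | i ∈ pseudoBasis S y ∧ (i : ℕ) < k} := by
          ext i
          simp only [Set.mem_ofPred_eq, Set.mem_insert_iff, Fin.ext_iff]
          constructor
          · rintro ⟨h2, h3⟩
            rcases Nat.lt_succ_iff_lt_or_eq.1 h3 with h4 | h4
            · exact Or.inr ⟨h2, h4⟩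
            · exact Or.inl h4
          · rintro (h2 | ⟨h2, h3⟩)
            · have : i = ⟨k, hk⟩ := Fin.ext h2
              exact ⟨this ▸ hj, by omega⟩
            · exact ⟨h2, by omega⟩
        rw [h1]
        refine ih.insert fun hmem => mem_pseudoBasis.1 hj (Submodule.span_mono ?_ hmem)
        rintro _ ⟨i, hi, rfl⟩
        exact ⟨i, hi.2, rfl⟩
      · refine ih.mono fun i hi => ⟨hi.1, ?_⟩
        have : i ≠ ⟨k, hk⟩ := fun h => hj (h ▸ hi.1)
        have h2 := hi.2
        rw [Ne, Fin.ext_iff] at this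
        dsimp only at this
        omega
  refine (this r le_rfl).mono fun i hi => ⟨hi, i.2⟩

/-- Syndromes have length `t`. In the protocol this leaves at least `ℓ + 1` of the `t + ℓ + 1` words
outside the pseudo-basis. -/
theorem card_pseudoBasis_le : (pseudoBasis S y).card ≤ t := by
  have h : LinearIndependent F fun i : pseudoBasis S y => S.H.mulVec (y i) :=
    linearIndepOn_pseudoBasis S y
  simpa using h.fintype_card_le_finrank

/-- Vectors with linearly independent syndromes are not all supported on a small set. -/
theorem card_pseudoBasis_le_of_support {e : Fin r → Fin (2 * t + 1) → F}
    (he : ∀ i ∈ pseudoBasis S y, S.H.mulVec (e i) = S.H.mulVec (y i))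
    {Z : Finset (Fin (2 * t + 1))} (hZ : ∀ i ∈ pseudoBasis S y, ∀ c ∉ Z, e i c = 0) :
    (pseudoBasis S y).card ≤ Z.card := by
  have h : LinearIndependent F fun i : pseudoBasis S y => S.H.mulVec (y i) :=
    linearIndepOn_pseudoBasis S y
  -- The syndromes factor through the restrictions of the `e i` to `Z`, which are then independent
  -- in a space of dimension `|Z|`.
  have h1 : (fun i : pseudoBasis S y => S.H.mulVec (y i)) =
      (S.H.submatrix id (fun c : Z => (c : Fin (2 * t + 1)))).mulVecLin ∘
        fun i : pseudoBasis S y => fun c : Z => e i c := by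
    funext i a
    rw [← he i i.2]
    simp only [Matrix.mulVec, dotProduct, Function.comp, Matrix.mulVecLin_apply,
      Matrix.submatrix_apply, id]
    rw [Finset.sum_coe_sort Z fun c => S.H a c * e i c]
    refine (Finset.sum_subset (Finset.subset_univ _) fun c _ hc => ?_).symm
    rw [hZ i i.2 c hc, mul_zero]
  rw [h1] at h
  have h2 := h.of_comp.fintype_card_le_finrank
  simpa using h2

end PseudoBasis

/-! ### The weight of the error of the special word -/

section SpecialWord

variable {F : Type} [Field F] [DecidableEq F] {t r : ℕ} (S : Setup F t)

/-- Excluded are only `0` and the values `-f j / e j` for `j` in the support of `f`: at most `1 + t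
/ 3` elements, while the list offers `2t + 1`. -/
theorem pickMultiplier_spec {f : Fin (2 * t + 1) → F} (hf : 3 * hammingNorm f ≤ t)
    (e : Fin (2 * t + 1) → F) : pickMultiplier S f e ≠ 0 ∧
      ∀ j, f j ≠ 0 → f j + pickMultiplier S f e * e j ≠ 0 := by
  unfold pickMultiplier
  cases h : (List.ofFn S.pts).find? fun a => decide (a ≠ 0 ∧ ∀ j, f j ≠ 0 → f j + a * e j ≠ 0) with
  | some a =>
    have := List.find?_some h
    simpa using this
  | none =>
    rw [List.find?_eq_none] at h
    have hbad : Finset.univ.image S.pts ⊆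
        insert 0 ((Finset.univ.filter fun j => f j ≠ 0).image fun j => -f j * (e j)⁻¹) := by
      intro a ha
      obtain ⟨i, _, rfl⟩ := Finset.mem_image.1 ha
      have := h (S.pts i) ((List.mem_ofFn' _ _).2 ⟨i, rfl⟩)
      by_contra hn
      rw [Finset.mem_insert, not_or] at hn
      apply this
      rw [decide_eq_true_eq]
      refine ⟨hn.1, fun j hj h0 => hn.2 (Finset.mem_image.2 ⟨j, by simpa using hj, ?_⟩)⟩
      have hej : e j ≠ 0 := fun he => hj (by simpa [he] using h0)
      field_simp
      linear_combination -h0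
    have h1 := Finset.card_le_card hbad
    rw [Finset.card_image_of_injective _ S.pts_injective] at h1
    have h2 := Finset.card_insert_le (0 : F)
      ((Finset.univ.filter fun j => f j ≠ 0).image fun j => -f j * (e j)⁻¹)
    have h3 : ((Finset.univ.filter fun j => f j ≠ 0).image fun j => -f j * (e j)⁻¹).card ≤
        hammingNorm f := Finset.card_image_le
    simp only [Finset.card_univ, Fintype.card_fin] at h1
    -- The list can be exhausted only for `t = 0`; then `f = 0`, and the default value `1` is
    -- admissible.
    have hf0 : f = 0 := by
      rw [← hammingNorm_eq_zero]; omega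
    simp [hf0]

theorem hammingNorm_add_le {n : ℕ} (f g : Fin n → F) :
    hammingNorm (f + g) ≤ hammingNorm f + hammingNorm g := by
  refine (Finset.card_le_card (t := (Finset.univ.filter fun i => f i ≠ 0) ∪
    Finset.univ.filter fun i => g i ≠ 0) fun i hi => ?_).trans (Finset.card_union_le _ _)
  simp only [Finset.mem_filter, Finset.mem_univ, true_and, Pi.add_apply, Finset.mem_union] at hi ⊢
  by_contra h
  push Not at h
  exact hi (by simp [h.1, h.2])

theorem hammingNorm_smul_le {n : ℕ} (a : F) (g : Fin n → F) :
    hammingNorm (a • g) ≤ hammingNorm g := by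
  refine Finset.card_le_card fun i hi => ?_
  simp only [Finset.mem_filter, Finset.mem_univ, true_and, Pi.smul_apply, smul_eq_mul] at hi ⊢
  exact right_ne_zero_of_mul hi

/-- The multipliers prevent cancellation, so the support of the running combination contains all
supports met so far. At the moment of stopping, two vectors of weight at most `t / 3` have been
added, whence the upper bound `2t / 3`. -/
theorem combine_spec {e : Fin r → Fin (2 * t + 1) → F} (L : List (Fin r))
    (hL : ∀ i ∈ L, 3 * hammingNorm (e i) ≤ t) (f : Fin (2 * t + 1) → F) (c : Fin r → F)
    (hf : f = ∑ i, c i • e i) (hw : 3 * hammingNorm f ≤ t) :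
    (∀ j ∉ L, combine S e L f c j = c j) ∧
      ((t < 3 * hammingNorm (∑ i, combine S e L f c i • e i) ∧
        3 * hammingNorm (∑ i, combine S e L f c i • e i) ≤ 2 * t) ∨
      (3 * hammingNorm (∑ i, combine S e L f c i • e i) ≤ t ∧
        (∀ k, f k ≠ 0 → (∑ i, combine S e L f c i • e i) k ≠ 0) ∧
        ∀ i ∈ L, ∀ k, e i k ≠ 0 → (∑ i, combine S e L f c i • e i) k ≠ 0)) := by
  induction L generalizing f c with
  | nil =>
    simp only [combine]
    rw [← hf]
    exact ⟨fun _ _ => trivial, Or.inr ⟨hw, fun _ h => h, by simp⟩⟩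
  | cons i L ih =>
    obtain ⟨ha, hfa⟩ := pickMultiplier_spec S hw (e i)
    set a := pickMultiplier S f (e i) with hadef
    have hsum : f + a • e i = ∑ j, (c + Pi.single i a : Fin r → F) j • e j := by
      simp only [Pi.add_apply, add_smul, Finset.sum_add_distrib, ← hf]
      congr 1
      rw [Finset.sum_eq_single i]
      · simp
      · intro j _ hj; simp [hj]
      · simp
    have hei := hL i (by simp)
    have hcoef : ∀ j ∉ i :: L, (c + Pi.single i a : Fin r → F) j = c j := by
      intro j hj
      have : j ≠ i := fun h => hj (by simp [h])
      simp [this]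
    have hsupp : ∀ k, f k ≠ 0 ∨ e i k ≠ 0 → (f + a • e i) k ≠ 0 := by
      intro k hk
      by_cases h0 : f k = 0
      · have := hk.resolve_left (not_not.2 h0)
        simp [h0, ha, this]
      · exact hfa k h0
    rw [combine]
    simp only [← hadef]
    split_ifs with h
    · refine ⟨hcoef, Or.inl ?_⟩
      rw [← hsum]
      have h1 := hammingNorm_add_le f (a • e i)
      have h2 := hammingNorm_smul_le a (e i)
      exact ⟨h, by omega⟩
    · obtain ⟨h1, h2⟩ := ih (fun j hj => hL j (by simp [hj])) (f + a • e i) (c + Pi.single i a) hsum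
        (by omega)
      refine ⟨fun j hj => (h1 j fun hj' => hj (by simp [hj'])).trans (hcoef j hj), ?_⟩
      rcases h2 with h2 | ⟨h2, h3, h4⟩
      · exact Or.inl h2
      · refine Or.inr ⟨h2, fun k hk => h3 k (hsupp k (Or.inl hk)), ?_⟩
        intro j hj k hk
        rcases List.mem_cons.1 hj with rfl | hj
        · exact h3 k (hsupp k (Or.inr hk))
        · exact h4 j hj k hk

/-- The error of the special word has weight at least the level at which the pseudo-basis is sent. -/
theorem basisLevel_le_weight (y e : Fin r → Fin (2 * t + 1) → F)
    (he : ∀ i, y i - e i ∈ LinearMap.range S.gen) :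
    basisLevel t (pseudoBasis S y).card ≤ hammingNorm
      (∑ i ∈ pseudoBasis S y, specialCoeff S y (pseudoBasis S y) i • e i) := by
  set I := pseudoBasis S y with hI
  have hsort : ∀ i, i ∈ I.sort (· ≤ ·) ↔ i ∈ I := fun i => Finset.mem_sort _
  have hsingle : ∀ i ∈ I, ∑ j ∈ I, (Pi.single i 1 : Fin r → F) j • e j = e i := by
    intro i hi
    rw [Finset.sum_eq_single_of_mem i hi]
    · simp
    · intro j _ hj; simp [hj]
  -- The level is at most `⌈t / 3⌉`, so any weight above `t / 3` is enough.
  have hgoal : ∀ k, t < 3 * k → basisLevel t I.card ≤ k := by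
    intro k hk; unfold basisLevel; omega
  cases h1 : (I.sort (· ≤ ·)).find? fun i => (decodeError S (y i)).isNone with
  | some i =>
    have hμ : specialCoeff S y I = Pi.single i 1 := by simp only [specialCoeff, h1]
    have hiI := (hsort i).1 (List.mem_of_find?_eq_some h1)
    rw [hμ, hsingle i hiI]
    have hnone : decodeError S (y i) = none := by
      simpa using List.find?_some h1
    -- Undecodability concerns the true error too: its weight is above `t / 2`.
    have := decodeError_eq_none.1 hnone (e i) (he i)
    exact hgoal _ (by omega)
  | none =>
    rw [List.find?_eq_none] at h1
    have hdec : ∀ i ∈ I, decodeError S (y i) = some ((decodeError S (y i)).getD 0) := by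
      intro i hi
      have := h1 i ((hsort i).2 hi)
      cases h : decodeError S (y i) with
      | none => simp [h] at this
      | some e => rfl
    have h1' : (I.sort (· ≤ ·)).find? (fun i => (decodeError S (y i)).isNone) = none := by
      rw [List.find?_eq_none]; exact h1
    set d : Fin r → Fin (2 * t + 1) → F := fun i => (decodeError S (y i)).getD 0 with hd
    cases h2 : (I.sort (· ≤ ·)).find? fun i => decide (t < 3 * hammingNorm (d i)) with
    | some i =>
      have hμ : specialCoeff S y I = Pi.single i 1 := by
        simp only [specialCoeff, h1']
        rw [hd] at h2
        simp only [h2]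
      have hiI := (hsort i).1 (List.mem_of_find?_eq_some h2)
      rw [hμ, hsingle i hiI]
      have hwt : t < 3 * hammingNorm (d i) := by simpa using List.find?_some h2
      apply hgoal
      -- A true error of weight at most `t / 3` would be the decoded one, whose weight is above `t /
      -- 3`.
      by_contra hlt
      have h3 := decodeError_eq_some (S := S) (y := y i) (e := e i) (by omega) (he i)
      have h4 := hdec i hiI
      rw [h3] at h4
      rw [hd] at hwt
      simp only [h3, Option.getD_some] at hwt
      omega
    | none =>
      have h2' := h2
      rw [List.find?_eq_none] at h2'
      have hlow : ∀ i ∈ I, 3 * hammingNorm (d i) ≤ t := by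
        intro i hi
        simpa using h2' i ((hsort i).2 hi)
      cases hL : I.sort (· ≤ ·) with
      | nil =>
        have : I.card = 0 := by rw [← Finset.length_sort (· ≤ ·), hL]; rfl
        simp [basisLevel, this]
      | cons i L =>
        have hmem : ∀ j, j ∈ I ↔ j = i ∨ j ∈ L := by
          intro j; rw [← hsort, hL, List.mem_cons]
        have hμ : specialCoeff S y I = combine S d L (d i) (Pi.single i 1) := by
          simp only [specialCoeff, h1']
          rw [hd] at h2
          simp only [h2]
          simp only [hL]
          rfl
        have hstart : d i = ∑ j, (Pi.single i 1 : Fin r → F) j • d j := by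
          rw [Finset.sum_eq_single i]
          · simp
          · intro j _ hj; simp [hj]
          · simp
        obtain ⟨hc, hcase⟩ := combine_spec S L (fun j hj => hlow j ((hmem j).2 (Or.inr hj))) (d i)
          (Pi.single i 1) hstart (hlow i ((hmem i).2 (Or.inl rfl)))
        rw [← hμ] at hc hcase
        set μ := specialCoeff S y I with hμdef
        have hzero : ∀ j ∉ I, μ j = 0 := by
          intro j hj
          rw [hmem, not_or] at hj
          rw [hc j hj.2]
          simp [hj.1]
        have hfd : ∑ j, μ j • d j = ∑ j ∈ I, μ j • d j := by
          refine (Finset.sum_subset (Finset.subset_univ _) fun j _ hj => ?_).symm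
          rw [hzero j hj, zero_smul]
        set f := ∑ j ∈ I, μ j • e j with hf
        rw [hfd] at hcase
        set f' := ∑ j ∈ I, μ j • d j with hf'
        by_cases hff : f' = f
        · rw [← hff]
          rcases hcase with ⟨h3, _⟩ | ⟨_, h4, h5⟩
          · exact hgoal _ h3
          -- The search ran to its end: the support of `f'` contains those of all decoded errors,
          -- whose syndromes are independent, so it has at least `|I|` elements.
          · refine (min_le_left _ _).trans ?_
            refine card_pseudoBasis_le_of_support S y (e := d) (fun j hj => ?_)
              (Z := Finset.univ.filter fun k => f' k ≠ 0) fun j hj k hk => ?_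
            · have := (decodeError_some (hdec j hj)).2
              rw [← S.H_spec, Matrix.mulVec_sub, sub_eq_zero] at this
              exact this.symm
            · by_contra hne
              apply hk
              rw [Finset.mem_filter]
              refine ⟨Finset.mem_univ _, ?_⟩
              rcases (hmem j).1 hj with rfl | hj
              · exact h4 k hne
              · exact h5 j hj k hne
        -- The two combinations differ by a nonzero codeword, so their weights add up to more than
        -- `t`; as `f'` has weight at most `2t / 3`, more than `t / 3` is left for `f`.
        · have hC : f' - f ∈ LinearMap.range S.gen := by
            rw [hf, hf', ← Finset.sum_sub_distrib]
            refine Submodule.sum_mem _ fun j hj => ?_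
            rw [← smul_sub]
            refine Submodule.smul_mem _ _ ?_
            have := Submodule.sub_mem _ (he j) (decodeError_some (hdec j hj)).2
            simpa [hd] using this
          have hlt : t < hammingNorm f' + hammingNorm f := by
            by_contra hle
            exact hff (S.eq_of_weight (y := f') (by simp) hC (by omega))
          apply hgoal
          rcases hcase with ⟨_, h3⟩ | ⟨h3, _⟩ <;> omega

end SpecialWord
end PSMT

namespace PSMT

/-! ### Bob's output is the secret -/

section Reliability

variable {F : Type} [Field F] [DecidableEq F] {t ℓ : ℕ} {S : Setup F t}

theorem lt_numBlocks {N m p : ℕ} (hp : p < N) : p / (m + 1) < numBlocks N m := by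
  unfold numBlocks
  rw [Nat.lt_iff_add_one_le, Nat.le_div_iff_mul_le (by omega)]
  have := Nat.div_mul_le_self p (m + 1)
  have : (p / (m + 1) + 1) * (m + 1) = p / (m + 1) * (m + 1) + (m + 1) := by ring
  omega

/-- Outside `T` everything arrives intact, so apart from the erasures in `K` at most `|T| - |K| ≤ t
- |K|` symbols of each codeword are wrong. -/
theorem genReceive_eq {m a b : ℕ} {K T : Finset (Fin (2 * t + 1))} (hm : m ≤ K.card) (hKT : K ⊆ T)
    (hT : T.card ≤ t) {v : Fin (2 * t + 1) → ℕ → F} {M : Fin a → Fin b → F}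
    (hv : ∀ i ∉ T, ∀ k : Fin (numBlocks (a * b) m), v i k = genBroadcast S m M i k) :
    genReceive S m K v a b = M := by
  funext i j
  set p := finProdFinEquiv (i, j) with hp
  have hdec : genDecode S m K (fun c => v c ((p : ℕ) / (m + 1))) =
      fun c : Fin (m + 1) => flatten M ((p : ℕ) / (m + 1) * (m + 1) + c) := by
    refine genDecode_eq hm ((Finset.card_le_card hKT).trans hT) ?_
    have hsub : (Kᶜ.filter fun i =>
        S.bgen m (fun c => flatten M ((p : ℕ) / (m + 1) * (m + 1) + c)) i ≠
          v i ((p : ℕ) / (m + 1))) ⊆ T \ K := by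
      intro c hc
      rw [Finset.mem_filter, Finset.mem_compl] at hc
      rw [Finset.mem_sdiff]
      refine ⟨?_, hc.1⟩
      by_contra hcT
      exact hc.2 (hv c hcT ⟨_, lt_numBlocks p.2⟩).symm
    refine (Finset.card_le_card hsub).trans ?_
    rw [Finset.card_sdiff_of_subset hKT]
    omega
  unfold genReceive
  rw [← hp, hdec]
  have hmod : (p : ℕ) / (m + 1) * (m + 1) +
      ((Fin.ofNat (m + 1) (p : ℕ) : Fin (m + 1)) : ℕ) = p := by
    rw [Fin.val_ofNat]
    exact Nat.div_add_mod' _ _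
  dsimp only
  rw [hmod, flatten, dif_pos p.2]
  simp only [Fin.eta, hp, Equiv.symm_apply_apply]

theorem lt_length_sort_compl {I : Finset (Fin (t + ℓ + 1))} (hI : I.card ≤ t) :
    ℓ < (Iᶜ.sort (· ≤ ·)).length := by
  rw [Finset.length_sort, Finset.card_compl, Fintype.card_fin]
  omega

/-- Enough words lie outside `I` for the default index in `remaining` never to be used. -/
theorem remaining_eq {I : Finset (Fin (t + ℓ + 1))} (hI : I.card ≤ t) (j : Fin ℓ) :
    remaining I j = (Iᶜ.sort (· ≤ ·))[(j : ℕ)]'(j.2.trans (lt_length_sort_compl hI)) :=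
  List.getD_eq_getElem _ _ _

theorem remaining_notMem {I : Finset (Fin (t + ℓ + 1))} (hI : I.card ≤ t) (j : Fin ℓ) :
    remaining I j ∉ I := by
  rw [← Finset.mem_compl, ← Finset.mem_sort (· ≤ ·), remaining_eq hI]
  exact List.getElem_mem _

theorem remaining_injective {I : Finset (Fin (t + ℓ + 1))} (hI : I.card ≤ t) :
    Function.Injective (remaining (ℓ := ℓ) I) := by
  intro j j' h
  rw [remaining_eq hI, remaining_eq hI] at h
  exact Fin.ext ((Finset.sort_nodup _ _).getElem_inj_iff.1 h)

/-- Errors supported on few channels vanish wherever those on the pseudo-basis do. -/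
theorem error_eq_zero {r : ℕ} {x y : Fin r → Fin (2 * t + 1) → F} {T : Finset (Fin (2 * t + 1))}
    (hT : T.card ≤ t) (hx : ∀ j, x j ∈ LinearMap.range S.gen) (hy : ∀ j, ∀ i ∉ T, y j i = x j i)
    {c : Fin (2 * t + 1)} (hc : ∀ i ∈ pseudoBasis S y, y i c = x i c) (j : Fin r) :
    y j c = x j c := by
  have hsyn : ∀ i, S.H.mulVec (y i) = S.H.mulVec (y i - x i) := by
    intro i
    rw [Matrix.mulVec_sub, (S.H_spec _).2 (hx i), sub_zero]
  have h := syndrome_mem_span S y j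
  rw [Submodule.mem_span_image_finset_iff_exists_fun] at h
  obtain ⟨μ, hμ⟩ := h
  -- The relation between syndromes lifts to the errors, since both sides are supported on `T`.
  have key : ∑ i : pseudoBasis S y, μ i • (y i - x i) = y j - x j := by
    refine S.eq_of_syndrome_eq hT (fun i hi => ?_) (fun i hi => ?_) ?_
    · rw [Finset.sum_apply]
      refine Finset.sum_eq_zero fun k _ => ?_
      simp [hy k i hi]
    · simp [hy j i hi]
    · rw [← hsyn j, ← hμ, ← Matrix.mulVecLin_apply, map_sum]
      refine Finset.sum_congr rfl fun i _ => ?_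
      rw [map_smul, Matrix.mulVecLin_apply, ← hsyn i]
  have := congrFun key c
  rw [Finset.sum_apply, Finset.sum_eq_zero, Pi.sub_apply] at this
  · exact (sub_eq_zero.1 this.symm)
  · intro i _
    simp [hc i i.2]

/-- The core of reliability, with the adversary reduced to a set `T` outside of which the channels
are honest; what arrives on `T` is arbitrary. -/
theorem bobOutput_eq (s : Fin ℓ → F) {x : Fin (t + ℓ + 1) → Fin (2 * t + 1) → F}
    (hx : ∀ j, x j ∈ LinearMap.range S.gen) {T : Finset (Fin (2 * t + 1))} (hT : T.card ≤ t)
    {y : Fin (2 * t + 1) → Fin (t + ℓ + 1) → F} (hy : ∀ i ∉ T, ∀ j, y i j = x j i)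
    {z : Fin (2 * t + 1) → Reply F t ℓ} (hz : ∀ i ∉ T, z i = aliceReply S s y i) :
    bobOutput S x z = s := by
  have hyw : ∀ j, ∀ i ∉ T, words y j i = x j i := fun j i hi => hy i hi j
  have hsub : ∀ j, words y j - (words y j - x j) ∈ LinearMap.range S.gen := fun j => by
    simpa using hx j
  have hmaj : majority t (fun i => (z i).pub) = some (alicePublic S s (words y)) := by
    apply majority_eq_some
    classical
    have hle : Tᶜ.card ≤
        (Finset.univ.filter fun i => (z i).pub = alicePublic S s (words y)).card := by
      refine Finset.card_le_card fun i hi => ?_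
      rw [Finset.mem_filter, hz i (Finset.mem_compl.1 hi)]
      exact ⟨Finset.mem_univ _, rfl⟩
    rw [Finset.card_compl, Fintype.card_fin] at hle
    omega
  set I := pseudoBasis S (words y) with hI
  set p := alicePublic S s (words y) with hp
  have hIt : I.card ≤ t := card_pseudoBasis_le S _
  have hspec : p.special - ∑ i : p.I, p.coeff i • x i =
      ∑ i ∈ I, specialCoeff S (words y) I i • (words y i - x i) := by
    simp only [smul_sub, Finset.sum_sub_distrib]
    congr 1
    exact Finset.sum_coe_sort I fun i => specialCoeff S (words y) I i • x i
  have hK₀ : specialSupport x p ⊆ T := by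
    intro c hc
    rw [specialSupport, Finset.mem_filter, hspec] at hc
    by_contra hcT
    refine hc.2 ?_
    rw [Finset.sum_apply]
    refine Finset.sum_eq_zero fun i _ => ?_
    simp [hyw i c hcT]
  have hK₀' : basisLevel t I.card ≤ (specialSupport x p).card := by
    have := basisLevel_le_weight S (words y) (fun j => words y j - x j) hsub
    rw [← hI, ← hspec] at this
    exact this
  have hbasis : genReceive S (basisLevel t p.I.card) (specialSupport x p)
      (fun i => (z i).basisSymbol) p.I.card (2 * t + 1) =
      fun a => words y (I.orderEmbOfFin rfl a) := by
    refine genReceive_eq hK₀' hK₀ hT fun i hi k => ?_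
    rw [hz i hi]
    exact dif_pos k.2
  set K := globalSupport S x p z with hK
  have hmemK : ∀ c, c ∈ K ↔ ∃ i ∈ I, words y i c ≠ x i c := by
    intro c
    rw [hK, globalSupport, Finset.mem_filter, hbasis]
    simp only [Finset.mem_univ, true_and, sub_ne_zero]
    constructor
    · rintro ⟨a, ha⟩
      exact ⟨_, I.orderEmbOfFin_mem rfl a, ha⟩
    · rintro ⟨i, hi, hne⟩
      have : i ∈ Set.range (I.orderEmbOfFin rfl) := by
        rw [Finset.range_orderEmbOfFin]; exact hi
      obtain ⟨a, rfl⟩ := this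
      exact ⟨a, hne⟩
  have hKT : K ⊆ T := by
    intro c hc
    obtain ⟨i, _, hne⟩ := (hmemK c).1 hc
    by_contra hcT
    exact hne (hyw i c hcT)
  have hzero : ∀ j, ∀ c ∉ K, (words y j - x j) c = 0 := by
    intro j c hc
    rw [Pi.sub_apply, sub_eq_zero]
    refine error_eq_zero hT hx hyw (fun i hi => ?_) j
    by_contra hne
    exact hc ((hmemK c).2 ⟨i, hi, hne⟩)
  funext j
  rw [bobOutput, hmaj]
  simp only
  rw [← hK]
  split_ifs with ht
  -- The global support has at least `⌈t / 2⌉` elements, which is the level of the syndromes.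
  · have hsyn : genReceive S (syndromeLevel t) K (fun i => (z i).synSymbol) ℓ t =
        fun j => S.H.mulVec (words y (remaining I j)) := by
      refine genReceive_eq (by unfold syndromeLevel; omega) hKT hT fun i hi k => ?_
      rw [hz i hi]
      exact dif_pos k.2
    rw [hsyn, errorOfSyndrome_eq ((Finset.card_le_card hKT).trans hT) (hzero (remaining I j))
      (by rw [Matrix.mulVec_sub, (S.H_spec _).2 (hx _), sub_zero])]
    simp only [hp, alicePublic, ← hI]
    rw [add_sub_cancel, add_sub_cancel_right]
  -- All errors now have weight below `t / 2`, so Alice decoded the true ones, and the second mask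
  -- is `h` of Bob's own codeword.
  · have hw := hammingNorm_le_of_support (hzero (remaining I j))
    have hd := decodeError_eq_some (S := S) (by omega) (hsub (remaining I j))
    simp only [hp, alicePublic, ← hI, hd]
    rw [sub_sub_cancel, add_sub_cancel_right]

theorem bobOutput_received (E : Adversary (2 * t + 1) t (Fin (t + ℓ + 1) → F) (Reply F t ℓ))
    [Fintype F] (s : Fin ℓ → F) (u : Fin (t + ℓ + 1) → Fin (t + 1) → F) :
    bobOutput S (fun j => S.gen (u j)) ((protocol S ℓ).received₂ E s u) = s := by
  refine bobOutput_eq s (fun j => ⟨u j, rfl⟩) E.card_le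
    (y := (protocol S ℓ).received₁ E u) (fun i hi j => ?_) fun i hi => ?_
  · rw [TwoRound.received₁, dif_neg hi]; rfl
  · rw [TwoRound.received₂, dif_neg hi]; rfl

theorem isReliable_protocol [Fintype F] (S : Setup F t) (ℓ : ℕ) : (protocol S ℓ).IsReliable t :=
  fun E s u => bobOutput_received E s u

theorem isReliable_bitProtocol [Fintype F] (S : Setup F t) : (bitProtocol S).IsReliable t := by
  intro E s u
  have h : bobOutput S (fun j => S.gen (u j)) ((bitProtocol S).received₂ E s u) =
      fun _ : Fin 1 => if s then (1 : F) else 0 :=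
    bobOutput_received E (fun _ => if s then (1 : F) else 0) u
  change decide (bobOutput S (fun j => S.gen (u j)) ((bitProtocol S).received₂ E s u) 0 = 1) = s
  rw [h]
  cases s <;> simp

end Reliability
end PSMT

namespace PSMT

/-! ### Privacy -/

section Privacy

variable {F : Type} [Field F] [DecidableEq F] {t ℓ : ℕ} {S : Setup F t}

/-- The candidate errors depend only on the coset of the word modulo the code. -/
theorem decodeError_add {y d : Fin (2 * t + 1) → F} (hd : d ∈ LinearMap.range S.gen) :
    decodeError S (y + d) = decodeError S y := by
  have key : ∀ e, y + d - e ∈ LinearMap.range S.gen ↔ y - e ∈ LinearMap.range S.gen := by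
    intro e
    rw [add_sub_right_comm, Submodule.add_mem_iff_left _ hd]
  cases h : decodeError S y with
  | some e =>
    obtain ⟨hw, he⟩ := decodeError_some h
    exact decodeError_eq_some hw ((key e).2 he)
  | none =>
    rw [decodeError_eq_none] at h ⊢
    exact fun e he => h e ((key e).1 he)

/-- Alice's message assembled from its ingredients. -/
def Reply.assemble (S : Setup F t) (I : Finset (Fin (t + ℓ + 1))) (μ : Fin (t + ℓ + 1) → F)
    (w : Fin (2 * t + 1) → F) (m₁ m₂ : Fin ℓ → F) (W : Fin (t + ℓ + 1) → Fin (2 * t + 1) → F)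
    (σ : Fin ℓ → Fin t → F) (i : Fin (2 * t + 1)) : Reply F t ℓ where
  pub := { I := I, coeff := fun i => μ i, special := w, mask₁ := m₁, mask₂ := m₂ }
  basis := genBroadcast S _ (fun a => W (I.orderEmbOfFin rfl a)) i
  syn := genBroadcast S (syndromeLevel t) σ i

/-- Isolates what the message depends on: apart from the masks, only words of the pseudo-basis,
coefficients and syndromes. With `I` as a separate argument it can be replaced by an equal set
although types depend on it. -/
theorem aliceReply_eq_assemble (s : Fin ℓ → F) (y : Fin (2 * t + 1) → Fin (t + ℓ + 1) → F)
    (i : Fin (2 * t + 1)) {I : Finset (Fin (t + ℓ + 1))} (hI : I = pseudoBasis S (words y)) :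
    aliceReply S s y i = Reply.assemble S I (specialCoeff S (words y) I)
      (∑ i ∈ I, specialCoeff S (words y) I i • words y i)
      (alicePublic S s (words y)).mask₁ (alicePublic S s (words y)).mask₂
      (fun j => if j ∈ I then words y j else 0)
      (fun j => S.H.mulVec (words y (remaining I j))) i := by
  subst hI
  have : (fun a : Fin (pseudoBasis S (words y)).card =>
      words y ((pseudoBasis S (words y)).orderEmbOfFin rfl a)) = fun a =>
      if (pseudoBasis S (words y)).orderEmbOfFin rfl a ∈ pseudoBasis S (words y) then
        words y ((pseudoBasis S (words y)).orderEmbOfFin rfl a) else 0 := by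
    funext a
    rw [if_pos (Finset.orderEmbOfFin_mem _ _ _)]
  unfold Reply.assemble
  simp only
  rw [← this]
  rfl

/-- Adding codewords outside the pseudo-basis changes Alice's message like a change of the secret. -/
theorem aliceReply_eq_of_add {s s' : Fin ℓ → F} {y y' : Fin (2 * t + 1) → Fin (t + ℓ + 1) → F}
    {d : Fin (t + ℓ + 1) → Fin (2 * t + 1) → F} (hd : ∀ j, d j ∈ LinearMap.range S.gen)
    (hy : words y' = words y + d) (h0 : ∀ j ∈ pseudoBasis S (words y), d j = 0)
    (hs : ∀ j, dotProduct S.h (d (remaining (pseudoBasis S (words y)) j)) = s j - s' j)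
    (i : Fin (2 * t + 1)) : aliceReply S s' y' i = aliceReply S s y i := by
  have hyj : ∀ j, words y' j = words y j + d j := fun j => congrFun hy j
  have hsyn : ∀ j, S.H.mulVec (words y' j) = S.H.mulVec (words y j) := by
    intro j
    rw [hyj, Matrix.mulVec_add, (S.H_spec _).2 (hd j), add_zero]
  have hdec : ∀ j, decodeError S (words y' j) = decodeError S (words y j) := by
    intro j
    rw [hyj, decodeError_add (hd j)]
  have hI : pseudoBasis S (words y') = pseudoBasis S (words y) := by
    ext j
    simp only [mem_pseudoBasis, hsyn]
  have hμ : specialCoeff S (words y') (pseudoBasis S (words y)) =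
      specialCoeff S (words y) (pseudoBasis S (words y)) := by
    simp only [specialCoeff, hdec]
  have hm₁ : (alicePublic S s' (words y')).mask₁ = (alicePublic S s (words y)).mask₁ := by
    funext j
    simp only [alicePublic, hI]
    rw [hyj, dotProduct_add, hs]
    ring
  have hm₂ : (alicePublic S s' (words y')).mask₂ = (alicePublic S s (words y)).mask₂ := by
    funext j
    simp only [alicePublic, hI, hdec]
    split
    · rw [hyj, dotProduct_sub, dotProduct_sub, dotProduct_add, hs]
      ring
    · rfl
  have hW : ∀ j ∈ pseudoBasis S (words y), words y' j = words y j := by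
    intro j hj
    rw [hyj, h0 j hj, add_zero]
  rw [aliceReply_eq_assemble s y i rfl, aliceReply_eq_assemble s' y' i hI.symm, hμ, hm₁, hm₂]
  congr 1
  · exact Finset.sum_congr rfl fun j hj => by rw [hW j hj]
  · funext j
    split_ifs with hj
    · exact hW j hj
    · rfl
  · funext j
    exact hsyn _

variable [Fintype F]

/-- The pseudo-basis of the words received by Alice. -/
noncomputable def receivedBasis (S : Setup F t)
    (E : Adversary (2 * t + 1) t (Fin (t + ℓ + 1) → F) (Reply F t ℓ))
    (u : Fin (t + ℓ + 1) → Fin (t + 1) → F) : Finset (Fin (t + ℓ + 1)) :=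
  pseudoBasis S (words ((protocol S ℓ).received₁ E u))

/-- Adding the messages `d j` to Bob's coins for the words used to mask the secrets. -/
noncomputable def shiftCoins (S : Setup F t)
    (E : Adversary (2 * t + 1) t (Fin (t + ℓ + 1) → F) (Reply F t ℓ))
    (d : Fin ℓ → Fin (t + 1) → F) (u : Fin (t + ℓ + 1) → Fin (t + 1) → F) :
    Fin (t + ℓ + 1) → Fin (t + 1) → F :=
  fun k => u k + ∑ j, if remaining (receivedBasis S E u) j = k then d j else 0

section Shift

variable {E : Adversary (2 * t + 1) t (Fin (t + ℓ + 1) → F) (Reply F t ℓ)}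
  {d : Fin ℓ → Fin (t + 1) → F} (u : Fin (t + ℓ + 1) → Fin (t + 1) → F)

theorem gen_sum_eq_zero (hd : ∀ j, ∀ i ∈ E.corrupted, S.gen (d j) i = 0) (k : Fin (t + ℓ + 1))
    {i : Fin (2 * t + 1)} (hi : i ∈ E.corrupted) :
    S.gen (∑ j, if remaining (receivedBasis S E u) j = k then d j else 0) i = 0 := by
  rw [map_sum, Finset.sum_apply]
  refine Finset.sum_eq_zero fun j _ => ?_
  split_ifs
  · exact hd j i hi
  · simp

theorem send_shiftCoins (hd : ∀ j, ∀ i ∈ E.corrupted, S.gen (d j) i = 0) {i : Fin (2 * t + 1)}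
    (hi : i ∈ E.corrupted) :
    (protocol S ℓ).send (shiftCoins S E d u) i = (protocol S ℓ).send u i := by
  funext k
  simp only [protocol, shiftCoins, map_add, Pi.add_apply, gen_sum_eq_zero u hd k hi, add_zero]

/-- The adversary sees the same symbols, hence inserts the same ones, and the shift vanishes on her
channels; so the received words change by codewords. -/
theorem words_received_shiftCoins (hd : ∀ j, ∀ i ∈ E.corrupted, S.gen (d j) i = 0) :
    words ((protocol S ℓ).received₁ E (shiftCoins S E d u)) =
      words ((protocol S ℓ).received₁ E u) + fun k =>
        S.gen (∑ j, if remaining (receivedBasis S E u) j = k then d j else 0) := by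
  funext k i
  simp only [words, TwoRound.received₁, Pi.add_apply]
  split_ifs with hi
  · rw [gen_sum_eq_zero u hd k hi, add_zero]
    rw [funext fun j : E.corrupted => send_shiftCoins u hd j.2]
  · simp only [protocol, shiftCoins, map_add, Pi.add_apply]

theorem card_receivedBasis_le : (receivedBasis S E u).card ≤ t := card_pseudoBasis_le S _

/-- Codewords have syndrome zero. The invariance is crucial because the shift itself depends on the
pseudo-basis; it is what makes the shift by `-d` an inverse. -/
theorem receivedBasis_shiftCoins (hd : ∀ j, ∀ i ∈ E.corrupted, S.gen (d j) i = 0) :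
    receivedBasis S E (shiftCoins S E d u) = receivedBasis S E u := by
  rw [receivedBasis, words_received_shiftCoins u hd, receivedBasis]
  ext k
  simp only [mem_pseudoBasis, Pi.add_apply, Matrix.mulVec_add,
    (S.H_spec _).2 (LinearMap.mem_range_self S.gen _), add_zero]

theorem shiftCoins_bijective (hd : ∀ j, ∀ i ∈ E.corrupted, S.gen (d j) i = 0) :
    Function.Bijective (shiftCoins S E d) := by
  have hneg : ∀ d : Fin ℓ → Fin (t + 1) → F, (∀ j, ∀ i ∈ E.corrupted, S.gen (d j) i = 0) →
      ∀ u, shiftCoins S E (-d) (shiftCoins S E d u) = u := by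
    intro d hd u
    funext k
    rw [shiftCoins, receivedBasis_shiftCoins u hd, shiftCoins, add_assoc, ← Finset.sum_add_distrib,
      Finset.sum_eq_zero, add_zero]
    intro j _
    split_ifs <;> simp
  refine Function.bijective_iff_has_inverse.2 ⟨shiftCoins S E (-d), hneg d hd, fun u => ?_⟩
  have := hneg (-d) (fun j i hi => by simp [hd j i hi]) u
  rwa [neg_neg] at this

theorem view_shiftCoins {s s' : Fin ℓ → F} (hd : ∀ j, ∀ i ∈ E.corrupted, S.gen (d j) i = 0)
    (hs : ∀ j, dotProduct S.h (S.gen (d j)) = s j - s' j) :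
    (protocol S ℓ).view E s' (shiftCoins S E d u) = (protocol S ℓ).view E s u := by
  refine Prod.ext (funext fun i => send_shiftCoins u hd i.2) (funext fun i => ?_)
  refine aliceReply_eq_of_add (d := fun k =>
        S.gen (∑ j, if remaining (receivedBasis S E u) j = k then d j else 0))
    (fun k => LinearMap.mem_range_self _ _) (words_received_shiftCoins u hd) (fun k hk => ?_)
    (fun j => ?_) i
  · rw [Finset.sum_eq_zero, map_zero]
    intro j _
    rw [if_neg]
    rintro rfl
    exact remaining_notMem (card_receivedBasis_le u) j hk
  · rw [← hs j, Finset.sum_eq_single_of_mem j (Finset.mem_univ j)]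
    · rw [← receivedBasis, if_pos rfl]
    · intro j' _ hj'
      rw [if_neg]
      exact fun h => hj' (remaining_injective (card_receivedBasis_le u) h)

end Shift

theorem map_uniformOfFintype_of_bijective {X Y : Type} [Fintype X] [Nonempty X] {f g : X → Y}
    {φ : X → X} (hφ : Function.Bijective φ) (h : ∀ u, g (φ u) = f u) :
    (PMF.uniformOfFintype X).map f = (PMF.uniformOfFintype X).map g := by
  have h1 : (PMF.uniformOfFintype X).map φ = PMF.uniformOfFintype X := by
    ext x
    obtain ⟨a, rfl⟩ := hφ.2 x
    rw [PMF.map_apply, tsum_eq_single a]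
    · simp
    · intro b hb
      rw [if_neg]
      exact fun h => hb (hφ.1 h).symm
  rw [show f = g ∘ φ from funext fun u => (h u).symm, ← PMF.map_comp, h1]

theorem map_view_eq (S : Setup F t)
    (E : Adversary (2 * t + 1) t (Fin (t + ℓ + 1) → F) (Reply F t ℓ)) (s s' : Fin ℓ → F) :
    (PMF.uniformOfFintype (Fin (t + ℓ + 1) → Fin (t + 1) → F)).map (fun u =>
      (⟨E, (protocol S ℓ).view E s u⟩ : Σ E : Adversary (2 * t + 1) t (Fin (t + ℓ + 1) → F)
        (Reply F t ℓ), (E.corrupted → _) × (E.corrupted → _))) =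
    (PMF.uniformOfFintype (Fin (t + ℓ + 1) → Fin (t + 1) → F)).map (fun u =>
      (⟨E, (protocol S ℓ).view E s' u⟩ : Σ E : Adversary (2 * t + 1) t (Fin (t + ℓ + 1) → F)
        (Reply F t ℓ), (E.corrupted → _) × (E.corrupted → _))) := by
  have hex : ∀ j, ∃ c, (∀ i ∈ E.corrupted, S.gen c i = 0) ∧
      dotProduct S.h (S.gen c) = s j - s' j := by
    intro j
    -- Applied to the codeword `0`, this gives a codeword that vanishes on the corrupted channels
    -- and has the prescribed value under `h`.
    obtain ⟨_, ⟨c, rfl⟩, h1, h2⟩ := S.h_spec E.corrupted E.card_le 0 (Submodule.zero_mem _)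
      (s j - s' j)
    exact ⟨c, h1, h2⟩
  choose d hd hs using hex
  refine map_uniformOfFintype_of_bijective (shiftCoins_bijective hd) fun u => ?_
  rw [view_shiftCoins u hd hs]

/-- The laws agree for each deterministic adversary, hence also after averaging over her random
choice. -/
theorem isPrivate_protocol (S : Setup F t) (ℓ : ℕ) : (protocol S ℓ).IsPrivate t := by
  intro μ s s'
  congr 1
  funext E
  exact map_view_eq S E s s'

theorem isPrivate_bitProtocol (S : Setup F t) : (bitProtocol S).IsPrivate t := by
  intro μ s s'
  congr 1
  funext E
  exact map_view_eq S E (fun _ => if s then 1 else 0) fun _ => if s' then 1 else 0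

end Privacy
end PSMT

namespace PSMT

/-! ### Existence of Reed–Solomon setups -/

section Existence

open Polynomial

variable {F : Type} [Field F] [DecidableEq F] {n : ℕ}

theorem exists_ofFn_eq {k : ℕ} {p : F[X]} (hp : p.natDegree < k) : ∃ c : Fin k → F, ofFn k c = p :=
  ⟨toFn k p, ofFn_comp_toFn_eq_id_of_natDegree_lt hp⟩

/-- A nonzero polynomial of degree less than `k` has at most `k - 1` roots, and the nodal polynomial
of `k - 1` of the points attains this. -/
theorem isMDS_rsEncoder {α : Fin n → F} (hα : Function.Injective α) {k : ℕ} (hk : 0 < k)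
    (hkn : k ≤ n) : IsMDS (rsEncoder α k) := by
  have hzero : ∀ (c : Fin k → F) (Z : Finset (Fin n)), k ≤ Z.card →
      (∀ i ∈ Z, rsEncoder α k c i = 0) → c = 0 := by
    intro c Z hZ h
    apply injective_ofFn k
    rw [ofFn_eq_zero_of_eval hα hZ fun i hi => by rw [← rsEncoder_apply]; exact h i hi, map_zero]
  refine ⟨?_, ?_, ?_⟩
  · rw [injective_iff_map_eq_zero]
    intro c hc
    exact hzero c Finset.univ (by simpa using hkn) fun i _ => by rw [hc]; rfl
  · obtain ⟨Z, _, hZ⟩ := Finset.exists_subset_card_eq (s := (Finset.univ : Finset (Fin n)))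
      (n := k - 1) (by simp; omega)
    obtain ⟨c, hc⟩ := exists_ofFn_eq (p := Lagrange.nodal Z α) (k := k)
      (by rw [Lagrange.natDegree_nodal]; omega)
    have hval : ∀ i, rsEncoder α k c i ≠ 0 ↔ i ∉ Z := by
      intro i
      rw [rsEncoder_apply, hc, Lagrange.eval_nodal, Finset.prod_ne_zero_iff]
      constructor
      · intro h hi
        exact h i hi (sub_self _)
      · intro h j hj h0
        exact h (hα (sub_eq_zero.1 h0) ▸ hj)
    have hw : hammingNorm (rsEncoder α k c) = n + 1 - k := by
      have : (Finset.univ.filter fun i => rsEncoder α k c i ≠ 0) = Zᶜ := by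
        ext i; simp [hval]
      rw [hammingNorm, this, Finset.card_compl, Fintype.card_fin]
      omega
    refine ⟨_, LinearMap.mem_range_self _ c, fun h0 => ?_, hw⟩
    rw [h0, hammingNorm_zero] at hw
    omega
  · rintro d ⟨_, ⟨c, rfl⟩, h0, rfl⟩
    by_contra hlt
    apply h0
    have hcard := Finset.card_filter_add_card_filter_not (s := (Finset.univ : Finset (Fin n)))
      fun i => rsEncoder α k c i ≠ 0
    rw [Finset.card_univ, Fintype.card_fin] at hcard
    have hw : hammingNorm (rsEncoder α k c) =
      (Finset.univ.filter fun i => rsEncoder α k c i ≠ 0).card := rfl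
    rw [hzero c (Finset.univ.filter fun i => ¬ rsEncoder α k c i ≠ 0) (by omega)
      (fun i hi => by simpa using hi), map_zero]

/-- The matrix of the quotient map modulo the code, in coordinates of the `m`-dimensional quotient.
-/
theorem exists_parityCheck {F : Type} [Field F] {k m n : ℕ} (hn : m + k = n)
    {g : (Fin k → F) →ₗ[F] (Fin n → F)} (hg : Function.Injective g) :
    ∃ H : Matrix (Fin m) (Fin n) F, ∀ x, H.mulVec x = 0 ↔ x ∈ LinearMap.range g := by
  have h1 := Submodule.finrank_quotient_add_finrank (LinearMap.range g)
  rw [LinearMap.finrank_range_of_inj hg] at h1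
  simp only [Module.finrank_fin_fun] at h1
  let e : ((Fin n → F) ⧸ LinearMap.range g) ≃ₗ[F] (Fin m → F) :=
    LinearEquiv.ofFinrankEq _ _ (by rw [Module.finrank_fin_fun]; omega)
  refine ⟨LinearMap.toMatrix' (e.toLinearMap ∘ₗ (LinearMap.range g).mkQ), fun x => ?_⟩
  rw [LinearMap.toMatrix'_mulVec]
  simp

/-- A linear form on messages extends from the code to the whole space through a left inverse of the
encoder. -/
theorem exists_dotProduct_eq {F : Type} [Field F] {k n : ℕ} {g : (Fin k → F) →ₗ[F] (Fin n → F)}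
    (hg : Function.Injective g) (φ : (Fin k → F) →ₗ[F] F) :
    ∃ h : Fin n → F, ∀ c, dotProduct h (g c) = φ c := by
  obtain ⟨L, hL⟩ := g.exists_leftInverse_of_injective (LinearMap.ker_eq_bot.2 hg)
  refine ⟨fun i => φ (L (Pi.single i 1)), fun c => ?_⟩
  have hLc : L (g c) = c := LinearMap.congr_fun hL c
  have h1 := (φ ∘ₗ L).pi_apply_eq_sum_univ (g c)
  rw [LinearMap.comp_apply, hLc] at h1
  rw [h1, dotProduct]
  refine Finset.sum_congr rfl fun i _ => ?_
  rw [smul_eq_mul, mul_comm, LinearMap.comp_apply]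
  congr 3
  funext j
  simp [Pi.single_apply, eq_comm]

/-- The vector `h` evaluates the message polynomial at a further point `β`, which exists as `q > n`.
The nodal polynomial of `T` has degree at most `t` and vanishes at the points of `T` but not at `β`,
so multiples of it change the value at `β` at will. -/
theorem exists_reedSolomon_setup [Fintype F] {t : ℕ} (hF : 2 * t + 1 < Fintype.card F) :
    ∃ S : Setup F t, S.IsReedSolomon := by
  obtain ⟨ε⟩ := Function.Embedding.nonempty_of_card_le (α := Fin (2 * t + 2)) (β := F)
    (by rw [Fintype.card_fin]; omega)
  set α : Fin (2 * t + 1) → F := fun i => ε i.castSucc with hαdef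
  set β : F := ε (Fin.last _)
  have hα : Function.Injective α := fun i j h => Fin.castSucc_injective _ (ε.injective h)
  have hβ : ∀ i, β ≠ α i := fun i h => (Fin.castSucc_lt_last i).ne' (ε.injective h)
  have hmds : ∀ m ≤ t, IsMDS (rsEncoder α (m + 1)) := fun m hm =>
    isMDS_rsEncoder hα (by omega) (by omega)
  have hgen := hmds t le_rfl
  obtain ⟨H, hH⟩ := exists_parityCheck (m := t) (by omega) hgen.1
  obtain ⟨h, hh⟩ := exists_dotProduct_eq hgen.1 (leval β ∘ₗ ofFn (t + 1))
  refine ⟨{ gen := rsEncoder α (t + 1), gen_mds := hgen, H := H, H_spec := hH, h := h,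
            h_spec := ?_, bgen := fun m => rsEncoder α (m + 1), bgen_mds := hmds, pts := α,
            pts_injective := hα }, rfl, fun _ _ => rfl⟩
  rintro T hT _ ⟨c, rfl⟩ a
  have hnode : (Lagrange.nodal T α).eval β ≠ 0 := by
    rw [Lagrange.eval_nodal, Finset.prod_ne_zero_iff]
    exact fun i _ => sub_ne_zero.2 (hβ i)
  obtain ⟨c', hc'⟩ := exists_ofFn_eq (p := Lagrange.nodal T α) (k := t + 1)
    (by rw [Lagrange.natDegree_nodal]; omega)
  set γ := (a - (ofFn (t + 1) c).eval β) / (Lagrange.nodal T α).eval β with hγ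
  refine ⟨_, LinearMap.mem_range_self _ (c + γ • c'), fun i hi => ?_, ?_⟩
  · simp [rsEncoder_apply, hc', Lagrange.eval_nodal_at_node hi]
  · rw [hh]
    simp only [LinearMap.comp_apply, map_add, map_smul, hc', leval_apply, smul_eq_mul, hγ]
    field_simp
    ring

theorem exists_field_two_pow (t : ℕ) : ∃ (F : Type) (_ : Field F) (_ : Fintype F) (k : ℕ),
    Fintype.card F = 2 ^ k ∧ 2 * t + 1 < 2 ^ k ∧ 2 ^ k ≤ 2 * (2 * t + 1) := by
  set k := Nat.log 2 (2 * t + 1) + 1 with hk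
  have h1 : 2 * t + 1 < 2 ^ k := Nat.lt_pow_succ_log_self one_lt_two _
  have h2 : 2 ^ Nat.log 2 (2 * t + 1) ≤ 2 * t + 1 := Nat.pow_log_le_self 2 (by omega)
  have : Fintype (GaloisField 2 k) := Fintype.ofFinite _
  refine ⟨GaloisField 2 k, inferInstance, inferInstance, k, ?_, h1, ?_⟩
  · rw [← Nat.card_eq_fintype_card, GaloisField.card 2 k (by omega)]
  · rw [hk, pow_succ]; omega

end Existence
end PSMT

namespace PSMT

/-! ### Communication -/

section Communication

/-- For `w ≤ t` the level is at least `w / 3`, so blocks hold more than `w / 3` symbols and `3n` of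
them suffice for `w n` symbols. -/
theorem numBlocks_basis_le {t w : ℕ} (hw : w ≤ t) (n : ℕ) :
    numBlocks (w * n) (basisLevel t w) ≤ 3 * n := by
  rw [numBlocks, ← Nat.lt_succ_iff, Nat.div_lt_iff_lt_mul (by omega)]
  have h : w ≤ 3 * basisLevel t w := by unfold basisLevel; omega
  have := Nat.mul_le_mul_right n h
  nlinarith

/-- Up to rounding, a syndrome costs at most `2t / (t + 2) = 2 - 4 / (t + 2)` symbols per channel.
The saving pays for a term `ℓ / (t + 2) ^ 2` in the length of each of `t + 1` numbers, as it occurs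
in `clog_le`. -/
theorem numBlocks_syndrome_add_le (t ℓ : ℕ) :
    numBlocks (ℓ * t) (syndromeLevel t) + (t + 1) * (ℓ / (t + 2) ^ 2) ≤ 2 * ℓ + 1 := by
  set r := ℓ / (t + 2) ^ 2 with hr
  set N := numBlocks (ℓ * t) (syndromeLevel t) with hN
  have h1 : N * (syndromeLevel t + 1) ≤ ℓ * t + syndromeLevel t := Nat.div_mul_le_self _ _
  have h2 : t ≤ 2 * syndromeLevel t ∧ 2 * syndromeLevel t ≤ t + 1 := by unfold syndromeLevel; omega
  have h3 : r * (t + 2) ^ 2 ≤ ℓ := Nat.div_mul_le_self _ _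
  have h4 : N * (t + 2) ≤ N * (2 * (syndromeLevel t + 1)) := Nat.mul_le_mul_left _ (by omega)
  have h5 : (t + 1) * r * (t + 2) ≤ ℓ := by nlinarith
  refine Nat.le_of_mul_le_mul_right ?_ (show 0 < t + 2 by omega)
  nlinarith

/-- Since `ℓ` may be huge compared with the field, the length of an index is not bounded by a
multiple of `b`. The excess is a fraction of `ℓ` so small that the factor `5` in the rate is not
affected. -/
theorem clog_le {t ℓ b : ℕ} (hb : 2 * t + 2 ≤ 2 ^ b) :
    Nat.clog 2 (t + ℓ + 2) ≤ 2 * b + ℓ / (t + 2) ^ 2 + 1 := by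
  set r := ℓ / (t + 2) ^ 2 with hr
  rw [Nat.clog_le_iff_le_pow one_lt_two]
  have h1 : ℓ < (t + 2) ^ 2 * (r + 1) := Nat.lt_mul_div_succ _ (by positivity)
  have h2 : r + 2 ≤ 2 ^ (r + 1) := Nat.lt_two_pow_self (n := r + 1)
  calc t + ℓ + 2 ≤ (t + 2) ^ 2 * (r + 2) := by nlinarith
    _ ≤ (2 ^ b) ^ 2 * 2 ^ (r + 1) :=
        Nat.mul_le_mul (Nat.pow_le_pow_left (by omega) 2) h2
    _ = 2 ^ (2 * b + r + 1) := by rw [← pow_mul, ← pow_add]; congr 1; ring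

variable {F : Type} [Field F] [DecidableEq F] [Fintype F] {t ℓ : ℕ}

theorem two_mul_add_two_le_pow_symbolBits {F : Type} [Fintype F] {t : ℕ}
    (hF : 2 * t + 1 < Fintype.card F) :
    2 * t + 2 ≤ 2 ^ symbolBits F :=
  le_trans (by omega) (Nat.le_pow_clog one_lt_two _)

theorem symbolBits_pos {F : Type} [Fintype F] {t : ℕ} (hF : 2 * t + 1 < Fintype.card F) :
    0 < symbolBits F := by
  by_contra h
  have := two_mul_add_two_le_pow_symbolBits hF
  rw [Nat.eq_zero_of_not_pos h] at this
  omega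

theorem bits_le {F : Type} [Fintype F] {t ℓ : ℕ} {z : Reply F t ℓ}
    (hF : 2 * t + 1 < Fintype.card F) (hz : z.pub.I.card ≤ t) :
    (t + ℓ + 1) * symbolBits F + z.bits ≤ (5 * ℓ + 9 * (2 * t + 1)) * symbolBits F := by
  set b := symbolBits F with hb
  have hb1 : 1 ≤ b := symbolBits_pos hF
  set w := z.pub.I.card with hw
  have h1 := numBlocks_basis_le hz (2 * t + 1)
  have h2 := numBlocks_syndrome_add_le t ℓ
  have h3 : Nat.clog 2 (t + ℓ + 2) ≤ _ := clog_le (two_mul_add_two_le_pow_symbolBits hF)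
  have h4 : Nat.clog 2 (t + ℓ + 1) ≤ Nat.clog 2 (t + ℓ + 2) := Nat.clog_mono_right 2 (by omega)
  rw [← hb] at h3
  rw [Reply.bits, ← hb, ← hw]
  set N₁ := numBlocks (w * (2 * t + 1)) (basisLevel t w)
  set N₂ := numBlocks (ℓ * t) (syndromeLevel t)
  set r := ℓ / (t + 2) ^ 2
  have h5 : w * Nat.clog 2 (t + ℓ + 1) ≤ t * Nat.clog 2 (t + ℓ + 2) := Nat.mul_le_mul hz h4
  have h6 : (t + 1) * Nat.clog 2 (t + ℓ + 2) ≤ (t + 1) * (3 * b + r) :=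
    Nat.mul_le_mul_left _ (by omega)
  have h7 : (t + 1) * r ≤ (t + 1) * r * b := Nat.le_mul_of_pos_right _ hb1
  calc (t + ℓ + 1) * b + (Nat.clog 2 (t + ℓ + 2) + w * Nat.clog 2 (t + ℓ + 1) +
        (w + (2 * t + 1) + 2 * ℓ + N₁ + N₂) * b)
      ≤ (t + ℓ + 1) * b + ((t + 1) * (3 * b) + (t + 1) * r * b +
        (w + (2 * t + 1) + 2 * ℓ + N₁ + N₂) * b) := by linarith
    _ = (t + ℓ + 1 + (t + 1) * 3 + (w + (2 * t + 1) + 2 * ℓ) + N₁ + (N₂ + (t + 1) * r)) * b := by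
        ring
    -- `5ℓ` consists of `ℓ` for the words, `2ℓ` for the masks and `2ℓ` for the syndromes; the other
    -- terms add up to at most `13t + 9 ≤ 9n`.
    _ ≤ (5 * ℓ + 9 * (2 * t + 1)) * b := Nat.mul_le_mul_right _ (by omega)

theorem transmittedBits_le (S : Setup F t) (hF : 2 * t + 1 < Fintype.card F)
    (E : Adversary (2 * t + 1) t (Fin (t + ℓ + 1) → F) (Reply F t ℓ)) (s : Fin ℓ → F)
    (u : Fin (t + ℓ + 1) → Fin (t + 1) → F) :
    (protocol S ℓ).transmittedBits E s u ≤
      (2 * t + 1) * ((5 * ℓ + 9 * (2 * t + 1)) * symbolBits F) := by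
  rw [TwoRound.transmittedBits, ← Finset.sum_add_distrib]
  refine (Finset.sum_le_card_nsmul _ _ _ fun i _ => bits_le hF ?_).trans (by simp)
  exact card_pseudoBasis_le S _

/-- With `b` bits per symbol, `2 ^ (b - 1) < q ≤ κ n`. As `n ≥ 3 > e` gives `log n ≥ 1`, the
contributions of `κ` and of rounding are absorbed by multiples of `log n`. -/
theorem symbolBits_le {F : Type} [Field F] [Fintype F] {t κ : ℕ} (ht : 1 ≤ t)
    (hκ : Fintype.card F ≤ κ * (2 * t + 1)) :
    (symbolBits F : ℝ) ≤ 2 * (κ + 2) * Real.log ((2 * t + 1 : ℕ) : ℝ) := by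
  set n : ℝ := ((2 * t + 1 : ℕ) : ℝ) with hn
  have hn3 : (3 : ℝ) ≤ n := by rw [hn]; exact_mod_cast (by omega : 3 ≤ 2 * t + 1)
  have hlog : 1 ≤ Real.log n := by
    rw [Real.le_log_iff_exp_le (by linarith)]
    linarith [Real.exp_one_lt_d9]
  have hq : 1 < Fintype.card F := Fintype.one_lt_card
  have hκ0 : 0 < κ := by
    by_contra h
    rw [Nat.eq_zero_of_not_pos h] at hκ
    omega
  have h1 : (2 : ℝ) ^ (symbolBits F - 1) ≤ κ * n := by
    have h2 := (Nat.pow_pred_clog_lt_self one_lt_two hq).le.trans hκ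
    rw [hn]
    exact_mod_cast h2
  have h3 := Real.log_le_log (by positivity) h1
  have hκ1 : (0 : ℝ) < κ := by exact_mod_cast hκ0
  rw [Real.log_pow, Real.log_mul hκ1.ne' (by linarith)] at h3
  have h4 : Real.log κ ≤ κ := (Real.log_le_sub_one_of_pos hκ1).trans (by linarith)
  have h5 : (symbolBits F : ℝ) ≤ (symbolBits F - 1 : ℕ) + 1 := by
    exact_mod_cast (by omega : symbolBits F ≤ symbolBits F - 1 + 1)
  have h6 : (1 / 2 : ℝ) ≤ Real.log 2 := by linarith [Real.log_two_gt_d9]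
  have h7 : (0 : ℝ) ≤ (symbolBits F - 1 : ℕ) := Nat.cast_nonneg _
  nlinarith

theorem rateAtMost (S : Setup F t) (hℓ : 1 ≤ ℓ) (hF : 2 * t + 1 < Fintype.card F) :
    (protocol S ℓ).RateAtMost t (ℓ * symbolBits F)
      (5 * ((2 * t + 1 : ℕ) : ℝ) + 9 * ((2 * t + 1 : ℕ) : ℝ) ^ 2 / (ℓ : ℝ)) := by
  intro E s u
  have h : ((protocol S ℓ).transmittedBits E s u : ℝ) ≤
      ((2 * t + 1) * ((5 * ℓ + 9 * (2 * t + 1)) * symbolBits F) : ℕ) :=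
    Nat.cast_le.2 (transmittedBits_le S hF E s u)
  have hb : (0 : ℝ) < symbolBits F := Nat.cast_pos.2 (symbolBits_pos hF)
  have hl : (0 : ℝ) < ℓ := Nat.cast_pos.2 hℓ
  rw [div_le_iff₀ (by push_cast; positivity)]
  refine h.trans (le_of_eq ?_)
  push_cast
  field_simp

theorem communicationAtMost_bitProtocol {κ : ℕ} (S : Setup F t) (ht : 1 ≤ t)
    (hF : 2 * t + 1 < Fintype.card F) (hκ : Fintype.card F ≤ κ * (2 * t + 1)) :
    (bitProtocol S).CommunicationAtMost t
      (28 * (κ + 2) * ((2 * t + 1 : ℕ) : ℝ) ^ 2 * Real.log ((2 * t + 1 : ℕ) : ℝ)) := by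
  intro E s u
  have h : ((bitProtocol S).transmittedBits E s u : ℝ) ≤
      ((2 * t + 1) * ((5 * 1 + 9 * (2 * t + 1)) * symbolBits F) : ℕ) :=
    Nat.cast_le.2 (transmittedBits_le S hF E (fun _ => if s then 1 else 0) u)
  refine h.trans ?_
  have hb := symbolBits_le (F := F) ht hκ
  -- This is `5 + 9n ≤ 14n`.
  have h1 : (2 * t + 1) * ((5 * 1 + 9 * (2 * t + 1)) * symbolBits F) ≤
      14 * (2 * t + 1) ^ 2 * symbolBits F := by
    rw [← mul_assoc]
    exact Nat.mul_le_mul_right _ (by nlinarith)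
  calc (((2 * t + 1) * ((5 * 1 + 9 * (2 * t + 1)) * symbolBits F) : ℕ) : ℝ)
      ≤ ((14 * (2 * t + 1) ^ 2 * symbolBits F : ℕ) : ℝ) := Nat.cast_le.2 h1
    _ = 14 * ((2 * t + 1 : ℕ) : ℝ) ^ 2 * symbolBits F := by push_cast; ring
    _ ≤ 14 * ((2 * t + 1 : ℕ) : ℝ) ^ 2 * (2 * (κ + 2) * Real.log ((2 * t + 1 : ℕ) : ℝ)) := by gcongr
    _ = _ := by ring

theorem rateAtMost_of_le (S : Setup F t) {ε : ℝ} (hε : 0 < ε)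
    (hℓ : ε * ((2 * t + 1 : ℕ) : ℝ) ≤ (ℓ : ℝ)) (hF : 2 * t + 1 < Fintype.card F) :
    (protocol S ℓ).RateAtMost t (ℓ * symbolBits F) ((5 + 9 / ε) * ((2 * t + 1 : ℕ) : ℝ)) := by
  have hn : (0 : ℝ) < ((2 * t + 1 : ℕ) : ℝ) := by exact_mod_cast Nat.succ_pos _
  have hl : (0 : ℝ) < ℓ := lt_of_lt_of_le (by positivity) hℓ
  intro E s u
  refine (rateAtMost S (Nat.cast_pos.1 hl) hF E s u).trans ?_
  rw [add_mul]
  gcongr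
  rw [div_le_iff₀ hl]
  calc 9 * ((2 * t + 1 : ℕ) : ℝ) ^ 2
      = 9 / ε * ((2 * t + 1 : ℕ) : ℝ) * (ε * ((2 * t + 1 : ℕ) : ℝ)) := by field_simp
    _ ≤ _ := by gcongr

end Communication
end PSMT
-- Assembly of the theorem
theorem mainTheorem2 :
    -- perfect reliability and privacy, for every choice of MDS codes and every `q > n = 2t+1`
    (∀ (F : Type) [Field F] [Fintype F] [DecidableEq F] (t ℓ : ℕ) (S : PSMT.Setup F t),
      2 * t + 1 < Fintype.card F →
        (PSMT.protocol S ℓ).IsReliable t ∧ (PSMT.protocol S ℓ).IsPrivate t ∧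
        (PSMT.bitProtocol S).IsReliable t ∧ (PSMT.bitProtocol S).IsPrivate t) ∧
    -- setups exist: Reed–Solomon codes for every `q > n`, and fields with `q = 2 ^ k ≤ 2n`
    (∀ (F : Type) [Field F] [Fintype F] [DecidableEq F] (t : ℕ),
      2 * t + 1 < Fintype.card F → ∃ S : PSMT.Setup F t, S.IsReedSolomon) ∧
    (∀ t : ℕ, ∃ (F : Type) (_ : Field F) (_ : Fintype F) (k : ℕ),
      Fintype.card F = 2 ^ k ∧ 2 * t + 1 < 2 ^ k ∧ 2 ^ k ≤ 2 * (2 * t + 1)) ∧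
    -- communication complexity `O(n² log n)` for a one-bit secret, when `q = O(n)`
    (∀ κ : ℕ, ∃ c : ℝ, ∀ (F : Type) [Field F] [Fintype F] [DecidableEq F] (t : ℕ)
      (S : PSMT.Setup F t), 1 ≤ t → 2 * t + 1 < Fintype.card F →
      Fintype.card F ≤ κ * (2 * t + 1) →
        (PSMT.bitProtocol S).CommunicationAtMost t
          (c * ((2 * t + 1 : ℕ) : ℝ) ^ 2 * Real.log ((2 * t + 1 : ℕ) : ℝ))) ∧
    -- transmission rate `5n + O(n²/ℓ)`
    (∃ c : ℝ, ∀ (F : Type) [Field F] [Fintype F] [DecidableEq F] (t ℓ : ℕ) (S : PSMT.Setup F t),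
      1 ≤ ℓ → 2 * t + 1 < Fintype.card F →
        (PSMT.protocol S ℓ).RateAtMost t (ℓ * PSMT.symbolBits F)
          (5 * ((2 * t + 1 : ℕ) : ℝ) + c * ((2 * t + 1 : ℕ) : ℝ) ^ 2 / (ℓ : ℝ))) ∧
    -- rate `O(n)` as soon as `ℓ = Ω(n)`
    (∀ ε : ℝ, 0 < ε → ∃ c : ℝ, ∀ (F : Type) [Field F] [Fintype F] [DecidableEq F] (t ℓ : ℕ)
      (S : PSMT.Setup F t), ε * ((2 * t + 1 : ℕ) : ℝ) ≤ (ℓ : ℝ) → 2 * t + 1 < Fintype.card F →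
        (PSMT.protocol S ℓ).RateAtMost t (ℓ * PSMT.symbolBits F)
          (c * ((2 * t + 1 : ℕ) : ℝ))) ∧
    -- in particular already for secrets of `O(n log n)` bits, when `q = O(n)`
    (∀ κ : ℕ, ∃ c : ℝ, ∀ (F : Type) [Field F] [Fintype F] [DecidableEq F] (t : ℕ)
      (S : PSMT.Setup F t), 1 ≤ t → 2 * t + 1 < Fintype.card F →
      Fintype.card F ≤ κ * (2 * t + 1) →
        ∃ ℓ : ℕ, 1 ≤ ℓ ∧
          ((ℓ * PSMT.symbolBits F : ℕ) : ℝ) ≤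
            c * ((2 * t + 1 : ℕ) : ℝ) * Real.log ((2 * t + 1 : ℕ) : ℝ) ∧
          (PSMT.protocol S ℓ).RateAtMost t (ℓ * PSMT.symbolBits F)
            (c * ((2 * t + 1 : ℕ) : ℝ))) ∧
    -- with Reed–Solomon codes, both parties run uniform programs of polynomial running time
    (∃ (bob₁ alice bob₂ : PSMT.Prog) (p : MvPolynomial (Fin 2) ℕ),
      ∀ (F : Type) [Field F] [Fintype F] [DecidableEq F] (t ℓ : ℕ) (S : PSMT.Setup F t),
        2 * t + 1 < Fintype.card F → S.IsReedSolomon →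
          PSMT.Implements bob₁ alice bob₂ S ℓ (MvPolynomial.eval ![2 * t + 1, ℓ] p)) := by
  refine ⟨fun F _ _ _ t ℓ S _ => ⟨PSMT.isReliable_protocol S ℓ, PSMT.isPrivate_protocol S ℓ,
      PSMT.isReliable_bitProtocol S, PSMT.isPrivate_bitProtocol S⟩,
    fun F _ _ _ t hF => PSMT.exists_reedSolomon_setup hF, PSMT.exists_field_two_pow,
    fun κ => ⟨_, fun F _ _ _ t S ht hF hκ => PSMT.communicationAtMost_bitProtocol S ht hF hκ⟩,
    ⟨9, fun F _ _ _ t ℓ S hℓ hF => PSMT.rateAtMost S hℓ hF⟩,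
    fun ε hε => ⟨_, fun F _ _ _ t ℓ S hℓ hF => PSMT.rateAtMost_of_le S hε hℓ hF⟩,
    -- The choice `ℓ = n` has rate at most `(5 + 9) n`; the summand `2 (κ + 2)` bounds the bits of a
    -- field element in units of `log n`.
    fun κ => ⟨14 + 2 * (κ + 2), fun F _ _ _ t S ht hF hκ => ⟨2 * t + 1, by omega, ?_, ?_⟩⟩,
    PSMT.exists_programs⟩
  · have hn : (0 : ℝ) ≤ ((2 * t + 1 : ℕ) : ℝ) := Nat.cast_nonneg _
    have hlog : 0 ≤ Real.log ((2 * t + 1 : ℕ) : ℝ) := Real.log_natCast_nonneg _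
    rw [Nat.cast_mul]
    refine (mul_le_mul_of_nonneg_left (PSMT.symbolBits_le ht hκ) hn).trans ?_
    nlinarith [mul_nonneg hn hlog]
  · intro E s u
    refine (PSMT.rateAtMost_of_le S one_pos (by rw [one_mul]) hF E s u).trans ?_
    have hn : (0 : ℝ) ≤ ((2 * t + 1 : ℕ) : ℝ) := Nat.cast_nonneg _
    refine mul_le_mul_of_nonneg_right ?_ hn
    have : (0 : ℝ) ≤ κ := Nat.cast_nonneg _
    linarith
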